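/- **Setting.** Let $T>0$, $\alpha>\frac13$, $\varepsilon,L>0$, $m,d\ge 0$. For a two-parameter map $g$ write $\|g\|_{\mu}=\sup_{0\le s<t\le T}|g_{st}|/|t-s|^{\mu}$ (and similarly on subintervals), and $\delta z_{st}=z_t-z_s$. *Rough paths.* $(\zeta,\zeta^2)$ is a geometric $\alpha$-Hölder rough path on $[0,T]$: $\zeta:[0,T]\to\mathbb R^d$ with $\zeta_0=0$, $\|\delta\zeta\|_\alpha<\infty$, $\|\zeta^2\|_{2\alpha}<\infty$ and, for $s\le u\le t$, $\zeta^{2;ij}_{st}-\zeta^{2;ij}_{su}-\zeta^{2;ij}_{ut}=\delta\zeta^i_{su}\,\delta\zeta^j_{ut}$ and $\zeta^{2;ij}_{st}+\zeta^{2;ji}_{st}=\delta\zeta^i_{st}\,\delta\zeta^j_{st}$. Let $\zeta^n:[0,T]\to\mathbb R^d$ be continuously differentiable paths with canonical lifts $\zeta^{n,2;ij}_{st}=\int_s^t\delta\zeta^{n,i}_{su}\,d\zeta^{n,j}_u$, such that $\|\delta\zeta^n-\delta\zeta\|_\alpha+\|\zeta^{n,2}-\zeta^2\|_{2\alpha}\to0$.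 *Controls.* Let $U$ be a separable metric space with its Borel $\sigma$-algebra (for instance a subset of $\mathbb R^k$), $\mathcal P_2(U)$ the probability measures on $U$ with finite second moment, with the Wasserstein distance $W_2$, and $\mathcal K\subset\mathcal P_2(U)$ nonempty and compact. Let $\mathcal V^{\varepsilon,L}([s,T])$ be the set of $\gamma:[s,T]\to\mathcal K$ with $W_2(\gamma_r,\gamma_t)\le L|t-r|^{\varepsilon}$ for all $r,t\in[s,T]$. *Coefficients.* * $b:[0,T]\times\mathbb R^m\times U\to\mathbb R^m$ is bounded; $C^1$ in $x$ with bounded derivative; Lipschitz in $a\in U$ near each point with one constant $C$, i.e. for all $t,x,a$ one has $|b(t,x,a')-b(t,x,a)|\le C\,d(a',a)$ for all $a'$ in a neighbourhood of $a$ that may depend on $t,x$; and, for each $x$, uniformly continuous in $t$, uniformly over $a\in U$. * $\sigma:[0,T]\times\mathbb R^m\to\mathbb R^{m\times d}$ is of class $C_b^{1,3}$: $C^1$ in $t$ and $C^3$ in $x$, with $\sigma$, $\partial_t\sigma$ and $\nabla_x^k\sigma$ ($k\le3$) bounded on $[0,T]\times\mathbb R^m$. * $F:[0,T]\times\mathbb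 R^m\times\mathcal K\to\mathbb R$ is bounded, measurable in $t$, Lipschitz in $x$ and Lipschitz in $\gamma\in\mathcal K$ for $W_2$, with constants uniform in the other variables; $G:\mathbb R^m\to\mathbb R$ is bounded and continuous. *State equations.* For $s\in[0,T]$, $y\in\mathbb R^m$, $\gamma\in\mathcal V^{\varepsilon,L}([s,T])$ consider on $[s,T]$ $$x_t=y+\int_s^t\!\int_U b(r,x_r,a)\,\gamma_r(da)\,dr+\int_s^t\sigma(r,x_r)\,d\zeta_r .\tag{1}$$ A solution of (1) is a path $x$ such that, for some $\kappa\in(\frac13,\alpha)$, the couple $(x,\sigma(\cdot,x))$ is weakly controlled by $\zeta$ on $[s,T]$ with exponent $\kappa$ (a couple $(z,z^\zeta)$ is so controlled if $z,z^\zeta$ are $\kappa$-Hölder and $\rho_{rt}=\delta z_{rt}-z^\zeta_r\delta\zeta_{rt}$ has $\|\rho\|_{2\kappa}<\infty$), and (1) holds with the last integral the rough integral of the weakly controlled couple $(\mu,\mu^\zeta)=(\sigma(\cdot,x),\nabla\sigma(\cdot,x)\sigma(\cdot,x))$, i.e. for $s\le r\le t\le T$ $$\int_r^t\mu\,d\zeta=\mu_r\delta\zeta_{rt}+\mu^\zeta_r\zeta^2_{rt}+\Lambda_{rt},$$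 where, with $\rho^{\mu}=\delta\mu-\mu^\zeta\delta\zeta$, $\Lambda$ is the unique two-parameter map with $\|\Lambda\|_{3\kappa}<\infty$ and $\Lambda_{rt}-\Lambda_{ru}-\Lambda_{ut}=\rho^{\mu}_{ru}\delta\zeta_{ut}+\delta\mu^\zeta_{ru}\,\zeta^2_{ut}$ for $r\le u\le t$. When $\zeta$ is replaced by the $C^1$ path $\zeta^n$, (1) is an ordinary integral equation for a continuous path. **Theorem.** Under these assumptions, for all $s\in[0,T]$, $y\in\mathbb R^m$ and $\gamma\in\mathcal V^{\varepsilon,L}([s,T])$, equation (1) driven by $(\zeta,\zeta^2)$ has a unique solution $x^{s,y,\gamma}$, and, for every $n$, equation (1) driven by $\zeta^n$ has a unique continuous solution $x^{s,y,\gamma,n}$. Moreover the value functions $$V(s,y)=\sup_{\gamma\in\mathcal V^{\varepsilon,L}([s,T])}\Big\{\int_s^TF(r,x^{s,y,\gamma}_r,\gamma_r)\,dr+G(x^{s,y,\gamma}_T)\Big\},$$ $$V^n(s,y)=\sup_{\gamma\in\mathcal V^{\varepsilon,L}([s,T])}\Big\{\int_s^TF(r,x^{s,y,\gamma,n}_r,\gamma_r)\,dr+G(x^{s,y,\gamma,n}_T)\Big\}$$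 satisfy $V^n\to V$ locally uniformly on $[0,T]\times\mathbb R^m$ as $n\to\infty$. -/

import Mathlib

open MeasureTheory Set Filter Topology
open scoped ENNReal

noncomputable section

namespace RoughControl

/-- `ℝⁿ` with its Euclidean norm. -/
abbrev E (n : ℕ) : Type := EuclideanSpace ℝ (Fin n)

section Increments

variable {W : Type*} [NormedAddCommGroup W] [NormedSpace ℝ W]

/-- The increment `δz_{st} = z_t - z_s` of a path. -/
def inc (z : ℝ → W) (s t : ℝ) : W := z t - z s

/-- `δg_{sut} = g_{st} - g_{su} - g_{ut}` for a two-parameter map. -/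
def delta (g : ℝ → ℝ → W) (s u t : ℝ) : W := g s t - g s u - g u t

/-- The Hölder norm `sup_{a ≤ s < t ≤ b} |g_{st}| / |t - s|^μ`, with values in `[0, ∞]`. -/
def holderNorm (a b μ : ℝ) (g : ℝ → ℝ → W) : ℝ≥0∞ :=
  ⨆ (s : ℝ) (t : ℝ) (_ : a ≤ s ∧ s < t ∧ t ≤ b), ENNReal.ofReal (‖g s t‖ / (t - s) ^ μ)

/-- `g = Λ(h)` on `[a, b]`: `δg = h` and `g` has finite `θ`-Hölder norm
(for `θ > 1` there is at most one such `g` on the simplex `a ≤ s ≤ t ≤ b`). -/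
def IsSewing (a b θ : ℝ) (h : ℝ → ℝ → ℝ → W) (g : ℝ → ℝ → W) : Prop :=
  (∀ s u t, a ≤ s → s ≤ u → u ≤ t → t ≤ b → delta g s u t = h s u t) ∧
    holderNorm a b θ g < ∞

end Increments

section RoughPaths

variable {d : ℕ}

/-- `(ζ, A)` is a geometric `α`-Hölder rough path on `[0, T]` started at `0`, where
`A s t i j` stands for `∫_s^t (ζ^i_u - ζ^i_s) dζ^j_u`. -/
structure IsGeometricRoughPath (T α : ℝ) (ζ : ℝ → E d) (A : ℝ → ℝ → Fin d → Fin d → ℝ) :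
    Prop where
  zero : ζ 0 = 0
  holder_path : holderNorm 0 T α (inc ζ) < ∞
  holder_area : holderNorm 0 T (2 * α) A < ∞
  chen : ∀ s u t, 0 ≤ s → s ≤ u → u ≤ t → t ≤ T → ∀ i j,
    delta A s u t i j = inc ζ s u i * inc ζ u t j
  geometric : ∀ s t, 0 ≤ s → s ≤ t → t ≤ T → ∀ i j,
    A s t i j + A s t j i = inc ζ s t i * inc ζ s t j

/-- The `α`-Hölder rough path distance on `[0, T]`. -/
def roughDist (T α : ℝ) (ζ₁ : ℝ → E d) (A₁ : ℝ → ℝ → Fin d → Fin d → ℝ)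
    (ζ₂ : ℝ → E d) (A₂ : ℝ → ℝ → Fin d → Fin d → ℝ) : ℝ≥0∞ :=
  holderNorm 0 T α (fun s t => inc ζ₁ s t - inc ζ₂ s t) +
    holderNorm 0 T (2 * α) (fun s t => A₁ s t - A₂ s t)

/-- The time derivative on `[0, T]` of a differentiable path. -/
def pathDeriv (T : ℝ) (ζ : ℝ → E d) (t : ℝ) : E d := derivWithin ζ (Icc 0 T) t

/-- The canonical lift of a `C¹` path: its iterated integrals
`∫_s^t (ζ^i_u - ζ^i_s) dζ^j_u`. -/
def canonicalArea (T : ℝ) (ζ : ℝ → E d) (s t : ℝ) (i j : Fin d) : ℝ :=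
  ∫ u in s..t, inc ζ s u i * pathDeriv T ζ u j

variable {W : Type*} [NormedAddCommGroup W] [NormedSpace ℝ W]

/-- The remainder `ρ_{st} = δz_{st} - z^ζ_s δζ_{st}`. -/
def remainder (ζ : ℝ → E d) (z : ℝ → W) (z' : ℝ → E d →L[ℝ] W) (s t : ℝ) : W :=
  inc z s t - z' s (inc ζ s t)

/-- The couple `(z, z')` is weakly controlled by `ζ` on `[a, b]` with exponent `κ`. -/
structure IsControlled (a b κ : ℝ) (ζ : ℝ → E d) (z : ℝ → W) (z' : ℝ → E d →L[ℝ] W) :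
    Prop where
  holder_path : holderNorm a b κ (inc z) < ∞
  holder_deriv : holderNorm a b κ (inc z') < ∞
  holder_remainder : holderNorm a b (2 * κ) (remainder ζ z z') < ∞

/-- The contraction `∑_{i,j} B(e_i)(e_j) A^{ij}` (in `B v w`, the vector `v` is the direction of
the derivative along `ζ`, and `w` the direction of integration). -/
def contract (B : E d →L[ℝ] E d →L[ℝ] W) (A : Fin d → Fin d → ℝ) : W :=
  ∑ i, ∑ j, A i j • B (EuclideanSpace.single i 1) (EuclideanSpace.single j 1)

/-- `I s t = ∫_s^t μ_u dζ_u` for all `a ≤ s ≤ t ≤ b`, as the rough integral of the weakly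
controlled path `(μ, μ')`, namely
`I = μ δζ + μ' A + Λ(ρ δζ + δμ' A)` with `ρ` the remainder of `(μ, μ')`. -/
def IsRoughIntegral (a b κ : ℝ) (ζ : ℝ → E d) (A : ℝ → ℝ → Fin d → Fin d → ℝ)
    (μ : ℝ → E d →L[ℝ] W) (μ' : ℝ → E d →L[ℝ] E d →L[ℝ] W) (I : ℝ → ℝ → W) : Prop :=
  IsControlled a b κ ζ μ μ' ∧
    ∃ g : ℝ → ℝ → W,
      IsSewing a b (3 * κ)
        (fun s u t => remainder ζ μ μ' s u (inc ζ u t) + contract (inc μ' s u) (A u t)) g ∧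
      ∀ s t, a ≤ s → s ≤ t → t ≤ b →
        I s t = μ s (inc ζ s t) + contract (μ' s) (A s t) + g s t

end RoughPaths

section Wasserstein

variable (U : Type*) [MetricSpace U] [MeasurableSpace U]

/-- Probability measures on `U` with finite second moments. -/
def P2 : Type _ :=
  {m : Measure U // IsProbabilityMeasure m ∧ ∃ a₀ : U, ∫⁻ a, edist a a₀ ^ 2 ∂m < ∞}

variable {U}

/-- The Wasserstein-2 distance. -/
def W2 (m₁ m₂ : P2 U) : ℝ≥0∞ :=
  ⨅ (π : Measure (U × U)) (_ : π.map Prod.fst = m₁.1 ∧ π.map Prod.snd = m₂.1),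
    (∫⁻ p, edist p.1 p.2 ^ 2 ∂π) ^ (1 / 2 : ℝ)

/-- The topology of the Wasserstein-2 distance, generated by its open balls. -/
instance : TopologicalSpace (P2 U) :=
  TopologicalSpace.generateFrom
    {s | ∃ (m : P2 U) (r : ℝ≥0∞), 0 < r ∧ s = {m' | W2 m m' < r}}

/-- The class `𝒱^{ε,L}([s, T])` of `𝒦`-valued paths that are `ε`-Hölder with constant `L`
for the Wasserstein-2 distance. -/
def controls (K : Set (P2 U)) (ε L s T : ℝ) : Set (ℝ → P2 U) :=
  {γ | (∀ r ∈ Icc s T, γ r ∈ K) ∧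
    ∀ r ∈ Icc s T, ∀ t ∈ Icc s T, W2 (γ r) (γ t) ≤ ENNReal.ofReal (L * |t - r| ^ ε)}

end Wasserstein

section Coefficients

variable {m d : ℕ} {U : Type*} [MetricSpace U] [MeasurableSpace U]

/-- The drift: `b ∈ C_b^{0,1,1}([0, T] × ℝᵐ × U; ℝᵐ)`, uniformly continuous in time.
As `U` is a metric space, the bound on the first derivative in `a` is expressed by the metric:
`b` is Lipschitz in `a` near every point, with one constant (if `U` is an open subset of `ℝᵏ` and
`b` is `C¹` in `a`, this says that the derivative in `a` is bounded). -/
def DriftRegular (T : ℝ) (b : ℝ → E m → U → E m) : Prop :=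
  (∃ C : ℝ, ∀ t ∈ Icc (0 : ℝ) T, ∀ a : U,
    ContDiff ℝ 1 (fun x => b t x a) ∧
    ∀ x, ‖b t x a‖ ≤ C ∧ ‖fderiv ℝ (fun x' => b t x' a) x‖ ≤ C ∧
      ∀ᶠ a' in 𝓝 a, ‖b t x a' - b t x a‖ ≤ C * dist a' a) ∧
  ∀ x : E m, ∀ η > 0, ∃ δ > 0, ∀ t ∈ Icc (0 : ℝ) T, ∀ t' ∈ Icc (0 : ℝ) T, |t - t'| < δ →
    ∀ a : U, ‖b t x a - b t' x a‖ ≤ η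

/-- The diffusion coefficient: `σ ∈ C_b^{1,3}([0, T] × ℝᵐ; ℝ^{m,d})`. -/
def DiffusionRegular (T : ℝ) (σ : ℝ → E m → E d →L[ℝ] E m) : Prop :=
  ∃ C : ℝ,
    (∀ t ∈ Icc (0 : ℝ) T, ContDiff ℝ 3 (σ t) ∧
      ∀ x, ∀ k : ℕ, k ≤ 3 → ‖iteratedFDeriv ℝ k (σ t) x‖ ≤ C) ∧
    ∀ x, ContDiffOn ℝ 1 (fun t => σ t x) (Icc 0 T) ∧
      ∀ t ∈ Icc (0 : ℝ) T, ‖derivWithin (fun t' => σ t' x) (Icc 0 T) t‖ ≤ C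

/-- The running reward `F : [0, T] × ℝᵐ × 𝒦 → ℝ`: bounded, measurable in time,
Lipschitz in `x` and (for the Wasserstein-2 distance) in the measure. -/
def RewardRegular (T : ℝ) (K : Set (P2 U)) (F : ℝ → E m → P2 U → ℝ) : Prop :=
  (∀ x, ∀ ν ∈ K, AEStronglyMeasurable (fun t => F t x ν) (volume.restrict (Icc 0 T))) ∧
  ∃ C : ℝ, ∀ t ∈ Icc (0 : ℝ) T,
    (∀ x, ∀ ν ∈ K, |F t x ν| ≤ C) ∧
    (∀ x x', ∀ ν ∈ K, |F t x ν - F t x' ν| ≤ C * ‖x - x'‖) ∧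
    (∀ x, ∀ ν ∈ K, ∀ ν' ∈ K,
      ENNReal.ofReal |F t x ν - F t x ν'| ≤ ENNReal.ofReal C * W2 ν ν')

end Coefficients

section ControlProblem

variable {m d : ℕ} {U : Type*} [MetricSpace U] [MeasurableSpace U]

/-- The relaxed drift `∫_U b(r, x_r, a) γ_r(da)`. -/
def relaxedDrift (b : ℝ → E m → U → E m) (γ : ℝ → P2 U) (x : ℝ → E m) (r : ℝ) : E m :=
  ∫ a, b r (x r) a ∂(γ r).1

/-- On `[s, T]`, `x` solves
`x_t = y + ∫_s^t ∫_U b(r, x_r, a) γ_r(da) dr + ∫_s^t σ(r, x_r) dζ_r`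
in the sense of controlled rough paths: for some `κ ∈ (1/3, α)` the couple `(x, σ(·, x))` is
weakly controlled by `ζ`, and the last integral is the rough integral of `σ(·, x)`, whose
derivative along `ζ` is `∇σ(·, x) σ(·, x)`. -/
def IsRoughSolution (T α : ℝ) (b : ℝ → E m → U → E m) (σ : ℝ → E m → E d →L[ℝ] E m)
    (ζ : ℝ → E d) (A : ℝ → ℝ → Fin d → Fin d → ℝ) (s : ℝ) (y : E m) (γ : ℝ → P2 U)
    (x : ℝ → E m) : Prop :=
  x s = y ∧ ∃ κ : ℝ, 1 / 3 < κ ∧ κ < α ∧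
    IsControlled s T κ ζ x (fun r => σ r (x r)) ∧
    IsRoughIntegral s T κ ζ A (fun r => σ r (x r))
      (fun r => (fderiv ℝ (σ r) (x r)).comp (σ r (x r)))
      (fun r t => inc x r t - ∫ u in r..t, relaxedDrift b γ x u)

/-- On `[s, T]`, `x` is continuous and solves the ordinary integral equation
`x_t = y + ∫_s^t ∫_U b(r, x_r, a) γ_r(da) dr + ∫_s^t σ(r, x_r) dζ_r` driven by a `C¹` path `ζ`. -/
def IsClassicalSolution (T : ℝ) (b : ℝ → E m → U → E m) (σ : ℝ → E m → E d →L[ℝ] E m)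
    (ζ : ℝ → E d) (s : ℝ) (y : E m) (γ : ℝ → P2 U) (x : ℝ → E m) : Prop :=
  ContinuousOn x (Icc s T) ∧ ∀ t ∈ Icc s T,
    x t = y + (∫ r in s..t, relaxedDrift b γ x r) +
      ∫ r in s..t, σ r (x r) (pathDeriv T ζ r)

/-- The objective `J_{sT} = ∫_s^T F(r, x_r, γ_r) dr + G(x_T)`. -/
def objective (T : ℝ) (F : ℝ → E m → P2 U → ℝ) (G : E m → ℝ) (s : ℝ) (γ : ℝ → P2 U)
    (x : ℝ → E m) : ℝ :=
  (∫ r in s..T, F r (x r) (γ r)) + G (x T)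

/-- The value `V(s, y) = sup_γ J_{sT}(γ, y)` of the control problem driven by the rough path
`(ζ, A)`, over the admissible controls `γ` on `[s, T]` and their state paths. -/
def roughValue (T α : ℝ) (b : ℝ → E m → U → E m) (σ : ℝ → E m → E d →L[ℝ] E m)
    (F : ℝ → E m → P2 U → ℝ) (G : E m → ℝ) (K : Set (P2 U)) (ε L : ℝ)
    (ζ : ℝ → E d) (A : ℝ → ℝ → Fin d → Fin d → ℝ) (s : ℝ) (y : E m) : ℝ :=
  sSup {J | ∃ γ ∈ controls K ε L s T, ∃ x, IsRoughSolution T α b σ ζ A s y γ x ∧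
    J = objective T F G s γ x}

/-- The value of the control problem driven by a `C¹` path `ζ`. -/
def classicalValue (T : ℝ) (b : ℝ → E m → U → E m) (σ : ℝ → E m → E d →L[ℝ] E m)
    (F : ℝ → E m → P2 U → ℝ) (G : E m → ℝ) (K : Set (P2 U)) (ε L : ℝ)
    (ζ : ℝ → E d) (s : ℝ) (y : E m) : ℝ :=
  sSup {J | ∃ γ ∈ controls K ε L s T, ∃ x, IsClassicalSolution T b σ ζ s y γ x ∧
    J = objective T F G s γ x}

end ControlProblem

end RoughControl

end

/-
A solution driven by `(ζ, A)` is characterised by its Davie expansion: up to `O(|t - s| ^ (3α))`,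
its increment is the drift increment plus the germ `σ δζ + (∇σ σ) A`. Both the rough and the
classical equation imply such an expansion. By the sewing estimate its remainder is bounded a
priori, on short intervals whose length depends only on the bounds for the coefficients and the
driver, and a second sewing estimate for the difference of two expansions makes solutions Lipschitz
in the initial value and in the driver, with a constant that does not depend on the drift. Uniqueness
is the case of equal drivers; existence follows because the classical solutions form a uniformly
Cauchy sequence whose limit inherits the expansion.

A control enters only through the averaged drift `∫ b(r, x, a) γ_r(da)`. Since controls are Hölder
for the Wasserstein distance, this drift is continuous in time, and its bound and its Lipschitz
constant in `x` are those of `b`. So the stability constant is the same for all controls and initial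
data, and the objectives, hence their suprema, are uniformly close.
-/

noncomputable section

namespace RoughControl

section Sewing

variable {W : Type*} [NormedAddCommGroup W] {a b θ M P : ℝ} {g : ℝ → ℝ → W}

/-- `‖g s t‖ ≤ M (t - s) ^ θ` on the simplex `a ≤ s ≤ t ≤ b`: the explicit form of a bound on
`holderNorm a b θ g`. For `θ > 0` it contains the vanishing of `g` on the diagonal. -/
def HolderBound (a b θ M : ℝ) (g : ℝ → ℝ → W) : Prop :=
  ∀ ⦃s t : ℝ⦄, a ≤ s → s ≤ t → t ≤ b → ‖g s t‖ ≤ M * (t - s) ^ θ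

theorem HolderBound.mono_const {N : ℝ} (hg : HolderBound a b θ M g) (hMN : M ≤ N) :
    HolderBound a b θ N g := fun _ _ hs hst ht =>
  (hg hs hst ht).trans
    (mul_le_mul_of_nonneg_right hMN (Real.rpow_nonneg (sub_nonneg.2 hst) _))

theorem HolderBound.holderNorm_le (hg : HolderBound a b θ M g) :
    holderNorm a b θ g ≤ ENNReal.ofReal M := by
  refine iSup_le fun s => iSup_le fun t => iSup_le fun ⟨hs, hst, ht⟩ =>
    ENNReal.ofReal_le_ofReal ?_
  rw [div_le_iff₀ (Real.rpow_pos_of_pos (sub_pos.2 hst) _)]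
  exact hg hs hst.le ht

theorem HolderBound.holderNorm_lt_top (hg : HolderBound a b θ M g) : holderNorm a b θ g < ∞ :=
  hg.holderNorm_le.trans_lt ENNReal.ofReal_lt_top

theorem holderBound_of_holderNorm_ne_top (h : holderNorm a b θ g ≠ ∞)
    (hdiag : ∀ s, a ≤ s → s ≤ b → g s s = 0) :
    HolderBound a b θ (holderNorm a b θ g).toReal g := by
  intro s t hs hst ht
  rcases hst.eq_or_lt with rfl | hst
  · rw [hdiag s hs ht, norm_zero, sub_self]
    positivity
  have hle : ENNReal.ofReal (‖g s t‖ / (t - s) ^ θ) ≤ holderNorm a b θ g :=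
    le_iSup_of_le s (le_iSup_of_le t (le_iSup_of_le ⟨hs, hst, ht⟩ le_rfl))
  rw [← div_le_iff₀ (Real.rpow_pos_of_pos (sub_pos.2 hst) _)]
  exact (ENNReal.ofReal_le_iff_le_toReal h).1 hle

/-- The constant of the sewing lemma: the sum of the geometric series of ratio `2 ^ (1 - θ)` that
collects the defects of additivity along dyadic partitions. -/
def sewingConst (θ : ℝ) : ℝ := (1 - 2 ^ (1 - θ))⁻¹

theorem two_rpow_one_sub_lt_one (hθ : 1 < θ) : (2 : ℝ) ^ (1 - θ) < 1 :=
  Real.rpow_lt_one_of_one_lt_of_neg one_lt_two (sub_neg.2 hθ)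

theorem one_le_sewingConst (hθ : 1 < θ) : 1 ≤ sewingConst θ := by
  have hpos : 0 < (2 : ℝ) ^ (1 - θ) := by positivity
  exact (one_le_inv₀ (sub_pos.2 (two_rpow_one_sub_lt_one hθ))).2 (by linarith)

theorem two_rpow_mul_sewingConst_add_one (hθ : 1 < θ) :
    2 ^ (1 - θ) * sewingConst θ + 1 = sewingConst θ := by
  have h : (1 - (2 : ℝ) ^ (1 - θ)) * sewingConst θ = 1 :=
    mul_inv_cancel₀ (sub_pos.2 (two_rpow_one_sub_lt_one hθ)).ne'
  linarith

theorem two_mul_half_rpow {x : ℝ} (hx : 0 ≤ x) : 2 * (x / 2) ^ θ = 2 ^ (1 - θ) * x ^ θ := by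
  rw [Real.div_rpow hx two_pos.le, Real.rpow_sub two_pos, Real.rpow_one]
  ring

theorem norm_le_of_delta_midpoint_le {θ' : ℝ} (hθ : 1 < θ) (hg : HolderBound a b θ' M g)
    (hd : HolderBound a b θ P fun s t => delta g s ((s + t) / 2) t) (n : ℕ) {s t : ℝ}
    (hs : a ≤ s) (hst : s ≤ t) (ht : t ≤ b) :
    ‖g s t‖ ≤ sewingConst θ * P * (t - s) ^ θ + (2 ^ (1 - θ')) ^ n * (M * (t - s) ^ θ') := by
  induction n generalizing s t with
  | zero =>
    have hP : 0 ≤ P * (t - s) ^ θ := (norm_nonneg _).trans (hd hs hst ht)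
    have := mul_nonneg (zero_le_one.trans (one_le_sewingConst hθ)) hP
    rw [pow_zero, one_mul]
    linarith [hg hs hst ht]
  | succ n ih =>
    set u := (s + t) / 2 with hu
    have hleft := ih hs (show s ≤ u by linarith) (by linarith)
    have hright := ih (show a ≤ u by linarith) (show u ≤ t by linarith) ht
    rw [show u - s = (t - s) / 2 by rw [hu]; ring] at hleft
    rw [show t - u = (t - s) / 2 by rw [hu]; ring] at hright
    have hsplit : ‖g s t‖ ≤ ‖g s u‖ + ‖g u t‖ + ‖delta g s u t‖ := by
      have : g s t = g s u + g u t + delta g s u t := by simp only [delta]; abel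
      exact this ▸ norm_add₃_le
    calc ‖g s t‖ ≤ sewingConst θ * P * (2 * ((t - s) / 2) ^ θ)
          + (2 ^ (1 - θ')) ^ n * (M * (2 * ((t - s) / 2) ^ θ')) + P * (t - s) ^ θ := by
          linarith [show ‖delta g s u t‖ ≤ P * (t - s) ^ θ from hd hs hst ht]
      _ = (2 ^ (1 - θ) * sewingConst θ + 1) * P * (t - s) ^ θ
          + (2 ^ (1 - θ')) ^ (n + 1) * (M * (t - s) ^ θ') := by
          rw [two_mul_half_rpow (sub_nonneg.2 hst), two_mul_half_rpow (sub_nonneg.2 hst)]; ring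
      _ = _ := by rw [two_rpow_mul_sewingConst_add_one hθ]

theorem HolderBound.of_delta_midpoint {θ' : ℝ} (hθ : 1 < θ) (hθ' : 1 < θ')
    (hg : HolderBound a b θ' M g)
    (hd : HolderBound a b θ P fun s t => delta g s ((s + t) / 2) t) :
    HolderBound a b θ (sewingConst θ * P) g := by
  intro s t hs hst ht
  have hlim : Tendsto (fun n : ℕ => sewingConst θ * P * (t - s) ^ θ
      + (2 ^ (1 - θ')) ^ n * (M * (t - s) ^ θ')) atTop
      (𝓝 (sewingConst θ * P * (t - s) ^ θ + 0 * (M * (t - s) ^ θ'))) :=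
    ((tendsto_pow_atTop_nhds_zero_of_lt_one (by positivity)
      (two_rpow_one_sub_lt_one hθ')).mul_const _).const_add _
  rw [zero_mul, add_zero] at hlim
  exact ge_of_tendsto' hlim fun n => norm_le_of_delta_midpoint_le hθ hg hd n hs hst ht

theorem le_two_mul_of_forall_add_half_mem {x : ℝ} {S : Set ℝ} (hne : S.Nonempty)
    (hx : ∀ y ∈ S, x ≤ y) (hS : ∀ y ∈ S, P + y / 2 ∈ S) : x ≤ 2 * P := by
  have hbdd : BddBelow S := ⟨x, hx⟩
  have hfix : 2 * (sInf S - P) ≤ sInf S :=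
    le_csInf hne fun y hy => by linarith [csInf_le hbdd (hS y hy)]
  linarith [le_csInf hne hx]

theorem rpow_mul_rpow_le_rpow {α θ' h : ℝ} (hα : 0 ≤ α) (hθ : 0 ≤ θ) (hθ' : 1 ≤ θ')
    (hαθ : θ ≤ 1 + α) (h0 : 0 ≤ h) (h1 : h ≤ 1) : h ^ α * h ^ θ' ≤ h ^ θ := by
  rw [← Real.rpow_add_of_nonneg h0 hα (by linarith)]
  exact Real.rpow_le_rpow_of_exponent_ge' h0 h1 hθ (by linarith)

/-- Sewing when the defect of additivity depends linearly on the map itself: on short intervals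
the contribution of the map is absorbed. -/
theorem HolderBound.of_delta_self {α θ' Q : ℝ} (hα : 0 ≤ α) (hθ : 1 < θ) (hθ' : 1 < θ')
    (hαθ : θ ≤ 1 + α) (hab : b - a ≤ 1) (hP : 0 ≤ P) (hQ : 0 ≤ Q)
    (hsmall : sewingConst θ * Q * (b - a) ^ α ≤ 1 / 2) (hg : HolderBound a b θ' M g)
    (hd : ∀ s u t, a ≤ s → s ≤ u → u ≤ t → t ≤ b →
      ‖delta g s u t‖ ≤ P * (t - s) ^ θ + Q * (t - s) ^ α * ‖g s u‖) :
    HolderBound a b θ (2 * (sewingConst θ * P)) g := by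
  have hc : 0 ≤ sewingConst θ := zero_le_one.trans (one_le_sewingConst hθ)
  have hmid {N : ℝ} (hN : ∀ s u t, a ≤ s → s ≤ u → u ≤ t → t ≤ b →
      Q * (t - s) ^ α * ‖g s u‖ ≤ N * (t - s) ^ θ) :
      HolderBound a b θ (sewingConst θ * (P + N)) g :=
    .of_delta_midpoint hθ hθ' hg fun s t hs hst ht => by
      have hu : s ≤ (s + t) / 2 ∧ (s + t) / 2 ≤ t := by constructor <;> linarith
      linarith [hd s _ t hs hu.1 hu.2 ht, hN s _ t hs hu.1 hu.2 ht]
  have hcrude : HolderBound a b θ (sewingConst θ * (P + Q * |M|)) g := by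
    refine hmid fun s u t hs hsu hut ht => ?_
    have hts : 0 ≤ t - s := by linarith
    calc Q * (t - s) ^ α * ‖g s u‖ ≤ Q * (t - s) ^ α * (|M| * (t - s) ^ θ') := by
          gcongr
          exact (hg.mono_const (le_abs_self M) hs hsu (hut.trans ht)).trans (by gcongr)
      _ = Q * |M| * ((t - s) ^ α * (t - s) ^ θ') := by ring
      _ ≤ Q * |M| * (t - s) ^ θ := by
          gcongr
          exact rpow_mul_rpow_le_rpow hα (by linarith) hθ'.le hαθ hts (by linarith)
  have himprove {y : ℝ} (hy0 : 0 ≤ y) (hy : HolderBound a b θ y g) :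
      HolderBound a b θ (sewingConst θ * P + y / 2) g := by
    refine (hmid (N := Q * (b - a) ^ α * y) fun s u t hs hsu hut ht => ?_).mono_const ?_
    · rw [mul_assoc _ y]
      have hts : 0 ≤ t - s := by linarith
      have hts' : t - s ≤ b - a := by linarith
      gcongr
      · exact mul_nonneg hQ (Real.rpow_nonneg (hts.trans hts') _)
      · exact (hy hs hsu (hut.trans ht)).trans (by gcongr)
    · linarith [mul_le_mul_of_nonneg_right hsmall hy0]
  intro s t hs hst ht
  rcases (Real.rpow_nonneg (sub_nonneg.2 hst) θ).eq_or_lt with h0 | hpos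
  · simpa [← h0] using hcrude hs hst ht
  rw [← div_le_iff₀ hpos]
  exact le_two_mul_of_forall_add_half_mem (S := {y | 0 ≤ y ∧ HolderBound a b θ y g})
    ⟨_, by positivity, hcrude⟩ (fun y hy => (div_le_iff₀ hpos).2 (hy.2 hs hst ht))
    fun y hy => ⟨add_nonneg (mul_nonneg hc hP) (by linarith [hy.1]), himprove hy.1 hy.2⟩

end Sewing

section Contract

variable {d : ℕ} {W : Type*} [NormedAddCommGroup W] [NormedSpace ℝ W]

/-- The sum of the absolute values of the entries of a matrix: the norm on areas for which
`‖contract B A‖ ≤ ‖B‖ * entrySum A`. -/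
def entrySum (A : Fin d → Fin d → ℝ) : ℝ := ∑ i, ∑ j, |A i j|

theorem entrySum_nonneg (A : Fin d → Fin d → ℝ) : 0 ≤ entrySum A := by
  unfold entrySum; positivity

theorem entrySum_le (A : Fin d → Fin d → ℝ) : entrySum A ≤ d ^ 2 * ‖A‖ := by
  have hentry (i j) : |A i j| ≤ ‖A‖ := (norm_le_pi_norm (A i) j).trans (norm_le_pi_norm A i)
  calc entrySum A ≤ ∑ _i : Fin d, ∑ _j : Fin d, ‖A‖ :=
        Finset.sum_le_sum fun i _ => Finset.sum_le_sum fun j _ => hentry i j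
    _ = d ^ 2 * ‖A‖ := by
        simp only [Finset.sum_const, Finset.card_univ, Fintype.card_fin, nsmul_eq_mul]; ring

theorem norm_contract_le (B : E d →L[ℝ] E d →L[ℝ] W) (A : Fin d → Fin d → ℝ) :
    ‖contract B A‖ ≤ ‖B‖ * entrySum A := by
  unfold contract entrySum
  rw [Finset.mul_sum]
  refine norm_sum_le_of_le _ fun i _ => ?_
  rw [Finset.mul_sum]
  refine norm_sum_le_of_le _ fun j _ => ?_
  rw [norm_smul, Real.norm_eq_abs, mul_comm]
  gcongr
  simpa using B.le_opNorm₂ (EuclideanSpace.single i 1) (EuclideanSpace.single j 1)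

theorem contract_sub_left (B B' : E d →L[ℝ] E d →L[ℝ] W) (A : Fin d → Fin d → ℝ) :
    contract (B - B') A = contract B A - contract B' A := by
  simp [contract, smul_sub, Finset.sum_sub_distrib]

theorem contract_sub_right (B : E d →L[ℝ] E d →L[ℝ] W) (A A' : Fin d → Fin d → ℝ) :
    contract B (A - A') = contract B A - contract B A' := by
  simp [contract, sub_smul, Finset.sum_sub_distrib]

theorem contract_mul (B : E d →L[ℝ] E d →L[ℝ] W) (v w : E d) :
    contract B (fun i j => v i * w j) = B v w := by
  have hbasis (v : E d) : v = ∑ i, v i • EuclideanSpace.single i (1 : ℝ) := by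
    ext j; simp [Finset.sum_apply, Pi.single_apply]
  conv_rhs => rw [hbasis v, hbasis w]
  simp only [contract, map_sum, map_smul, _root_.sum_apply,
    _root_.smul_apply, Finset.smul_sum, smul_smul]
  rw [Finset.sum_comm]
  simp only [mul_comm]

end Contract

section Taylor

variable {X W : Type*} [NormedAddCommGroup X] [NormedSpace ℝ X]
  [NormedAddCommGroup W] [NormedSpace ℝ W] {f g : X → W} {A B C q : ℝ}

theorem norm_sub_le_of_norm_fderiv_le (hf : Differentiable ℝ f) (hC : ∀ x, ‖fderiv ℝ f x‖ ≤ C)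
    (x y : X) : ‖f x - f y‖ ≤ C * ‖x - y‖ :=
  convex_univ.norm_image_sub_le_of_norm_fderiv_le (fun x _ => hf x) (fun x _ => hC x)
    (mem_univ y) (mem_univ x)

theorem norm_fderiv_sub_le_of_iteratedFDeriv_two (hf : ContDiff ℝ 2 f)
    (hC : ∀ x, ‖iteratedFDeriv ℝ 2 f x‖ ≤ C) (x y : X) :
    ‖fderiv ℝ f x - fderiv ℝ f y‖ ≤ C * ‖x - y‖ := by
  have hf' : ContDiff ℝ 1 (fderiv ℝ f) := hf.fderiv_right (by norm_num)
  refine norm_sub_le_of_norm_fderiv_le (hf'.differentiable (by norm_num)) (fun x => ?_) x y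
  rw [← norm_iteratedFDeriv_one, norm_iteratedFDeriv_fderiv]
  exact hC x

theorem norm_taylor_sub_le (hf : Differentiable ℝ f)
    (hC : ∀ x y, ‖fderiv ℝ f x - fderiv ℝ f y‖ ≤ C * ‖x - y‖) (hC0 : 0 ≤ C) (p v w : X) :
    ‖f (p + v) - f (p + w) - fderiv ℝ f p (v - w)‖ ≤ C * (‖v‖ + ‖w‖) * ‖v - w‖ := by
  have h := (convex_closedBall p (‖v‖ + ‖w‖)).norm_image_sub_le_of_norm_fderiv_le' (𝕜 := ℝ)
    (f := f) (φ := fderiv ℝ f p) (C := C * (‖v‖ + ‖w‖)) (x := p + w) (y := p + v)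
    (fun x _ => hf x) (fun x hx => (hC x p).trans (by
      rw [mem_closedBall_iff_norm] at hx; gcongr)) (by simp) (by simp)
  simpa using h

theorem hasFDerivAt_comp_add_right (hf : Differentiable ℝ f) (x v : X) :
    HasFDerivAt (fun x => f (x + v)) (fderiv ℝ f (x + v)) x :=
  ((hf (x + v)).hasFDerivAt.comp x ((hasFDerivAt_id x).add_const v)).congr_fderiv
    (by ext u; simp)

theorem hasFDerivAt_comp_add_left (hf : Differentiable ℝ f) (v x : X) :
    HasFDerivAt (fun x => f (v + x)) (fderiv ℝ f (v + x)) x := by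
  simpa only [add_comm v] using hasFDerivAt_comp_add_right hf x v

theorem norm_second_difference_le (hf : Differentiable ℝ f)
    (hC : ∀ x y, ‖fderiv ℝ f x - fderiv ℝ f y‖ ≤ C * ‖x - y‖) (p q v : X) :
    ‖f (p + v) - f p - (f (q + v) - f q)‖ ≤ C * ‖p - q‖ * ‖v‖ := by
  have hd (x) : HasFDerivAt (fun x => f (x + v) - f x) (fderiv ℝ f (x + v) - fderiv ℝ f x) x :=
    (hasFDerivAt_comp_add_right hf x v).sub (hf x).hasFDerivAt
  rw [mul_right_comm]
  exact norm_sub_le_of_norm_fderiv_le (fun x => (hd x).differentiableAt)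
    (fun x => by rw [(hd x).fderiv]; simpa using hC (x + v) x) p q

theorem norm_taylor_sub_taylor_le (hf : Differentiable ℝ f)
    (hC : ∀ p q v, ‖fderiv ℝ f (p + v) - fderiv ℝ f p - (fderiv ℝ f (q + v) - fderiv ℝ f q)‖
      ≤ C * ‖p - q‖ * ‖v‖) (hC0 : 0 ≤ C) (p q v : X) :
    ‖f (p + v) - f p - fderiv ℝ f p v - (f (q + v) - f q - fderiv ℝ f q v)‖
      ≤ C * ‖p - q‖ * ‖v‖ ^ 2 := by
  have hd (x) : HasFDerivAt (fun x => f (p + x) - f (q + x))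
      (fderiv ℝ f (p + x) - fderiv ℝ f (q + x)) x :=
    (hasFDerivAt_comp_add_left hf p x).sub (hasFDerivAt_comp_add_left hf q x)
  have h := (convex_closedBall (0 : X) ‖v‖).norm_image_sub_le_of_norm_hasFDerivWithin_le'
    (𝕜 := ℝ) (f := fun x => f (p + x) - f (q + x)) (φ := fderiv ℝ f p - fderiv ℝ f q)
    (C := C * ‖p - q‖ * ‖v‖) (x := 0) (y := v)
    (fun x _ => (hd x).hasFDerivWithinAt) (fun x hx => by
      rw [mem_closedBall_iff_norm, sub_zero] at hx
      rw [sub_sub_sub_comm]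
      exact (hC p q x).trans (by gcongr)) (by simp) (by simp)
  simp only [add_zero, sub_zero, _root_.sub_apply] at h
  calc _ = ‖f (p + v) - f (q + v) - (f p - f q) - (fderiv ℝ f p v - fderiv ℝ f q v)‖ := by
        congr 1; abel
    _ ≤ C * ‖p - q‖ * ‖v‖ * ‖v‖ := h
    _ = _ := by ring

theorem norm_central_difference_sub_le (hf : Differentiable ℝ f)
    (hC : ∀ p q v, ‖fderiv ℝ f (p + v) - fderiv ℝ f p - (fderiv ℝ f (q + v) - fderiv ℝ f q)‖
      ≤ C * ‖p - q‖ * ‖v‖) (hC0 : 0 ≤ C) (x v : X) :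
    ‖f (x + v) - f (x - v) - (2 : ℝ) • fderiv ℝ f x v‖ ≤ C * ‖v‖ ^ 3 := by
  have hd (z) : HasFDerivAt (fun z => f (x + z) - f (x - z))
      (fderiv ℝ f (x + z) + fderiv ℝ f (x - z)) z :=
    ((hasFDerivAt_comp_add_left hf x z).sub ((hf (x - z)).hasFDerivAt.comp z
      ((hasFDerivAt_id z).const_sub x))).congr_fderiv (by ext u; simp)
  have h := (convex_closedBall (0 : X) ‖v‖).norm_image_sub_le_of_norm_hasFDerivWithin_le'
    (𝕜 := ℝ) (f := fun z => f (x + z) - f (x - z)) (φ := (2 : ℝ) • fderiv ℝ f x)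
    (C := C * ‖v‖ * ‖v‖) (x := 0) (y := v)
    (fun z _ => (hd z).hasFDerivWithinAt) (fun z hz => by
      rw [mem_closedBall_iff_norm, sub_zero] at hz
      have hsecond := hC x (x - z) z
      rw [sub_add_cancel, sub_sub_cancel] at hsecond
      calc _ = ‖fderiv ℝ f (x + z) - fderiv ℝ f x - (fderiv ℝ f x - fderiv ℝ f (x - z))‖ := by
            rw [two_smul]; congr 1; abel
        _ ≤ _ := hsecond.trans (by gcongr)) (by simp) (by simp)
  simp only [add_zero, sub_zero, sub_self, _root_.smul_apply] at h
  exact h.trans_eq (by ring)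

theorem norm_le_div_of_norm_apply_le_on_sphere {ℓ : X →L[ℝ] W} (hA : 0 ≤ A) (hq : 0 < q)
    (h : ∀ v, ‖v‖ = q → ‖ℓ v‖ ≤ A) : ‖ℓ‖ ≤ A / q := by
  refine ContinuousLinearMap.opNorm_le_of_unit_norm (by positivity) fun e he => ?_
  have hv := h (q • e) (by rw [norm_smul, he, mul_one, Real.norm_of_nonneg hq.le])
  rw [map_smul, norm_smul, Real.norm_of_nonneg hq.le] at hv
  rw [le_div_iff₀ hq]
  linarith

theorem norm_fderiv_le_of_norm_le_of_lipschitz (hf : Differentiable ℝ f) (hA : ∀ x, ‖f x‖ ≤ A)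
    (hB : ∀ x y, ‖fderiv ℝ f x - fderiv ℝ f y‖ ≤ B * ‖x - y‖)
    (hB0 : 0 ≤ B) (hq : 0 < q) (x : X) : ‖fderiv ℝ f x‖ ≤ (2 * A + B * q ^ 2) / q := by
  have hA0 : 0 ≤ A := (norm_nonneg _).trans (hA x)
  refine norm_le_div_of_norm_apply_le_on_sphere (by positivity) hq fun v hv => ?_
  have h := norm_taylor_sub_le hf hB hB0 x v 0
  simp only [add_zero, sub_zero, norm_zero, hv] at h
  calc ‖fderiv ℝ f x v‖ = ‖f (x + v) - f x - (f (x + v) - f x - fderiv ℝ f x v)‖ := by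
        congr 1; abel
    _ ≤ ‖f (x + v)‖ + ‖f x‖ + ‖f (x + v) - f x - fderiv ℝ f x v‖ :=
        (norm_sub_le _ _).trans (by gcongr; exact norm_sub_le _ _)
    _ ≤ 2 * A + B * q ^ 2 := by linarith [hA (x + v), hA x]

theorem norm_fderiv_le_of_norm_le_of_second_difference (hf : Differentiable ℝ f)
    (hA : ∀ x, ‖f x‖ ≤ A)
    (hB : ∀ p q v, ‖fderiv ℝ f (p + v) - fderiv ℝ f p - (fderiv ℝ f (q + v) - fderiv ℝ f q)‖
      ≤ B * ‖p - q‖ * ‖v‖) (hB0 : 0 ≤ B) (hq : 0 < q) (x : X) :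
    ‖fderiv ℝ f x‖ ≤ (A + B / 2 * q ^ 3) / q := by
  have hA0 : 0 ≤ A := (norm_nonneg _).trans (hA x)
  refine norm_le_div_of_norm_apply_le_on_sphere (by positivity) hq fun v hv => ?_
  have h := norm_central_difference_sub_le hf hB hB0 x v
  have htwo : ‖(2 : ℝ) • fderiv ℝ f x v‖ ≤ 2 * A + B * q ^ 3 := by
    calc _ = ‖f (x + v) - f (x - v) - (f (x + v) - f (x - v) - (2 : ℝ) • fderiv ℝ f x v)‖ := by
          congr 1; abel
      _ ≤ ‖f (x + v)‖ + ‖f (x - v)‖ + ‖f (x + v) - f (x - v) - (2 : ℝ) • fderiv ℝ f x v‖ :=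
          (norm_sub_le _ _).trans (by gcongr; exact norm_sub_le _ _)
      _ ≤ 2 * A + B * q ^ 3 := by rw [hv] at h; linarith [hA (x + v), hA (x - v)]
  rw [norm_smul, Real.norm_of_nonneg two_pos.le] at htwo
  linarith

/-- If two functions differ by `O(q³)` and their derivatives have controlled second differences,
the derivatives differ by `O(q²)`. -/
theorem norm_fderiv_sub_fderiv_le_sq (hf : Differentiable ℝ f) (hg : Differentiable ℝ g)
    (hfC : ∀ p q v, ‖fderiv ℝ f (p + v) - fderiv ℝ f p - (fderiv ℝ f (q + v) - fderiv ℝ f q)‖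
      ≤ C * ‖p - q‖ * ‖v‖)
    (hgC : ∀ p q v, ‖fderiv ℝ g (p + v) - fderiv ℝ g p - (fderiv ℝ g (q + v) - fderiv ℝ g q)‖
      ≤ C * ‖p - q‖ * ‖v‖)
    (hC0 : 0 ≤ C) (hq : 0 ≤ q) (hfg : ∀ x, ‖f x - g x‖ ≤ C * q ^ 3) (x : X) :
    ‖fderiv ℝ f x - fderiv ℝ g x‖ ≤ 2 * C * q ^ 2 := by
  rcases hq.eq_or_lt with rfl | hq
  · obtain rfl : f = g := funext fun x => sub_eq_zero.1 (by simpa using hfg x)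
    simp
  have hd (x) : HasFDerivAt (fun x => f x - g x) (fderiv ℝ f x - fderiv ℝ g x) x :=
    (hf x).hasFDerivAt.sub (hg x).hasFDerivAt
  rw [← (hd x).fderiv]
  refine (norm_fderiv_le_of_norm_le_of_second_difference (fun x => (hd x).differentiableAt) hfg
    (B := 2 * C) (fun p q v => ?_) (by positivity) hq x).trans_eq (by field_simp; ring)
  simp only [(hd _).fderiv]
  calc _ = ‖fderiv ℝ f (p + v) - fderiv ℝ f p - (fderiv ℝ f (q + v) - fderiv ℝ f q)
        - (fderiv ℝ g (p + v) - fderiv ℝ g p - (fderiv ℝ g (q + v) - fderiv ℝ g q))‖ := by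
        congr 1; abel
    _ ≤ C * ‖p - q‖ * ‖v‖ + C * ‖p - q‖ * ‖v‖ := norm_sub_le_of_le (hfC p q v) (hgC p q v)
    _ = _ := by ring

theorem norm_fderiv_sub_fderiv_le (hf : Differentiable ℝ f) (hg : Differentiable ℝ g)
    (hfC : ∀ x y, ‖fderiv ℝ f x - fderiv ℝ f y‖ ≤ C * ‖x - y‖)
    (hgC : ∀ x y, ‖fderiv ℝ g x - fderiv ℝ g y‖ ≤ C * ‖x - y‖)
    (hC0 : 0 ≤ C) (hq : 0 ≤ q) (hfg : ∀ x, ‖f x - g x‖ ≤ 2 * C * q ^ 2) (x : X) :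
    ‖fderiv ℝ f x - fderiv ℝ g x‖ ≤ 6 * C * q := by
  rcases hq.eq_or_lt with rfl | hq
  · obtain rfl : f = g := funext fun x => sub_eq_zero.1 (by simpa using hfg x)
    simp
  have hd (x) : HasFDerivAt (fun x => f x - g x) (fderiv ℝ f x - fderiv ℝ g x) x :=
    (hf x).hasFDerivAt.sub (hg x).hasFDerivAt
  rw [← (hd x).fderiv]
  refine (norm_fderiv_le_of_norm_le_of_lipschitz (fun x => (hd x).differentiableAt) hfg
    (B := 2 * C) (fun x y => ?_) (by positivity) hq x).trans_eq (by field_simp; ring)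
  simp only [(hd _).fderiv]
  rw [sub_sub_sub_comm]
  exact (norm_sub_le_of_le (hfC x y) (hgC x y)).trans_eq (by ring)

end Taylor

section BoundedC3

variable {X W : Type*} [NormedAddCommGroup X] [NormedSpace ℝ X]
  [NormedAddCommGroup W] [NormedSpace ℝ W] {f : X → W} {C : ℝ}

/-- `f` is of class `C³`, and `C` bounds `f` and its derivatives up to the third order. -/
structure BoundedC3 (C : ℝ) (f : X → W) : Prop where
  contDiff : ContDiff ℝ 3 f
  bound : ∀ x, ∀ k : ℕ, k ≤ 3 → ‖iteratedFDeriv ℝ k f x‖ ≤ C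

namespace BoundedC3

theorem nonneg (hf : BoundedC3 C f) : 0 ≤ C :=
  (norm_nonneg _).trans (hf.bound 0 0 (by norm_num))

theorem differentiable (hf : BoundedC3 C f) : Differentiable ℝ f :=
  hf.contDiff.differentiable (by norm_num)

theorem contDiff_fderiv (hf : BoundedC3 C f) : ContDiff ℝ 2 (fderiv ℝ f) :=
  hf.contDiff.fderiv_right (by norm_num)

theorem differentiable_fderiv (hf : BoundedC3 C f) : Differentiable ℝ (fderiv ℝ f) :=
  hf.contDiff_fderiv.differentiable (by norm_num)

theorem norm_le (hf : BoundedC3 C f) (x : X) : ‖f x‖ ≤ C := by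
  simpa using hf.bound x 0 (by norm_num)

theorem norm_fderiv_le (hf : BoundedC3 C f) (x : X) : ‖fderiv ℝ f x‖ ≤ C := by
  rw [← norm_iteratedFDeriv_one]; exact hf.bound x 1 (by norm_num)

theorem norm_fderiv_fderiv_le (hf : BoundedC3 C f) (x : X) :
    ‖fderiv ℝ (fderiv ℝ f) x‖ ≤ C := by
  rw [← norm_iteratedFDeriv_one, norm_iteratedFDeriv_fderiv]; exact hf.bound x 2 (by norm_num)

theorem norm_fderiv_sub_le (hf : BoundedC3 C f) (x y : X) :
    ‖fderiv ℝ f x - fderiv ℝ f y‖ ≤ C * ‖x - y‖ :=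
  norm_sub_le_of_norm_fderiv_le hf.differentiable_fderiv hf.norm_fderiv_fderiv_le x y

theorem norm_fderiv_fderiv_sub_le (hf : BoundedC3 C f) (x y : X) :
    ‖fderiv ℝ (fderiv ℝ f) x - fderiv ℝ (fderiv ℝ f) y‖ ≤ C * ‖x - y‖ :=
  norm_fderiv_sub_le_of_iteratedFDeriv_two hf.contDiff_fderiv
    (fun x => by rw [norm_iteratedFDeriv_fderiv]; exact hf.bound x 3 le_rfl) x y

end BoundedC3

end BoundedC3

section Scale

/-- The scale `|t - s| ^ (1/3)` in which the estimates are homogeneous: it bounds the increments of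
an `α`-Hölder path on short intervals when `α > 1/3`, and its cube is the length of the interval. -/
def scale (s t : ℝ) : ℝ := |t - s| ^ (1 / 3 : ℝ)

theorem scale_nonneg (s t : ℝ) : 0 ≤ scale s t := Real.rpow_nonneg (abs_nonneg _) _

theorem scale_pow_three (s t : ℝ) : scale s t ^ 3 = |t - s| := by
  rw [scale, ← Real.rpow_mul_natCast (abs_nonneg _)]; norm_num

theorem le_mul_pow_of_le_mul_pow_succ {K q x : ℝ} {k : ℕ} (hK : 0 ≤ K) (hq : 0 ≤ q)
    (h : x ≤ K * q ^ (k + 1)) (hxK : x ≤ K) : x ≤ K * q ^ k := by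
  rcases le_total q 1 with hq1 | hq1
  · exact h.trans (by gcongr K * ?_; exact pow_le_pow_of_le_one hq hq1 k.le_succ)
  · exact hxK.trans (le_mul_of_one_le_right hK (one_le_pow₀ hq1))

end Scale

section SpaceTime

variable {X Y : Type*} [NormedAddCommGroup X] [NormedAddCommGroup Y] {T C : ℝ} {k : ℕ}

/-- Boundedness and Lipschitz continuity of a function on `[0, T] × X` and of its increments, on
`[0, T]` and with one constant: the time increments are of order `k + 1` in `scale`, and are
Lipschitz in space with a constant of order `k`. -/
structure SpaceTimeRegular (T : ℝ) (k : ℕ) (C : ℝ) (f : ℝ → X → Y) : Prop where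
  nonneg : 0 ≤ C
  bound : ∀ t ∈ Icc 0 T, ∀ x, ‖f t x‖ ≤ C
  lip : ∀ t ∈ Icc 0 T, ∀ x y, ‖f t x - f t y‖ ≤ C * ‖x - y‖
  time : ∀ s ∈ Icc 0 T, ∀ t ∈ Icc 0 T, ∀ x, ‖f t x - f s x‖ ≤ C * scale s t ^ (k + 1)
  cross : ∀ s ∈ Icc 0 T, ∀ t ∈ Icc 0 T, ∀ x y,
    ‖f t x - f s x - (f t y - f s y)‖ ≤ C * scale s t ^ k * ‖x - y‖
  second : ∀ t ∈ Icc 0 T, ∀ p q v,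
    ‖f t (p + v) - f t p - (f t (q + v) - f t q)‖ ≤ C * ‖p - q‖ * ‖v‖

namespace SpaceTimeRegular

variable {f : ℝ → X → Y}

theorem mono {C' : ℝ} (hf : SpaceTimeRegular T k C f) (hC : C ≤ C') :
    SpaceTimeRegular T k C' f where
  nonneg := hf.nonneg.trans hC
  bound t ht x := (hf.bound t ht x).trans hC
  lip t ht x y := (hf.lip t ht x y).trans (by gcongr)
  time s hs t ht x := (hf.time s hs t ht x).trans (by
    gcongr; exact pow_nonneg (scale_nonneg _ _) _)
  cross s hs t ht x y := (hf.cross s hs t ht x y).trans (by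
    gcongr; exact pow_nonneg (scale_nonneg _ _) _)
  second t ht p q v := (hf.second t ht p q v).trans (by gcongr)

theorem norm_time_sub_le (hf : SpaceTimeRegular T k C f) {s t : ℝ} (hs : s ∈ Icc 0 T)
    (ht : t ∈ Icc 0 T) (x : X) : ‖f t x - f s x‖ ≤ 2 * C * scale s t ^ k := by
  have hC := hf.nonneg
  refine le_mul_pow_of_le_mul_pow_succ (by positivity) (scale_nonneg s t)
    ((hf.time s hs t ht x).trans ?_)
    ((norm_sub_le_of_le (hf.bound t ht x) (hf.bound s hs x)).trans_eq (two_mul C).symm)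
  gcongr
  exacts [pow_nonneg (scale_nonneg s t) _, by linarith]

theorem norm_cross_le (hf : SpaceTimeRegular T (k + 1) C f) {s t : ℝ} (hs : s ∈ Icc 0 T)
    (ht : t ∈ Icc 0 T) (x y : X) :
    ‖f t x - f s x - (f t y - f s y)‖ ≤ 2 * C * scale s t ^ k * ‖x - y‖ := by
  have hC := hf.nonneg
  have hq := scale_nonneg s t
  rw [mul_right_comm]
  refine le_mul_pow_of_le_mul_pow_succ (by positivity) hq ((hf.cross s hs t ht x y).trans ?_) ?_
  · rw [mul_right_comm]; gcongr; linarith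
  · rw [sub_sub_sub_comm]
    exact (norm_sub_le_of_le (hf.lip t ht x y) (hf.lip s hs x y)).trans_eq (by ring)

theorem weaken (hf : SpaceTimeRegular T (k + 1) C f) : SpaceTimeRegular T k (2 * C) f where
  nonneg := mul_nonneg two_pos.le hf.nonneg
  bound t ht x := (hf.bound t ht x).trans (by linarith [hf.nonneg])
  lip t ht x y := (hf.lip t ht x y).trans (by gcongr; linarith [hf.nonneg])
  time _ hs _ ht := hf.norm_time_sub_le hs ht
  cross _ hs _ ht := hf.norm_cross_le hs ht
  second t ht p q v := (hf.second t ht p q v).trans (by gcongr; linarith [hf.nonneg])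

end SpaceTimeRegular

theorem SpaceTimeRegular.of_fderiv [NormedSpace ℝ X] [NormedSpace ℝ Y] {f : ℝ → X → Y}
    (hC : 0 ≤ C) (hf : ∀ t ∈ Icc 0 T, Differentiable ℝ (f t))
    (hbound : ∀ t ∈ Icc 0 T, ∀ x, ‖f t x‖ ≤ C)
    (hfderiv : ∀ t ∈ Icc 0 T, ∀ x, ‖fderiv ℝ (f t) x‖ ≤ C)
    (hlip : ∀ t ∈ Icc 0 T, ∀ x y, ‖fderiv ℝ (f t) x - fderiv ℝ (f t) y‖ ≤ C * ‖x - y‖)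
    (htime : ∀ s ∈ Icc 0 T, ∀ t ∈ Icc 0 T, ∀ x, ‖f t x - f s x‖ ≤ C * scale s t ^ (k + 1))
    (hcross : ∀ s ∈ Icc 0 T, ∀ t ∈ Icc 0 T, ∀ x,
      ‖fderiv ℝ (f t) x - fderiv ℝ (f s) x‖ ≤ C * scale s t ^ k) :
    SpaceTimeRegular T k C f where
  nonneg := hC
  bound := hbound
  lip t ht := norm_sub_le_of_norm_fderiv_le (hf t ht) (hfderiv t ht)
  time := htime
  cross s hs t ht x y := by
    have hd (x) : HasFDerivAt (fun x => f t x - f s x) (fderiv ℝ (f t) x - fderiv ℝ (f s) x) x :=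
      (hf t ht x).hasFDerivAt.sub (hf s hs x).hasFDerivAt
    exact norm_sub_le_of_norm_fderiv_le (fun x => (hd x).differentiableAt)
      (fun x => by rw [(hd x).fderiv]; exact hcross s hs t ht x) x y
  second t ht := norm_second_difference_le (hf t ht) (hlip t ht)

end SpaceTime

section Composition

variable {X Y Z V : Type*} [NormedAddCommGroup X]
  [NormedAddCommGroup Y] [NormedSpace ℝ Y] [NormedAddCommGroup Z] [NormedSpace ℝ Z]
  [NormedAddCommGroup V] [NormedSpace ℝ V]

theorem norm_comp_four_corner_le (P₁ P₂ P₃ P₄ : Y →L[ℝ] Z) (G₁ G₂ G₃ G₄ : V →L[ℝ] Y) :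
    ‖P₁.comp G₁ - P₂.comp G₂ - (P₃.comp G₃ - P₄.comp G₄)‖ ≤
      ‖P₁ - P₂ - (P₃ - P₄)‖ * ‖G₁‖ + ‖P₂ - P₄‖ * ‖G₁ - G₂‖ + ‖P₃ - P₄‖ * ‖G₁ - G₃‖
        + ‖P₄‖ * ‖G₁ - G₂ - (G₃ - G₄)‖ := by
  have hsplit : P₁.comp G₁ - P₂.comp G₂ - (P₃.comp G₃ - P₄.comp G₄) =
      (P₁ - P₂ - (P₃ - P₄)).comp G₁ + (P₂ - P₄).comp (G₁ - G₂) + (P₃ - P₄).comp (G₁ - G₃)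
        + P₄.comp (G₁ - G₂ - (G₃ - G₄)) := by
    simp only [ContinuousLinearMap.comp_sub, ContinuousLinearMap.sub_comp]; abel
  rw [hsplit]
  refine norm_add₄_le.trans ?_
  gcongr <;> exact ContinuousLinearMap.opNorm_comp_le _ _

theorem norm_comp_sub_comp_le (P P' : Y →L[ℝ] Z) (G G' : V →L[ℝ] Y) :
    ‖P.comp G - P'.comp G'‖ ≤ ‖P - P'‖ * ‖G‖ + ‖P'‖ * ‖G - G'‖ := by
  have hsplit : P.comp G - P'.comp G' = (P - P').comp G + P'.comp (G - G') := by
    simp only [ContinuousLinearMap.comp_sub, ContinuousLinearMap.sub_comp]; abel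
  rw [hsplit]
  exact norm_add_le_of_le (ContinuousLinearMap.opNorm_comp_le _ _)
    (ContinuousLinearMap.opNorm_comp_le _ _)

theorem SpaceTimeRegular.comp {T C : ℝ} {k : ℕ} {f : ℝ → X → Y →L[ℝ] Z} {g : ℝ → X → V →L[ℝ] Y}
    (hf : SpaceTimeRegular T k C f) (hg : SpaceTimeRegular T k C g) :
    SpaceTimeRegular T k (6 * C ^ 2) (fun t x => (f t x).comp (g t x)) where
  nonneg := by positivity
  bound t ht x := by
    have hC := hf.nonneg
    calc _ ≤ ‖f t x‖ * ‖g t x‖ := ContinuousLinearMap.opNorm_comp_le _ _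
      _ ≤ C * C := by gcongr; exacts [hf.bound t ht x, hg.bound t ht x]
      _ ≤ _ := by nlinarith
  lip t ht x y := by
    have hC := hf.nonneg
    calc _ ≤ _ := norm_comp_sub_comp_le _ _ _ _
      _ ≤ C * ‖x - y‖ * C + C * (C * ‖x - y‖) := by
        gcongr; exacts [hf.lip t ht x y, hg.bound t ht x, hf.bound t ht y, hg.lip t ht x y]
      _ = 2 * C ^ 2 * ‖x - y‖ := by ring
      _ ≤ _ := by gcongr; norm_num
  time s hs t ht x := by
    have hC := hf.nonneg
    have hq := scale_nonneg s t
    calc _ ≤ _ := norm_comp_sub_comp_le _ _ _ _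
      _ ≤ C * scale s t ^ (k + 1) * C + C * (C * scale s t ^ (k + 1)) := by
        gcongr; exacts [hf.time s hs t ht x, hg.bound t ht x, hf.bound s hs x, hg.time s hs t ht x]
      _ = 2 * C ^ 2 * scale s t ^ (k + 1) := by ring
      _ ≤ _ := by gcongr; norm_num
  cross s hs t ht x y := by
    have hC := hf.nonneg
    have hq := scale_nonneg s t
    calc _ ≤ _ := norm_comp_four_corner_le _ _ _ _ _ _ _ _
      _ ≤ C * scale s t ^ k * ‖x - y‖ * C + C * ‖x - y‖ * (2 * C * scale s t ^ k)
          + 2 * C * scale s t ^ k * (C * ‖x - y‖) + C * (C * scale s t ^ k * ‖x - y‖) := by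
        gcongr
        exacts [hf.cross s hs t ht x y, hg.bound t ht x, hf.lip s hs x y,
          hg.norm_time_sub_le hs ht x, hf.norm_time_sub_le hs ht y, hg.lip t ht x y,
          hf.bound s hs y, hg.cross s hs t ht x y]
      _ = _ := by ring
  second t ht p q v := by
    have hC := hf.nonneg
    calc _ ≤ _ := norm_comp_four_corner_le _ _ _ _ _ _ _ _
      _ ≤ C * ‖p - q‖ * ‖v‖ * C + C * ‖p - q‖ * (C * ‖v‖)
          + C * ‖v‖ * (C * ‖p - q‖) + C * (C * ‖p - q‖ * ‖v‖) := by
        gcongr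
        · exact hf.second t ht p q v
        · exact hg.bound t ht _
        · exact hf.lip t ht p q
        · simpa only [add_sub_cancel_left] using hg.lip t ht (p + v) p
        · simpa only [add_sub_cancel_left] using hf.lip t ht (q + v) q
        · simpa only [add_sub_add_right_eq_sub] using hg.lip t ht (p + v) (q + v)
        · exact hf.bound t ht q
        · exact hg.second t ht p q v
      _ = 4 * C ^ 2 * ‖p - q‖ * ‖v‖ := by ring
      _ ≤ _ := by gcongr; norm_num

end Composition

section Field

variable {X V : Type*} [NormedAddCommGroup X] [NormedSpace ℝ X]
  [NormedAddCommGroup V] [NormedSpace ℝ V] {T C : ℝ} {σ : ℝ → X → V →L[ℝ] X}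

/-- The field `∇σ σ` that multiplies the area of the driver in the expansion of a solution. -/
def levyField (σ : ℝ → X → V →L[ℝ] X) (t : ℝ) (x : X) : V →L[ℝ] V →L[ℝ] X :=
  (fderiv ℝ (σ t) x).comp (σ t x)

/-- The regularity of a vector field, of its derivative in space and of `∇σ σ` that the expansions
use, with one constant. -/
structure FieldRegular (T C : ℝ) (σ : ℝ → X → V →L[ℝ] X) : Prop where
  differentiable : ∀ t ∈ Icc 0 T, Differentiable ℝ (σ t)
  field : SpaceTimeRegular T 2 C σ
  deriv : SpaceTimeRegular T 1 C (fun t => fderiv ℝ (σ t))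
  levy : SpaceTimeRegular T 1 C (levyField σ)

theorem FieldRegular.mono {C' : ℝ} (hσ : FieldRegular T C σ) (hC : C ≤ C') :
    FieldRegular T C' σ where
  differentiable := hσ.differentiable
  field := hσ.field.mono hC
  deriv := hσ.deriv.mono hC
  levy := hσ.levy.mono hC

theorem norm_fderiv_time_sub_le {Y : Type*} [NormedAddCommGroup Y] [NormedSpace ℝ Y]
    {f : ℝ → X → Y} (hspace : ∀ t ∈ Icc 0 T, BoundedC3 C (f t))
    (htime : ∀ s ∈ Icc 0 T, ∀ t ∈ Icc 0 T, ∀ x, ‖f t x - f s x‖ ≤ C * |t - s|)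
    {s t : ℝ} (hs : s ∈ Icc 0 T) (ht : t ∈ Icc 0 T) (x : X) :
    ‖fderiv ℝ (f t) x - fderiv ℝ (f s) x‖ ≤ 2 * C * scale s t ^ 2 := by
  have hfs := hspace s hs
  have hft := hspace t ht
  refine norm_fderiv_sub_fderiv_le_sq hft.differentiable hfs.differentiable
    (norm_second_difference_le hft.differentiable_fderiv hft.norm_fderiv_fderiv_sub_le)
    (norm_second_difference_le hfs.differentiable_fderiv hfs.norm_fderiv_fderiv_sub_le)
    hfs.nonneg (scale_nonneg s t) (fun x => ?_) x
  rw [scale_pow_three]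
  exact htime s hs t ht x

theorem spaceTimeRegular_of_boundedC3 {Y : Type*} [NormedAddCommGroup Y] [NormedSpace ℝ Y]
    {f : ℝ → X → Y} (hC : 0 ≤ C) (hspace : ∀ t ∈ Icc 0 T, BoundedC3 C (f t))
    (htime : ∀ s ∈ Icc 0 T, ∀ t ∈ Icc 0 T, ∀ x, ‖f t x - f s x‖ ≤ C * |t - s|) :
    SpaceTimeRegular T 2 (2 * C) f := by
  have hC2 : C ≤ 2 * C := by linarith
  refine .of_fderiv (by positivity) (fun t ht => (hspace t ht).differentiable)
    (fun t ht x => ((hspace t ht).norm_le x).trans hC2)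
    (fun t ht x => ((hspace t ht).norm_fderiv_le x).trans hC2)
    (fun t ht x y => ((hspace t ht).norm_fderiv_sub_le x y).trans (by gcongr))
    (fun s hs t ht x => ?_) (fun s hs t ht => norm_fderiv_time_sub_le hspace htime hs ht)
  rw [scale_pow_three]
  exact (htime s hs t ht x).trans (by gcongr)

theorem spaceTimeRegular_fderiv_of_boundedC3 {Y : Type*} [NormedAddCommGroup Y] [NormedSpace ℝ Y]
    {f : ℝ → X → Y} (hC : 0 ≤ C) (hspace : ∀ t ∈ Icc 0 T, BoundedC3 C (f t))
    (htime : ∀ s ∈ Icc 0 T, ∀ t ∈ Icc 0 T, ∀ x, ‖f t x - f s x‖ ≤ C * |t - s|) :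
    SpaceTimeRegular T 1 (6 * C) (fun t => fderiv ℝ (f t)) := by
  have hC6 : C ≤ 6 * C := by linarith
  have htime' (s) (hs : s ∈ Icc 0 T) (t) (ht : t ∈ Icc 0 T) :=
    norm_fderiv_time_sub_le hspace htime hs ht
  refine .of_fderiv (by positivity) (fun t ht => (hspace t ht).differentiable_fderiv)
    (fun t ht x => ((hspace t ht).norm_fderiv_le x).trans hC6)
    (fun t ht x => ((hspace t ht).norm_fderiv_fderiv_le x).trans hC6)
    (fun t ht x y => ((hspace t ht).norm_fderiv_fderiv_sub_le x y).trans (by gcongr))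
    (fun s hs t ht x => (htime' s hs t ht x).trans (by gcongr; norm_num))
    (fun s hs t ht x => ?_)
  rw [pow_one]
  exact norm_fderiv_sub_fderiv_le (hspace t ht).differentiable_fderiv
    (hspace s hs).differentiable_fderiv (hspace t ht).norm_fderiv_fderiv_sub_le
    (hspace s hs).norm_fderiv_fderiv_sub_le hC (scale_nonneg s t) (htime' s hs t ht) x

theorem FieldRegular.of_boundedC3 (hC : 0 ≤ C) (hspace : ∀ t ∈ Icc 0 T, BoundedC3 C (σ t))
    (htime : ∀ s ∈ Icc 0 T, ∀ t ∈ Icc 0 T, ∀ x, ‖σ t x - σ s x‖ ≤ C * |t - s|) :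
    FieldRegular T (6 * C + 6 * (6 * C) ^ 2) σ where
  differentiable t ht := (hspace t ht).differentiable
  field := (spaceTimeRegular_of_boundedC3 hC hspace htime).mono (by nlinarith)
  deriv := (spaceTimeRegular_fderiv_of_boundedC3 hC hspace htime).mono (by nlinarith)
  levy := ((spaceTimeRegular_fderiv_of_boundedC3 hC hspace htime).comp
    ((spaceTimeRegular_of_boundedC3 hC hspace htime).weaken.mono (by linarith))).mono (by linarith)

end Field

section SpaceTimeIncrement

variable {X Y : Type*} [NormedAddCommGroup X] [NormedAddCommGroup Y] {T C s u : ℝ} {k : ℕ}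
  {f : ℝ → X → Y}

theorem SpaceTimeRegular.norm_sub_le (hf : SpaceTimeRegular T k C f) (hs : s ∈ Icc 0 T)
    (hu : u ∈ Icc 0 T) (y v : X) : ‖f u (y + v) - f s y‖ ≤ C * scale s u ^ (k + 1) + C * ‖v‖ := by
  rw [← sub_add_sub_cancel _ (f s (y + v))]
  refine norm_add_le_of_le (hf.time s hs u hu _) ?_
  simpa only [add_sub_cancel_left] using hf.lip s hs (y + v) y

theorem SpaceTimeRegular.norm_sub_sub_le (hf : SpaceTimeRegular T k C f) (hs : s ∈ Icc 0 T)
    (hu : u ∈ Icc 0 T) (y v y' v' : X) :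
    ‖f u (y + v) - f s y - (f u (y' + v') - f s y')‖ ≤
      C * scale s u ^ k * ‖y + v - (y' + v')‖ + (C * ‖y - y'‖ * ‖v‖ + C * ‖v - v'‖) := by
  have hsplit : f u (y + v) - f s y - (f u (y' + v') - f s y') =
      (f u (y + v) - f s (y + v) - (f u (y' + v') - f s (y' + v')))
      + ((f s (y + v) - f s y - (f s (y' + v) - f s y')) + (f s (y' + v) - f s (y' + v'))) := by
    abel
  rw [hsplit]
  refine norm_add_le_of_le (hf.cross s hs u hu _ _)
    (norm_add_le_of_le (hf.second s hs y y' v) ?_)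
  simpa only [add_sub_add_left_eq_sub] using hf.lip s hs (y' + v) (y' + v')

end SpaceTimeIncrement

section FieldDefect

variable {X V : Type*} [NormedAddCommGroup X] [NormedSpace ℝ X]
  [NormedAddCommGroup V] [NormedSpace ℝ V] {T C s u : ℝ} {σ : ℝ → X → V →L[ℝ] X}

/-- The error made when the increment of a vector field, between time `s` and position `y` and
time `u` and position `y + v`, is replaced by its derivative in a direction `e` close to `v`. -/
def fieldDefect (σ : ℝ → X → V →L[ℝ] X) (s u : ℝ) (y v e : X) : V →L[ℝ] X :=
  σ u (y + v) - σ s y - fderiv ℝ (σ s) y e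

theorem fieldDefect_eq (y v e : X) :
    fieldDefect σ s u y v e = (σ u (y + v) - σ s (y + v))
      + (σ s (y + v) - σ s y - fderiv ℝ (σ s) y v) + fderiv ℝ (σ s) y (v - e) := by
  rw [fieldDefect, map_sub]; abel

variable (hσ : FieldRegular T C σ)
include hσ

/-- The displacement `v₀` is an approximation of `v` of the right order, so that only `v - v₀`
appears linearly. -/
theorem FieldRegular.norm_taylor_le (hs : s ∈ Icc 0 T) (y v₀ v : X) :
    ‖σ s (y + v) - σ s y - fderiv ℝ (σ s) y v‖ ≤ C * ‖v₀‖ ^ 2 + 2 * C * ‖v - v₀‖ := by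
  have htaylor := norm_taylor_sub_le (hσ.differentiable s hs) (hσ.deriv.lip s hs)
    hσ.deriv.nonneg y v₀ 0
  have hlip := hσ.field.lip s hs (y + v) (y + v₀)
  have hderiv := (fderiv ℝ (σ s) y).le_of_opNorm_le (hσ.deriv.bound s hs y) (v - v₀)
  simp only [add_zero, sub_zero, norm_zero, add_sub_add_left_eq_sub] at htaylor hlip
  have hsplit : σ s (y + v) - σ s y - fderiv ℝ (σ s) y v =
      (σ s (y + v₀) - σ s y - fderiv ℝ (σ s) y v₀) + (σ s (y + v) - σ s (y + v₀))
        - fderiv ℝ (σ s) y (v - v₀) := by rw [map_sub]; abel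
  rw [hsplit]
  refine (norm_sub_le_of_le (norm_add_le_of_le htaylor hlip) hderiv).trans_eq (by ring)

theorem FieldRegular.norm_fieldDefect_le (hs : s ∈ Icc 0 T) (hu : u ∈ Icc 0 T) (y v₀ v e : X) :
    ‖fieldDefect σ s u y v e‖ ≤
      C * scale s u ^ 3 + (C * ‖v₀‖ ^ 2 + 2 * C * ‖v - v₀‖) + C * ‖v - e‖ := by
  rw [fieldDefect_eq]
  exact norm_add_le_of_le
    (norm_add_le_of_le (hσ.field.time s hs u hu _) (hσ.norm_taylor_le hs y v₀ v))
    ((fderiv ℝ (σ s) y).le_of_opNorm_le (hσ.deriv.bound s hs y) _)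

theorem FieldRegular.norm_fieldDefect_sub_le (hs : s ∈ Icc 0 T) (hu : u ∈ Icc 0 T)
    (y v e y' v' e' : X) :
    ‖fieldDefect σ s u y v e - fieldDefect σ s u y' v' e'‖ ≤
      C * scale s u ^ 2 * ‖y + v - (y' + v')‖
        + (C * ‖y - y'‖ * ‖v‖ ^ 2 + C * (‖v‖ + ‖v'‖) * ‖v - v'‖)
        + (C * ‖y - y'‖ * ‖v - e‖ + C * ‖v - e - (v' - e')‖) := by
  have hsplit : fieldDefect σ s u y v e - fieldDefect σ s u y' v' e' =
      (σ u (y + v) - σ s (y + v) - (σ u (y' + v') - σ s (y' + v')))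
      + ((σ s (y + v) - σ s y - fderiv ℝ (σ s) y v
          - (σ s (y' + v) - σ s y' - fderiv ℝ (σ s) y' v))
        + (σ s (y' + v) - σ s (y' + v') - fderiv ℝ (σ s) y' (v - v')))
      + ((fderiv ℝ (σ s) y - fderiv ℝ (σ s) y') (v - e)
        + fderiv ℝ (σ s) y' (v - e - (v' - e'))) := by
    simp only [fieldDefect, map_sub, _root_.sub_apply]; abel
  have hd := hσ.differentiable s hs
  rw [hsplit]
  exact norm_add_le_of_le (norm_add_le_of_le (hσ.field.cross s hs u hu _ _)
      (norm_add_le_of_le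
        (norm_taylor_sub_taylor_le hd (hσ.deriv.second s hs) hσ.deriv.nonneg y y' v)
        (norm_taylor_sub_le hd (hσ.deriv.lip s hs) hσ.deriv.nonneg y' v v')))
    (norm_add_le_of_le (ContinuousLinearMap.le_of_opNorm_le _ (hσ.deriv.lip s hs y y') _)
      (ContinuousLinearMap.le_of_opNorm_le _ (hσ.deriv.bound s hs y') _))

end FieldDefect

section Exponents

variable {h α : ℝ}

theorem rpow_two_mul_eq (h0 : 0 ≤ h) (α : ℝ) : h ^ (2 * α) = (h ^ α) ^ 2 := by
  rw [← Real.rpow_mul_natCast h0, mul_comm]; norm_num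

theorem scale_eq {s t : ℝ} (hst : s ≤ t) : scale s t = (t - s) ^ (1 / 3 : ℝ) := by
  rw [scale, abs_of_nonneg (sub_nonneg.2 hst)]

theorem scale_mono {s u t : ℝ} (hsu : s ≤ u) (hut : u ≤ t) : scale s u ≤ scale s t := by
  rw [scale_eq hsu, scale_eq (hsu.trans hut)]
  exact Real.rpow_le_rpow (by linarith) (by linarith) (by norm_num)

theorem scale_le_one {s t : ℝ} (hst : s ≤ t) (hts : t - s ≤ 1) : scale s t ≤ 1 := by
  rw [scale_eq hst]
  exact Real.rpow_le_one (by linarith) hts (by norm_num)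

theorem rpow_le_scale {s t : ℝ} (hα : 1 / 3 < α) (hst : s ≤ t) (hts : t - s ≤ 1) :
    (t - s) ^ α ≤ scale s t := by
  rw [scale_eq hst]
  exact Real.rpow_le_rpow_of_exponent_ge' (by linarith) hts (by norm_num) hα.le

theorem rpow_two_thirds_add {s t : ℝ} (hα : 0 ≤ α) (hst : s ≤ t) :
    (t - s) ^ (2 / 3 + α) = scale s t ^ 2 * (t - s) ^ α := by
  rw [scale_eq hst, Real.rpow_add_of_nonneg (by linarith) (by norm_num) hα,
    ← Real.rpow_mul_natCast (by linarith)]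
  norm_num

end Exponents

section Expansion

variable {d : ℕ} {X : Type*} [NormedAddCommGroup X] [NormedSpace ℝ X]

/-- The second-order expansion `σ δζ + (∇σ σ) A` of the rough integral of `σ(·, x)`. -/
def germ (σ : ℝ → X → E d →L[ℝ] X) (ζ : ℝ → E d) (A : ℝ → ℝ → Fin d → Fin d → ℝ)
    (x : ℝ → X) (s t : ℝ) : X :=
  σ s (x s) (inc ζ s t) + contract (levyField σ s (x s)) (A s t)

/-- The remainder of the second-order expansion of a path `x` with drift increments `J`: in the
sense of Davie, `x` solves the equation when it is of order larger than one. -/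
def davieRemainder (σ : ℝ → X → E d →L[ℝ] X) (ζ : ℝ → E d) (A : ℝ → ℝ → Fin d → Fin d → ℝ)
    (J : ℝ → ℝ → X) (x : ℝ → X) (s t : ℝ) : X :=
  inc x s t - J s t - germ σ ζ A x s t

variable {σ : ℝ → X → E d →L[ℝ] X} {ζ : ℝ → E d} {A : ℝ → ℝ → Fin d → Fin d → ℝ}
  {J : ℝ → ℝ → X} {x : ℝ → X} {s u t : ℝ}

theorem inc_eq_add_davieRemainder :
    inc x s t = J s t + germ σ ζ A x s t + davieRemainder σ ζ A J x s t := by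
  rw [davieRemainder]; abel

theorem remainder_eq : remainder ζ x (fun r => σ r (x r)) s t =
    J s t + contract (levyField σ s (x s)) (A s t) + davieRemainder σ ζ A J x s t := by
  rw [remainder, davieRemainder, germ]; abel

theorem remainder_field_eq_fieldDefect :
    remainder ζ (fun r => σ r (x r)) (fun r => levyField σ r (x r)) s u =
      fieldDefect σ s u (x s) (inc x s u) (σ s (x s) (inc ζ s u)) := by
  rw [fieldDefect, inc, add_sub_cancel]; rfl

theorem contract_eq_of_chen (B : E d →L[ℝ] E d →L[ℝ] X)
    (hchen : ∀ i j, delta A s u t i j = inc ζ s u i * inc ζ u t j) :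
    contract B (A s t) =
      B (inc ζ s u) (inc ζ u t) + contract B (A s u) + contract B (A u t) := by
  have hdelta : contract B (delta A s u t) = B (inc ζ s u) (inc ζ u t) := by
    rw [← contract_mul]
    congr 1
    ext i j
    exact hchen i j
  rw [← hdelta, delta, contract_sub_right, contract_sub_right]
  abel

theorem norm_apply_add_contract_le (F : E d →L[ℝ] X) (L : E d →L[ℝ] E d →L[ℝ] X) {ξ : E d}
    {a : Fin d → Fin d → ℝ} {K p q : ℝ} (hK : 0 ≤ K) (hp : 0 ≤ p) (hpq : p ≤ q)
    (hξ : ‖ξ‖ ≤ K * p) (ha : entrySum a ≤ K * p ^ 2) :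
    ‖F ξ + contract L a‖ ≤ K * (‖F‖ + q * ‖L‖) * p := by
  calc _ ≤ ‖F‖ * ‖ξ‖ + ‖L‖ * entrySum a :=
        norm_add_le_of_le (F.le_opNorm ξ) (norm_contract_le L a)
    _ ≤ ‖F‖ * (K * p) + ‖L‖ * (K * (q * p)) := by
      gcongr
      exact ha.trans (by rw [sq]; gcongr)
    _ = _ := by ring

theorem delta_davieRemainder
    (hchen : ∀ i j, delta A s u t i j = inc ζ s u i * inc ζ u t j)
    (hJ : J s t = J s u + J u t) :
    delta (davieRemainder σ ζ A J x) s u t =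
      remainder ζ (fun r => σ r (x r)) (fun r => levyField σ r (x r)) s u (inc ζ u t)
      + contract (inc (fun r => levyField σ r (x r)) s u) (A u t) := by
  have hζ : inc ζ s t = inc ζ s u + inc ζ u t := by simp only [inc]; abel
  have hx : inc x s t = inc x s u + inc x u t := by simp only [inc]; abel
  have hσ : inc (fun r => σ r (x r)) s u = σ u (x u) - σ s (x s) := rfl
  have hlevy : inc (fun r => levyField σ r (x r)) s u
    = levyField σ u (x u) - levyField σ s (x s) := rfl
  simp only [delta, davieRemainder, remainder, germ, hJ, contract_eq_of_chen _ hchen, hζ, hx,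
    hσ, hlevy, contract_sub_left, _root_.sub_apply, map_add]
  abel

end Expansion

section Single

variable {d : ℕ} {X : Type*} [NormedAddCommGroup X] [NormedSpace ℝ X]

/-- Bounds of order `α` and `2 * α` on a path and its area on `[a, b]`, with Chen's relation. -/
structure DriverBound (a b α C : ℝ) (ζ : ℝ → E d) (A : ℝ → ℝ → Fin d → Fin d → ℝ) : Prop where
  path : ∀ s t, a ≤ s → s ≤ t → t ≤ b → ‖inc ζ s t‖ ≤ C * (t - s) ^ α
  area : ∀ s t, a ≤ s → s ≤ t → t ≤ b → entrySum (A s t) ≤ C * (t - s) ^ (2 * α)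
  chen : ∀ s u t, a ≤ s → s ≤ u → u ≤ t → t ≤ b → ∀ i j,
    delta A s u t i j = inc ζ s u i * inc ζ u t j

/-- A vector field, a driver and drift increments on an interval of length at most one, all
controlled by one constant `C`. -/
structure DavieSetup (T a b α C : ℝ) (σ : ℝ → X → E d →L[ℝ] X) (ζ : ℝ → E d)
    (A : ℝ → ℝ → Fin d → Fin d → ℝ) (J : ℝ → ℝ → X) : Prop where
  nonneg : 0 ≤ a
  le_end : b ≤ T
  short : b - a ≤ 1
  lt_exponent : 1 / 3 < α
  one_le : 1 ≤ C
  field : FieldRegular T C σ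
  driver : DriverBound a b α C ζ A
  drift_add : ∀ s u t, a ≤ s → s ≤ u → u ≤ t → t ≤ b → J s t = J s u + J u t
  drift_le : ∀ s t, a ≤ s → s ≤ t → t ≤ b → ‖J s t‖ ≤ C * (t - s)

namespace DavieSetup

variable {T a b α C : ℝ} {σ : ℝ → X → E d →L[ℝ] X} {ζ : ℝ → E d}
  {A : ℝ → ℝ → Fin d → Fin d → ℝ} {J : ℝ → ℝ → X} (H : DavieSetup T a b α C σ ζ A J)
include H

theorem mem_Icc {s : ℝ} (hs : a ≤ s) (hs' : s ≤ b) : s ∈ Icc 0 T :=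
  ⟨H.nonneg.trans hs, hs'.trans H.le_end⟩

variable {s u : ℝ} (hs : a ≤ s) (hsu : s ≤ u) (hu : u ≤ b)
include hs hsu hu

theorem scale_le_one : scale s u ≤ 1 := RoughControl.scale_le_one hsu (by linarith [H.short])

theorem rpow_le_scale : (u - s) ^ α ≤ scale s u :=
  RoughControl.rpow_le_scale H.lt_exponent hsu (by linarith [H.short])

theorem norm_drift_le : ‖J s u‖ ≤ C * scale s u ^ 3 := by
  rw [scale_pow_three, abs_of_nonneg (sub_nonneg.2 hsu)]
  exact H.drift_le s u hs hsu hu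

theorem entrySum_le : entrySum (A s u) ≤ C * ((u - s) ^ α) ^ 2 := by
  rw [← rpow_two_mul_eq (sub_nonneg.2 hsu)]
  exact H.driver.area s u hs hsu hu

theorem norm_area_term_le (x : X) :
    ‖contract (levyField σ s x) (A s u)‖ ≤ C ^ 2 * scale s u ^ 2 := by
  have hC := H.one_le
  calc _ ≤ _ := norm_contract_le _ _
    _ ≤ C * (C * ((u - s) ^ α) ^ 2) := by
      gcongr
      exacts [entrySum_nonneg _, H.field.levy.bound s (H.mem_Icc hs (hsu.trans hu)) x,
        H.entrySum_le hs hsu hu]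
    _ ≤ C * (C * scale s u ^ 2) := by
      have := H.rpow_le_scale hs hsu hu
      have : 0 ≤ (u - s) ^ α := Real.rpow_nonneg (by linarith) α
      gcongr
    _ = _ := by ring

theorem norm_field_term_le (x : X) : ‖σ s x (inc ζ s u)‖ ≤ C ^ 2 * scale s u := by
  have hC := H.one_le
  calc _ ≤ C * ‖inc ζ s u‖ := ContinuousLinearMap.le_of_opNorm_le _
        (H.field.field.bound s (H.mem_Icc hs (hsu.trans hu)) x) _
    _ ≤ C * (C * scale s u) := by
      gcongr
      exact (H.driver.path s u hs hsu hu).trans (by gcongr; exact H.rpow_le_scale hs hsu hu)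
    _ = _ := by ring

theorem norm_remainder_le (x : ℝ → X) : ‖remainder ζ x (fun r => σ r (x r)) s u‖ ≤
    3 * C ^ 2 * scale s u ^ 2 + ‖davieRemainder σ ζ A J x s u‖ := by
  have hC := H.one_le
  have hq := scale_nonneg s u
  have hJ : ‖J s u‖ ≤ C ^ 2 * scale s u ^ 2 := (H.norm_drift_le hs hsu hu).trans <|
    mul_le_mul (le_self_pow₀ hC two_ne_zero)
      (pow_le_pow_of_le_one hq (H.scale_le_one hs hsu hu) (by norm_num)) (by positivity)
      (by positivity)
  rw [remainder_eq (J := J) (A := A)]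
  refine norm_add₃_le.trans ?_
  have : 0 ≤ C ^ 2 * scale s u ^ 2 := by positivity
  linarith [H.norm_area_term_le hs hsu hu (x s)]

theorem norm_drift_add_germ_le (x : ℝ → X) :
    ‖J s u + germ σ ζ A x s u‖ ≤ 3 * C ^ 2 * scale s u := by
  have hC := H.one_le
  have hq := scale_nonneg s u
  have hq1 := H.scale_le_one hs hsu hu
  calc _ ≤ C * scale s u ^ 3 + (C ^ 2 * scale s u + C ^ 2 * scale s u ^ 2) :=
        norm_add_le_of_le (H.norm_drift_le hs hsu hu) (norm_add_le_of_le
          (H.norm_field_term_le hs hsu hu _) (H.norm_area_term_le hs hsu hu _))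
    _ ≤ C ^ 2 * scale s u + (C ^ 2 * scale s u + C ^ 2 * scale s u) := by
      gcongr
      exacts [le_self_pow₀ hC two_ne_zero, pow_le_of_le_one hq hq1 three_ne_zero,
        pow_le_of_le_one hq hq1 two_ne_zero]
    _ = _ := by ring

theorem norm_inc_le (x : ℝ → X) :
    ‖inc x s u‖ ≤ 3 * C ^ 2 * scale s u + ‖davieRemainder σ ζ A J x s u‖ := by
  rw [inc_eq_add_davieRemainder (J := J) (A := A)]
  exact norm_add_le_of_le (H.norm_drift_add_germ_le hs hsu hu x) le_rfl

theorem norm_remainder_field_le (x : ℝ → X) {B : ℝ} (hB : 3 * C ^ 2 ≤ B) :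
    ‖remainder ζ (fun r => σ r (x r)) (fun r => levyField σ r (x r)) s u‖ ≤
      3 * B ^ 3 * scale s u ^ 2 + 3 * B * ‖davieRemainder σ ζ A J x s u‖ := by
  have hC := H.one_le
  have hCB : C ≤ B := by nlinarith
  have hB0 : 0 ≤ B := by linarith
  have hq := scale_nonneg s u
  have hq32 : scale s u ^ 3 ≤ scale s u ^ 2 :=
    pow_le_pow_of_le_one hq (H.scale_le_one hs hsu hu) (by norm_num)
  have h := H.field.norm_fieldDefect_le (H.mem_Icc hs (hsu.trans hu))
    (H.mem_Icc (hs.trans hsu) hu) (x s) (J s u + germ σ ζ A x s u) (inc x s u)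
    (σ s (x s) (inc ζ s u))
  rw [← remainder_field_eq_fieldDefect, inc_eq_add_davieRemainder (J := J) (σ := σ) (ζ := ζ)
    (A := A), add_sub_cancel_left, ← inc_eq_add_davieRemainder] at h
  calc _ ≤ _ := h
    _ ≤ B * scale s u ^ 2 + (B * (B * scale s u) ^ 2 + 2 * C * ‖davieRemainder σ ζ A J x s u‖)
        + C * (B * scale s u ^ 2 + ‖davieRemainder σ ζ A J x s u‖) := by
      gcongr
      · exact (H.norm_drift_add_germ_le hs hsu hu x).trans (by gcongr)
      · exact (H.norm_remainder_le hs hsu hu x).trans (by gcongr)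
    _ = (B + B ^ 3 + C * B) * scale s u ^ 2 + 3 * C * ‖davieRemainder σ ζ A J x s u‖ := by ring
    _ ≤ _ := by gcongr; nlinarith [mul_le_mul_of_nonneg_right hCB hB0]

theorem norm_inc_levyField_le (x : ℝ → X) {B : ℝ} (hB : 3 * C ^ 2 ≤ B) :
    ‖inc (fun r => levyField σ r (x r)) s u‖ ≤
      2 * B ^ 2 * scale s u + B * ‖davieRemainder σ ζ A J x s u‖ := by
  have hC := H.one_le
  have hCB : C ≤ B := by nlinarith
  have hB0 : 0 ≤ B := by linarith
  have hq := scale_nonneg s u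
  have h := H.field.levy.norm_sub_le (H.mem_Icc hs (hsu.trans hu)) (H.mem_Icc (hs.trans hsu) hu)
    (x s) (inc x s u)
  rw [inc, add_sub_cancel] at h
  calc _ ≤ _ := h
    _ ≤ B * scale s u + B * (B * scale s u + ‖davieRemainder σ ζ A J x s u‖) := by
      rw [one_add_one_eq_two]
      gcongr
      · exact pow_le_of_le_one hq (H.scale_le_one hs hsu hu) two_ne_zero
      · exact (H.norm_inc_le hs hsu hu x).trans (by gcongr)
    _ = (B + B ^ 2) * scale s u + B * ‖davieRemainder σ ζ A J x s u‖ := by ring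
    _ ≤ _ := by gcongr; nlinarith

end DavieSetup

section Apriori

variable {T a b α C : ℝ} {σ : ℝ → X → E d →L[ℝ] X} {ζ : ℝ → E d}
  {A : ℝ → ℝ → Fin d → Fin d → ℝ} {J : ℝ → ℝ → X}

theorem DavieSetup.norm_delta_davieRemainder_le (H : DavieSetup T a b α C σ ζ A J) (x : ℝ → X)
    {s u t : ℝ} (hs : a ≤ s) (hsu : s ≤ u) (hut : u ≤ t) (ht : t ≤ b) :
    ‖delta (davieRemainder σ ζ A J x) s u t‖ ≤
      5 * (3 * C ^ 2) ^ 4 * (t - s) ^ (2 / 3 + α)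
        + 4 * (3 * C ^ 2) ^ 2 * (t - s) ^ α * ‖davieRemainder σ ζ A J x s u‖ := by
  have hC := H.one_le
  have hα : 0 ≤ α := by linarith [H.lt_exponent]
  have hub := hut.trans ht
  have hq := scale_nonneg s t
  have hpow : (t - u) ^ α ≤ (t - s) ^ α := by gcongr
  have hp : 0 ≤ (t - u) ^ α := Real.rpow_nonneg (sub_nonneg.2 hut) α
  have := norm_nonneg (davieRemainder σ ζ A J x s u)
  set B := 3 * C ^ 2 with hB
  have hCB : C ≤ B := by nlinarith
  have hfield := H.norm_remainder_field_le hs hsu hub x le_rfl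
  have hlevy := H.norm_inc_levyField_le hs hsu hub x le_rfl
  rw [← hB] at hfield hlevy
  rw [delta_davieRemainder (H.driver.chen s u t hs hsu hut ht) (H.drift_add s u t hs hsu hut ht),
    rpow_two_thirds_add hα (hsu.trans hut)]
  have hmono := scale_mono hsu hut
  have hqs := scale_nonneg s u
  calc _ ≤ C * (_ + scale s t * _) * (t - s) ^ α :=
        norm_apply_add_contract_le _ _ (by linarith) (hp.trans hpow)
          (H.rpow_le_scale hs (hsu.trans hut) ht)
          ((H.driver.path u t (hs.trans hsu) hut ht).trans (by gcongr))
          ((H.entrySum_le (hs.trans hsu) hut ht).trans (by gcongr))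
    _ ≤ B * (3 * B ^ 3 * scale s t ^ 2 + 3 * B * ‖davieRemainder σ ζ A J x s u‖
        + (scale s t * (2 * B ^ 2 * scale s t) + 1 * (B * ‖davieRemainder σ ζ A J x s u‖)))
          * (t - s) ^ α := by
      have hp' := hp.trans hpow
      gcongr
      · exact hfield.trans (by gcongr)
      · refine (mul_le_mul_of_nonneg_left hlevy hq).trans ?_
        rw [mul_add]
        gcongr
        exact H.scale_le_one hs (hsu.trans hut) ht
    _ = (3 * B ^ 4 + 2 * B ^ 3) * (scale s t ^ 2 * (t - s) ^ α)
        + 4 * B ^ 2 * (t - s) ^ α * ‖davieRemainder σ ζ A J x s u‖ := by ring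
    _ ≤ _ := by
      have hB1 : 1 ≤ B := hC.trans hCB
      have hp' := hp.trans hpow
      gcongr
      nlinarith [pow_le_pow_right₀ hB1 (show 3 ≤ 4 by norm_num)]

/-- The constant of the a priori bound on Davie remainders. -/
def aprioriConst (α C : ℝ) : ℝ := 10 * sewingConst (2 / 3 + α) * (3 * C ^ 2) ^ 4

theorem aprioriConst_nonneg (hα : 1 / 3 < α) : 0 ≤ aprioriConst α C := by
  have := one_le_sewingConst (θ := 2 / 3 + α) (by linarith)
  unfold aprioriConst
  positivity

theorem DavieSetup.holderBound_davieRemainder (H : DavieSetup T a b α C σ ζ A J) {θ M : ℝ}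
    {x : ℝ → X} (hθ : 1 < θ) (hR : HolderBound a b θ M (davieRemainder σ ζ A J x))
    (hsmall : sewingConst (2 / 3 + α) * (4 * (3 * C ^ 2) ^ 2) * (b - a) ^ α ≤ 1 / 2) :
    HolderBound a b (2 / 3 + α) (aprioriConst α C) (davieRemainder σ ζ A J x) := by
  have hα := H.lt_exponent
  refine (HolderBound.of_delta_self (by linarith) (by linarith) hθ (by linarith) H.short
    (by positivity) (by positivity) hsmall hR fun s u t hs hsu hut ht =>
      H.norm_delta_davieRemainder_le x hs hsu hut ht).mono_const ?_
  rw [aprioriConst]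
  linarith

end Apriori

end Single

section Stability

variable {d : ℕ} {X : Type*} [NormedAddCommGroup X] [NormedSpace ℝ X]

/-- Two driven paths at distance `D` on `[a, b]` in driver, drift and value, with Davie remainders
of order `2 / 3 + α` bounded by `M`. -/
structure DavieClose (T a b α C M D : ℝ) (σ : ℝ → X → E d →L[ℝ] X) (ζ ζ' : ℝ → E d)
    (A A' : ℝ → ℝ → Fin d → Fin d → ℝ) (J J' : ℝ → ℝ → X) (x x' : ℝ → X) : Prop where
  left : DavieSetup T a b α C σ ζ A J
  right : DavieSetup T a b α C σ ζ' A' J'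
  nonneg : 0 ≤ M
  left_remainder : HolderBound a b (2 / 3 + α) M (davieRemainder σ ζ A J x)
  right_remainder : HolderBound a b (2 / 3 + α) M (davieRemainder σ ζ' A' J' x')
  path : ∀ s t, a ≤ s → s ≤ t → t ≤ b → ‖inc ζ s t - inc ζ' s t‖ ≤ D * (t - s) ^ α
  area : ∀ s t, a ≤ s → s ≤ t → t ≤ b → entrySum (A s t - A' s t) ≤ D * (t - s) ^ (2 * α)
  drift : ∀ s t, a ≤ s → s ≤ t → t ≤ b → ‖J s t - J' s t‖ ≤ C * D * (t - s)
  value : ∀ r ∈ Icc a b, ‖x r - x' r‖ ≤ D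

section OneStep

variable {T a b α C M : ℝ} {σ : ℝ → X → E d →L[ℝ] X} {ζ : ℝ → E d}
  {A : ℝ → ℝ → Fin d → Fin d → ℝ} {J : ℝ → ℝ → X} {x : ℝ → X} {s u : ℝ}

theorem DavieSetup.norm_davieRemainder_le (H : DavieSetup T a b α C σ ζ A J) (hM : 0 ≤ M)
    (hR : HolderBound a b (2 / 3 + α) M (davieRemainder σ ζ A J x))
    (hs : a ≤ s) (hsu : s ≤ u) (hu : u ≤ b) :
    ‖davieRemainder σ ζ A J x s u‖ ≤ M * scale s u ^ 2 := by
  refine (hR hs hsu hu).trans (mul_le_mul_of_nonneg_left ?_ hM)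
  rw [rpow_two_thirds_add (by linarith [H.lt_exponent]) hsu]
  exact mul_le_of_le_one_right (sq_nonneg _)
    ((H.rpow_le_scale hs hsu hu).trans (H.scale_le_one hs hsu hu))

theorem DavieSetup.one_step_le (H : DavieSetup T a b α C σ ζ A J) (hM : 0 ≤ M)
    (hR : HolderBound a b (2 / 3 + α) M (davieRemainder σ ζ A J x))
    (hs : a ≤ s) (hsu : s ≤ u) (hu : u ≤ b) {B : ℝ} (hB : 5 * C ^ 2 + M ≤ B) :
    ‖inc x s u‖ ≤ B * scale s u ∧
      ‖remainder ζ x (fun r => σ r (x r)) s u‖ ≤ B * scale s u ^ 2 ∧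
      ‖remainder ζ (fun r => σ r (x r)) (fun r => levyField σ r (x r)) s u‖ ≤
        3 * B ^ 3 * scale s u ^ 2 ∧
      ‖inc (fun r => levyField σ r (x r)) s u‖ ≤ 2 * B ^ 2 * scale s u := by
  have hC := H.one_le
  have hB₀ : 3 * C ^ 2 + M ≤ B := by nlinarith
  have hq := scale_nonneg s u
  have hR' := H.norm_davieRemainder_le hM hR hs hsu hu
  have hR1 : ‖davieRemainder σ ζ A J x s u‖ ≤ M * scale s u :=
    hR'.trans (mul_le_mul_of_nonneg_left
      (pow_le_of_le_one hq (H.scale_le_one hs hsu hu) two_ne_zero) hM)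
  refine ⟨?_, ?_, ?_, ?_⟩
  · calc _ ≤ 3 * C ^ 2 * scale s u + M * scale s u :=
          (H.norm_inc_le hs hsu hu x).trans (by gcongr)
      _ = (3 * C ^ 2 + M) * scale s u := by ring
      _ ≤ _ := by gcongr
  · calc _ ≤ 3 * C ^ 2 * scale s u ^ 2 + M * scale s u ^ 2 :=
          (H.norm_remainder_le hs hsu hu x).trans (by gcongr)
      _ = (3 * C ^ 2 + M) * scale s u ^ 2 := by ring
      _ ≤ _ := by gcongr
  · calc _ ≤ 3 * (3 * C ^ 2) ^ 3 * scale s u ^ 2 + 3 * (3 * C ^ 2) * (M * scale s u ^ 2) :=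
          (H.norm_remainder_field_le hs hsu hu x le_rfl).trans (by gcongr)
      _ = 3 * ((3 * C ^ 2) ^ 3 + 3 * C ^ 2 * M) * scale s u ^ 2 := by ring
      _ ≤ 3 * (3 * C ^ 2 + M) ^ 3 * scale s u ^ 2 := by
        have hK : 1 ≤ 3 * C ^ 2 := by nlinarith
        gcongr
        nlinarith [mul_nonneg hM (by nlinarith : 0 ≤ (3 * C ^ 2) * (3 * C ^ 2 - 1)),
          mul_nonneg hM hM, mul_nonneg (mul_nonneg hM hM) hM,
          mul_nonneg (mul_nonneg hM hM) (by positivity : 0 ≤ 3 * C ^ 2)]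
      _ ≤ _ := by gcongr
  · calc _ ≤ 2 * (3 * C ^ 2) ^ 2 * scale s u + 3 * C ^ 2 * (M * scale s u) :=
          (H.norm_inc_levyField_le hs hsu hu x le_rfl).trans (by gcongr)
      _ = (2 * (3 * C ^ 2) ^ 2 + 3 * C ^ 2 * M) * scale s u := by ring
      _ ≤ 2 * (3 * C ^ 2 + M) ^ 2 * scale s u := by
        gcongr
        nlinarith [mul_nonneg hM hM, mul_nonneg hM (sq_nonneg C)]
      _ ≤ _ := by gcongr

end OneStep

namespace DavieClose

variable {T a b α C M D : ℝ} {σ : ℝ → X → E d →L[ℝ] X} {ζ ζ' : ℝ → E d}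
  {A A' : ℝ → ℝ → Fin d → Fin d → ℝ} {J J' : ℝ → ℝ → X} {x x' : ℝ → X}
  (H : DavieClose T a b α C M D σ ζ ζ' A A' J J' x x')
include H

variable {s u : ℝ} (hs : a ≤ s) (hsu : s ≤ u) (hu : u ≤ b)
include hs hsu hu

theorem dist_nonneg : 0 ≤ D :=
  (norm_nonneg _).trans (H.value s ⟨hs, hsu.trans hu⟩)

theorem norm_drift_sub_le : ‖J s u - J' s u‖ ≤ C ^ 2 * D * scale s u ^ 2 := by
  have hC := H.left.one_le
  have hD := H.dist_nonneg hs hsu hu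
  have hq := scale_nonneg s u
  calc _ ≤ C * D * scale s u ^ 3 := by
        rw [scale_pow_three, abs_of_nonneg (sub_nonneg.2 hsu)]
        exact H.drift s u hs hsu hu
    _ ≤ _ := by
      have hq32 : scale s u ^ 3 ≤ scale s u ^ 2 :=
        pow_le_pow_of_le_one hq (H.left.scale_le_one hs hsu hu) (by norm_num)
      gcongr
      exact le_self_pow₀ hC two_ne_zero

theorem norm_field_term_sub_le :
    ‖σ s (x s) (inc ζ s u) - σ s (x' s) (inc ζ' s u)‖ ≤ 2 * C ^ 2 * D * scale s u := by
  have hC := H.left.one_le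
  have hD := H.dist_nonneg hs hsu hu
  have hsT := H.left.mem_Icc hs (hsu.trans hu)
  have hpow := H.left.rpow_le_scale hs hsu hu
  have hsplit : σ s (x s) (inc ζ s u) - σ s (x' s) (inc ζ' s u) =
      (σ s (x s) - σ s (x' s)) (inc ζ s u) + σ s (x' s) (inc ζ s u - inc ζ' s u) := by
    rw [_root_.sub_apply, map_sub]; abel
  rw [hsplit]
  calc _ ≤ C * D * (C * scale s u) + C * (D * scale s u) := by
        refine norm_add_le_of_le (ContinuousLinearMap.le_of_opNorm_le_of_le _ ?_ ?_)
          (ContinuousLinearMap.le_of_opNorm_le_of_le _ (H.left.field.field.bound s hsT _) ?_)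
        · exact (H.left.field.field.lip s hsT _ _).trans
            (by gcongr; exact H.value s ⟨hs, hsu.trans hu⟩)
        · exact (H.left.driver.path s u hs hsu hu).trans (by gcongr)
        · exact (H.path s u hs hsu hu).trans (by gcongr)
    _ = (C ^ 2 + C) * D * scale s u := by ring
    _ ≤ _ := by
      have := scale_nonneg s u
      gcongr
      nlinarith

theorem norm_area_term_sub_le :
    ‖contract (levyField σ s (x s)) (A s u) - contract (levyField σ s (x' s)) (A' s u)‖ ≤
      2 * C ^ 2 * D * scale s u ^ 2 := by
  have hC := H.left.one_le
  have hD := H.dist_nonneg hs hsu hu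
  have hsT := H.left.mem_Icc hs (hsu.trans hu)
  have hpow : (u - s) ^ (2 * α) ≤ scale s u ^ 2 := by
    rw [rpow_two_mul_eq (sub_nonneg.2 hsu)]
    have := Real.rpow_nonneg (sub_nonneg.2 hsu) α
    gcongr
    exact H.left.rpow_le_scale hs hsu hu
  have hsplit : contract (levyField σ s (x s)) (A s u)
      - contract (levyField σ s (x' s)) (A' s u) =
      contract (levyField σ s (x s) - levyField σ s (x' s)) (A s u)
        + contract (levyField σ s (x' s)) (A s u - A' s u) := by
    rw [contract_sub_left, contract_sub_right]; abel
  rw [hsplit]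
  calc _ ≤ C * D * (C * scale s u ^ 2) + C * (D * scale s u ^ 2) := by
        refine norm_add_le_of_le ((norm_contract_le _ _).trans (mul_le_mul ?_ ?_
          (entrySum_nonneg _) (by positivity))) ((norm_contract_le _ _).trans (mul_le_mul
            (H.left.field.levy.bound s hsT _) ?_ (entrySum_nonneg _) (by positivity)))
        · exact (H.left.field.levy.lip s hsT _ _).trans
            (by gcongr; exact H.value s ⟨hs, hsu.trans hu⟩)
        · exact (H.left.driver.area s u hs hsu hu).trans (by gcongr)
        · exact (H.area s u hs hsu hu).trans (by gcongr)
    _ = (C ^ 2 + C) * D * scale s u ^ 2 := by ring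
    _ ≤ _ := by
      have := scale_nonneg s u
      gcongr
      nlinarith

theorem norm_inc_sub_le : ‖inc x s u - inc x' s u‖ ≤ 5 * C ^ 2 * D * scale s u
    + ‖davieRemainder σ ζ A J x s u - davieRemainder σ ζ' A' J' x' s u‖ := by
  have hD := H.dist_nonneg hs hsu hu
  have hq := scale_nonneg s u
  have hq21 : scale s u ^ 2 ≤ scale s u :=
    pow_le_of_le_one hq (H.left.scale_le_one hs hsu hu) two_ne_zero
  have hsplit : inc x s u - inc x' s u = J s u - J' s u
      + (σ s (x s) (inc ζ s u) - σ s (x' s) (inc ζ' s u))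
      + (contract (levyField σ s (x s)) (A s u) - contract (levyField σ s (x' s)) (A' s u))
      + (davieRemainder σ ζ A J x s u - davieRemainder σ ζ' A' J' x' s u) := by
    simp only [davieRemainder, germ]; abel
  rw [hsplit]
  refine norm_add_le_of_le ?_ le_rfl
  calc _ ≤ C ^ 2 * D * scale s u ^ 2 + 2 * C ^ 2 * D * scale s u
        + 2 * C ^ 2 * D * scale s u ^ 2 :=
        norm_add_le_of_le (norm_add_le_of_le (H.norm_drift_sub_le hs hsu hu)
          (H.norm_field_term_sub_le hs hsu hu)) (H.norm_area_term_sub_le hs hsu hu)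
    _ ≤ C ^ 2 * D * scale s u + 2 * C ^ 2 * D * scale s u + 2 * C ^ 2 * D * scale s u := by
      gcongr
    _ = _ := by ring

theorem norm_remainder_sub_le :
    ‖remainder ζ x (fun r => σ r (x r)) s u - remainder ζ' x' (fun r => σ r (x' r)) s u‖ ≤
      3 * C ^ 2 * D * scale s u ^ 2
        + ‖davieRemainder σ ζ A J x s u - davieRemainder σ ζ' A' J' x' s u‖ := by
  rw [remainder_eq (J := J) (A := A), remainder_eq (J := J') (A := A'), add_sub_add_comm,
    add_sub_add_comm]
  refine norm_add_le_of_le ((norm_add_le_of_le (H.norm_drift_sub_le hs hsu hu)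
    (H.norm_area_term_sub_le hs hsu hu)).trans (le_of_eq ?_)) le_rfl
  ring

theorem norm_remainder_field_sub_le {B : ℝ} (hB : 5 * C ^ 2 + M ≤ B) :
    ‖remainder ζ (fun r => σ r (x r)) (fun r => levyField σ r (x r)) s u
        - remainder ζ' (fun r => σ r (x' r)) (fun r => levyField σ r (x' r)) s u‖ ≤
      7 * B ^ 3 * D * scale s u ^ 2 + 3 * B ^ 2 *
        ‖davieRemainder σ ζ A J x s u - davieRemainder σ ζ' A' J' x' s u‖ := by
  have hC := H.left.one_le
  have hM := H.nonneg
  have hD := H.dist_nonneg hs hsu hu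
  have hq := scale_nonneg s u
  have hq1 := H.left.scale_le_one hs hsu hu
  have hCB : C ≤ B := by nlinarith
  have hB1 : 1 ≤ B := hC.trans hCB
  obtain ⟨hx, hw, -, -⟩ := H.left.one_step_le hM H.left_remainder hs hsu hu hB
  obtain ⟨hx', -, -, -⟩ := H.right.one_step_le hM H.right_remainder hs hsu hu hB
  have hinc := H.norm_inc_sub_le hs hsu hu
  have hrem := H.norm_remainder_sub_le hs hsu hu
  set R := ‖davieRemainder σ ζ A J x s u - davieRemainder σ ζ' A' J' x' s u‖
  have : 0 ≤ R := norm_nonneg _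
  have h := H.left.field.norm_fieldDefect_sub_le (H.left.mem_Icc hs (hsu.trans hu))
    (H.left.mem_Icc (hs.trans hsu) hu) (x s) (inc x s u) (σ s (x s) (inc ζ s u)) (x' s)
    (inc x' s u) (σ s (x' s) (inc ζ' s u))
  have hadd (y : ℝ → X) : y s + inc y s u = y u := add_sub_cancel _ _
  rw [← remainder_field_eq_fieldDefect, ← remainder_field_eq_fieldDefect, hadd, hadd] at h
  calc _ ≤ _ := h
    _ ≤ B * scale s u ^ 2 * D + (B * D * (B * scale s u) ^ 2
          + B * (B * scale s u + B * scale s u) * (B * D * scale s u + R))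
        + (B * D * (B * scale s u ^ 2) + B * (B * D * scale s u ^ 2 + R)) := by
      have hs' := H.value s ⟨hs, hsu.trans hu⟩
      gcongr
      · exact H.value u ⟨hs.trans hsu, hu⟩
      · exact hinc.trans (by gcongr; linarith)
      · exact hw
      · exact hrem.trans (by gcongr; nlinarith)
    _ = (B + 3 * B ^ 3 + 2 * B ^ 2) * D * scale s u ^ 2
        + (2 * B ^ 2 * scale s u + B) * R := by ring
    _ ≤ (B ^ 3 + 3 * B ^ 3 + 2 * B ^ 3) * D * scale s u ^ 2
        + (2 * B ^ 2 * 1 + B ^ 2) * R := by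
      gcongr
      exacts [le_self_pow₀ hB1 three_ne_zero, by norm_num, le_self_pow₀ hB1 two_ne_zero]
    _ ≤ _ := by
      have : 0 ≤ B ^ 3 * D * scale s u ^ 2 := by positivity
      linarith

theorem norm_inc_levyField_sub_le {B : ℝ} (hB : 5 * C ^ 2 + M ≤ B) :
    ‖inc (fun r => levyField σ r (x r)) s u - inc (fun r => levyField σ r (x' r)) s u‖ ≤
      3 * B ^ 2 * D * scale s u
        + B * ‖davieRemainder σ ζ A J x s u - davieRemainder σ ζ' A' J' x' s u‖ := by
  have hC := H.left.one_le
  have hM := H.nonneg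
  have hD := H.dist_nonneg hs hsu hu
  have hq := scale_nonneg s u
  have hCB : C ≤ B := by nlinarith
  have hB1 : 1 ≤ B := hC.trans hCB
  obtain ⟨hx, -, -, -⟩ := H.left.one_step_le hM H.left_remainder hs hsu hu hB
  have hinc := H.norm_inc_sub_le hs hsu hu
  set R := ‖davieRemainder σ ζ A J x s u - davieRemainder σ ζ' A' J' x' s u‖
  have : 0 ≤ R := norm_nonneg _
  have h := H.left.field.levy.norm_sub_sub_le (H.left.mem_Icc hs (hsu.trans hu))
    (H.left.mem_Icc (hs.trans hsu) hu) (x s) (inc x s u) (x' s) (inc x' s u)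
  simp only [inc, add_sub_cancel, pow_one] at h
  calc _ ≤ _ := h
    _ ≤ B * scale s u * D + (B * D * (B * scale s u) + B * (B * D * scale s u + R)) := by
      have hs' := H.value s ⟨hs, hsu.trans hu⟩
      gcongr
      · exact H.value u ⟨hs.trans hsu, hu⟩
      · exact hx
      · exact hinc.trans (by gcongr; linarith)
    _ = (B + B ^ 2 + B ^ 2) * D * scale s u + B * R := by ring
    _ ≤ _ := by
      gcongr
      nlinarith

end DavieClose

section Contraction

variable {T a b α C M D : ℝ} {σ : ℝ → X → E d →L[ℝ] X} {ζ ζ' : ℝ → E d}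
  {A A' : ℝ → ℝ → Fin d → Fin d → ℝ} {J J' : ℝ → ℝ → X} {x x' : ℝ → X}

theorem DavieClose.norm_apply_add_contract_sub_le
    (H : DavieClose T a b α C M D σ ζ ζ' A A' J J' x x') {s u t : ℝ} (hs : a ≤ s) (hsu : s ≤ u)
    (hut : u ≤ t) (ht : t ≤ b) (F F' : E d →L[ℝ] X) (L L' : E d →L[ℝ] E d →L[ℝ] X) :
    ‖F (inc ζ u t) + contract L (A u t) - (F' (inc ζ' u t) + contract L' (A' u t))‖ ≤
      C * (‖F - F'‖ + scale s t * ‖L - L'‖) * (t - s) ^ α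
        + D * (‖F'‖ + scale s t * ‖L'‖) * (t - s) ^ α := by
  have hC := H.left.one_le
  have hau := hs.trans hsu
  have hD := H.dist_nonneg hau hut ht
  have hα : 0 ≤ α := by linarith [H.left.lt_exponent]
  have hsplit : F (inc ζ u t) + contract L (A u t) - (F' (inc ζ' u t) + contract L' (A' u t)) =
      ((F - F') (inc ζ u t) + contract (L - L') (A u t))
        + (F' (inc ζ u t - inc ζ' u t) + contract L' (A u t - A' u t)) := by
    rw [_root_.sub_apply, map_sub, contract_sub_left, contract_sub_right]; abel
  have hp : 0 ≤ (t - u) ^ α := Real.rpow_nonneg (sub_nonneg.2 hut) α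
  have hpow : (t - u) ^ α ≤ (t - s) ^ α := by gcongr
  have hpq := H.left.rpow_le_scale hs (hsu.trans hut) ht
  have harea : entrySum (A u t - A' u t) ≤ D * ((t - u) ^ α) ^ 2 :=
    (H.area u t hau hut ht).trans_eq (by rw [rpow_two_mul_eq (sub_nonneg.2 hut)])
  rw [hsplit]
  exact norm_add_le_of_le
    (norm_apply_add_contract_le _ _ (by linarith) (hp.trans hpow) hpq
      ((H.left.driver.path u t hau hut ht).trans (by gcongr))
      ((H.left.entrySum_le hau hut ht).trans (by gcongr)))
    (norm_apply_add_contract_le _ _ hD (hp.trans hpow) hpq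
      ((H.path u t hau hut ht).trans (by gcongr)) (harea.trans (by gcongr)))

theorem DavieClose.norm_delta_sub_le (H : DavieClose T a b α C M D σ ζ ζ' A A' J J' x x')
    {B : ℝ} (hB : 5 * C ^ 2 + M ≤ B) {s u t : ℝ} (hs : a ≤ s) (hsu : s ≤ u) (hut : u ≤ t)
    (ht : t ≤ b) :
    ‖delta (davieRemainder σ ζ A J x) s u t - delta (davieRemainder σ ζ' A' J' x') s u t‖ ≤
      15 * B ^ 4 * D * (t - s) ^ (2 / 3 + α) + 4 * B ^ 3 * (t - s) ^ α *
        ‖davieRemainder σ ζ A J x s u - davieRemainder σ ζ' A' J' x' s u‖ := by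
  have hC := H.left.one_le
  have hM := H.nonneg
  have hub := hut.trans ht
  have hD := H.dist_nonneg hs hsu hub
  have hα : 0 ≤ α := by linarith [H.left.lt_exponent]
  have hCB : C ≤ B := by nlinarith
  have hB1 : 1 ≤ B := hC.trans hCB
  obtain ⟨-, -, hF', hL'⟩ := H.right.one_step_le hM H.right_remainder hs hsu hub hB
  have hF := H.norm_remainder_field_sub_le hs hsu hub hB
  have hL := H.norm_inc_levyField_sub_le hs hsu hub hB
  set R := ‖davieRemainder σ ζ A J x s u - davieRemainder σ ζ' A' J' x' s u‖
  have : 0 ≤ R := norm_nonneg _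
  rw [delta_davieRemainder (H.left.driver.chen s u t hs hsu hut ht)
      (H.left.drift_add s u t hs hsu hut ht),
    delta_davieRemainder (H.right.driver.chen s u t hs hsu hut ht)
      (H.right.drift_add s u t hs hsu hut ht), rpow_two_thirds_add hα (hsu.trans hut)]
  set F := remainder ζ (fun r => σ r (x r)) (fun r => levyField σ r (x r)) s u
  set F' := remainder ζ' (fun r => σ r (x' r)) (fun r => levyField σ r (x' r)) s u
  set L := inc (fun r => levyField σ r (x r)) s u
  set L' := inc (fun r => levyField σ r (x' r)) s u
  have hq := scale_nonneg s t
  have hqs := scale_nonneg s u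
  have hmono := scale_mono hsu hut
  have hq1 := H.left.scale_le_one hs (hsu.trans hut) ht
  have hp : 0 ≤ (t - s) ^ α := Real.rpow_nonneg (sub_nonneg.2 (hsu.trans hut)) α
  calc _ ≤ C * (‖F - F'‖ + scale s t * ‖L - L'‖) * (t - s) ^ α
        + D * (‖F'‖ + scale s t * ‖L'‖) * (t - s) ^ α :=
        H.norm_apply_add_contract_sub_le hs hsu hut ht F F' L L'
    _ ≤ B * (7 * B ^ 3 * D * scale s t ^ 2 + 3 * B ^ 2 * R
          + (scale s t * (3 * B ^ 2 * D * scale s t) + 1 * (B * R))) * (t - s) ^ α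
        + D * (3 * B ^ 3 * scale s t ^ 2 + scale s t * (2 * B ^ 2 * scale s t))
          * (t - s) ^ α := by
      gcongr
      · exact hF.trans (by gcongr)
      · refine (mul_le_mul_of_nonneg_left hL hq).trans ?_
        rw [mul_add]
        gcongr
      · exact hF'.trans (by gcongr)
      · exact hL'.trans (by gcongr)
    _ = (7 * B ^ 4 + 6 * B ^ 3 + 2 * B ^ 2) * D * (scale s t ^ 2 * (t - s) ^ α)
        + (3 * B ^ 3 + B ^ 2) * (t - s) ^ α * R := by ring
    _ ≤ (7 * B ^ 4 + 6 * B ^ 4 + 2 * B ^ 4) * D * (scale s t ^ 2 * (t - s) ^ α)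
        + (3 * B ^ 3 + B ^ 3) * (t - s) ^ α * R := by
      gcongr <;> first | exact hB1 | norm_num
    _ = _ := by ring

/-- The constant that has to be small, after multiplication by the cube root of the length of the
interval, for the equation to be contractive. -/
def stabilityConst (α C M : ℝ) : ℝ := 35 * sewingConst (2 / 3 + α) * (5 * C ^ 2 + M) ^ 4

theorem stabilityConst_nonneg (hα : 1 / 3 < α) : 0 ≤ stabilityConst α C M := by
  have := one_le_sewingConst (θ := 2 / 3 + α) (by linarith)
  unfold stabilityConst
  positivity

theorem DavieClose.norm_davieRemainder_sub_le
    (H : DavieClose T a b α C M D σ ζ ζ' A A' J J' x x') (hab : a ≤ b)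
    (hsmall : stabilityConst α C M * (b - a) ^ (1 / 3 : ℝ) ≤ 1 / 2) :
    HolderBound a b (2 / 3 + α) (30 * sewingConst (2 / 3 + α) * (5 * C ^ 2 + M) ^ 4 * D)
      (fun s t => davieRemainder σ ζ A J x s t - davieRemainder σ ζ' A' J' x' s t) := by
  have hα := H.left.lt_exponent
  have hC := H.left.one_le
  have hM := H.nonneg
  have hD := H.dist_nonneg le_rfl hab le_rfl
  have hc := one_le_sewingConst (θ := 2 / 3 + α) (by linarith)
  have hpow := H.left.rpow_le_scale le_rfl hab le_rfl
  rw [scale_eq hab] at hpow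
  have hsum : HolderBound a b (2 / 3 + α) (M + M)
      (fun s t => davieRemainder σ ζ A J x s t - davieRemainder σ ζ' A' J' x' s t) := by
    intro s t hs hst ht
    rw [add_mul]
    exact norm_sub_le_of_le (H.left_remainder hs hst ht) (H.right_remainder hs hst ht)
  refine (HolderBound.of_delta_self (α := α) (P := 15 * (5 * C ^ 2 + M) ^ 4 * D)
    (Q := 4 * (5 * C ^ 2 + M) ^ 3) (by linarith) (by linarith) (by linarith) (by linarith)
    H.left.short (by positivity) (by positivity) ?_ hsum ?_).mono_const (le_of_eq (by ring))
  · refine le_trans ?_ hsmall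
    have hB1 : 1 ≤ 5 * C ^ 2 + M := by nlinarith
    have : 0 ≤ (b - a) ^ (1 / 3 : ℝ) := Real.rpow_nonneg (sub_nonneg.2 hab) _
    calc _ ≤ sewingConst (2 / 3 + α) * (35 * (5 * C ^ 2 + M) ^ 4) * (b - a) ^ (1 / 3 : ℝ) := by
          gcongr <;> first | exact hB1 | norm_num
      _ = _ := by rw [stabilityConst]; ring
  · intro s u t hs hsu hut ht
    have hdelta : delta (fun s t => davieRemainder σ ζ A J x s t
        - davieRemainder σ ζ' A' J' x' s t) s u t =
        delta (davieRemainder σ ζ A J x) s u t - delta (davieRemainder σ ζ' A' J' x') s u t := by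
      simp only [delta]; abel
    rw [hdelta]
    exact H.norm_delta_sub_le le_rfl hs hsu hut ht

theorem DavieClose.norm_sub_le (H : DavieClose T a b α C M D σ ζ ζ' A A' J J' x x')
    (hsmall : stabilityConst α C M * (b - a) ^ (1 / 3 : ℝ) ≤ 1 / 2) {t : ℝ}
    (ht : t ∈ Icc a b) : ‖x t - x' t‖ ≤ ‖x a - x' a‖ + D / 2 := by
  have hα := H.left.lt_exponent
  have hC := H.left.one_le
  have hM := H.nonneg
  have hab := ht.1.trans ht.2
  have hD := H.dist_nonneg le_rfl hab le_rfl
  have hc := one_le_sewingConst (θ := 2 / 3 + α) (by linarith)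
  have hB1 : 1 ≤ 5 * C ^ 2 + M := by nlinarith
  have hq : scale a t ≤ (b - a) ^ (1 / 3 : ℝ) := scale_eq hab ▸ scale_mono ht.1 ht.2
  have hq0 := scale_nonneg a t
  have hpow : (t - a) ^ (2 / 3 + α) ≤ scale a t := by
    rw [scale_eq ht.1]
    exact Real.rpow_le_rpow_of_exponent_ge' (sub_nonneg.2 ht.1)
      (by linarith [H.left.short, ht.2]) (by norm_num) (by linarith)
  have hsplit : x t - x' t = (x a - x' a) + (inc x a t - inc x' a t) := by simp only [inc]; abel
  rw [hsplit]
  refine norm_add_le_of_le le_rfl ((H.norm_inc_sub_le le_rfl ht.1 ht.2).trans ?_)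
  calc _ ≤ 5 * C ^ 2 * D * scale a t
        + 30 * sewingConst (2 / 3 + α) * (5 * C ^ 2 + M) ^ 4 * D * scale a t := by
        gcongr
        exact (H.norm_davieRemainder_sub_le hab hsmall le_rfl ht.1 ht.2).trans (by gcongr)
    _ ≤ 5 * (sewingConst (2 / 3 + α) * (5 * C ^ 2 + M) ^ 4) * D * (b - a) ^ (1 / 3 : ℝ)
        + 30 * sewingConst (2 / 3 + α) * (5 * C ^ 2 + M) ^ 4 * D * (b - a) ^ (1 / 3 : ℝ) := by
      have hB4 := le_self_pow₀ hB1 four_ne_zero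
      have hcB : (5 * C ^ 2 + M) ^ 4 ≤ sewingConst (2 / 3 + α) * (5 * C ^ 2 + M) ^ 4 :=
        le_mul_of_one_le_left (by positivity) hc
      have h5 : 5 * C ^ 2 ≤ 5 * (sewingConst (2 / 3 + α) * (5 * C ^ 2 + M) ^ 4) := by
        linarith [hB4.trans hcB, sq_nonneg C]
      gcongr
    _ = stabilityConst α C M * (b - a) ^ (1 / 3 : ℝ) * D := by rw [stabilityConst]; ring
    _ ≤ 1 / 2 * D := by gcongr
    _ = D / 2 := by ring

end Contraction

end Stability

section Global

variable {d : ℕ} {X : Type*} [NormedAddCommGroup X]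

/-- A drift that is bounded by `C`, `C`-Lipschitz in space and continuous in time on `[a, b]`. -/
structure DriftField (a b C : ℝ) (β : ℝ → X → X) : Prop where
  bound : ∀ r ∈ Icc a b, ∀ x, ‖β r x‖ ≤ C
  lip : ∀ r ∈ Icc a b, ∀ x y, ‖β r x - β r y‖ ≤ C * ‖x - y‖
  cont : ∀ x, ContinuousOn (fun r => β r x) (Icc a b)

section Drift

variable {a b C : ℝ} {β : ℝ → X → X} {x x' : ℝ → X}

theorem DriftField.continuousOn_comp (hβ : DriftField a b C β) (hx : ContinuousOn x (Icc a b)) :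
    ContinuousOn (fun r => β r (x r)) (Icc a b) := by
  have h : ContinuousOn (Function.uncurry fun (y : X) (r : ℝ) => β r y) (univ ×ˢ Icc a b) :=
    continuousOn_prod_of_continuousOn_lipschitzOnWith _ C.toNNReal
      (fun y _ => hβ.cont y)
      (fun r hr => LipschitzOnWith.of_dist_le_mul fun y _ z _ => by
        rw [dist_eq_norm, dist_eq_norm]
        exact (hβ.lip r hr y z).trans (by gcongr; exact Real.le_coe_toNNReal C))
  exact h.comp (hx.prodMk continuousOn_id) fun r hr => ⟨mem_univ _, hr⟩

theorem DriftField.intervalIntegrable (hβ : DriftField a b C β) (hx : ContinuousOn x (Icc a b))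
    {s t : ℝ} (hs : a ≤ s) (hst : s ≤ t) (ht : t ≤ b) :
    IntervalIntegrable (fun r => β r (x r)) volume s t :=
  ((hβ.continuousOn_comp hx).mono (Icc_subset_Icc hs ht)).intervalIntegrable_of_Icc hst

variable [NormedSpace ℝ X]

/-- The increments of the integral of the drift along a path. -/
def driftIncrement (β : ℝ → X → X) (x : ℝ → X) (s t : ℝ) : X :=
  ∫ u in s..t, β u (x u)

theorem DriftField.driftIncrement_add (hβ : DriftField a b C β) (hx : ContinuousOn x (Icc a b))
    {s u t : ℝ} (hs : a ≤ s) (hsu : s ≤ u) (hut : u ≤ t) (ht : t ≤ b) :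
    driftIncrement β x s t = driftIncrement β x s u + driftIncrement β x u t :=
  (intervalIntegral.integral_add_adjacent_intervals
    (hβ.intervalIntegrable hx hs hsu (hut.trans ht))
    (hβ.intervalIntegrable hx (hs.trans hsu) hut ht)).symm

theorem DriftField.norm_driftIncrement_le (hβ : DriftField a b C β) (x : ℝ → X)
    {s t : ℝ} (hs : a ≤ s) (hst : s ≤ t) (ht : t ≤ b) :
    ‖driftIncrement β x s t‖ ≤ C * (t - s) := by
  refine (intervalIntegral.norm_integral_le_of_norm_le_const (C := C) fun r hr => ?_).trans_eq
    (by rw [abs_of_nonneg (sub_nonneg.2 hst)])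
  rw [uIoc_of_le hst] at hr
  exact hβ.bound r ⟨hs.trans hr.1.le, hr.2.trans ht⟩ _

theorem DriftField.norm_driftIncrement_sub_le (hβ : DriftField a b C β)
    (hx : ContinuousOn x (Icc a b)) (hx' : ContinuousOn x' (Icc a b)) (hC : 0 ≤ C) {D : ℝ}
    {s t : ℝ} (hs : a ≤ s) (hst : s ≤ t) (ht : t ≤ b)
    (hD : ∀ r ∈ Icc s t, ‖x r - x' r‖ ≤ D) :
    ‖driftIncrement β x s t - driftIncrement β x' s t‖ ≤ C * D * (t - s) := by
  rw [driftIncrement, driftIncrement, ← intervalIntegral.integral_sub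
    (hβ.intervalIntegrable hx hs hst ht) (hβ.intervalIntegrable hx' hs hst ht)]
  refine (intervalIntegral.norm_integral_le_of_norm_le_const (C := C * D) fun r hr => ?_).trans_eq
    (by rw [abs_of_nonneg (sub_nonneg.2 hst)])
  rw [uIoc_of_le hst] at hr
  exact (hβ.lip r ⟨hs.trans hr.1.le, hr.2.trans ht⟩ _ _).trans
    (mul_le_mul_of_nonneg_left (hD r ⟨hr.1.le, hr.2⟩) hC)

end Drift

section LocalToGlobal

variable {a b h ϱ : ℝ}

theorem exists_pos_mul_rpow_le_half {K α : ℝ} (hK : 0 ≤ K) (hα : 0 < α) :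
    ∃ h > (0 : ℝ), h ≤ 1 ∧ K * h ^ α ≤ 1 / 2 := by
  have hpos : 0 < 1 / (2 * (K + 1)) := by positivity
  refine ⟨(1 / (2 * (K + 1))) ^ (1 / α), by positivity,
    Real.rpow_le_one hpos.le ?_ (by positivity), ?_⟩
  · rw [div_le_one (by positivity)]; linarith
  · rw [← Real.rpow_mul hpos.le, one_div_mul_cancel hα.ne', Real.rpow_one, mul_one_div,
      div_le_div_iff₀ (by positivity) (by norm_num)]
    linarith

theorem add_le_two_pow_mul_of_local_le {f : ℝ → ℝ} (hh : 0 < h)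
    (hf : ∀ c e, a ≤ c → c ≤ e → e ≤ b → e - c ≤ h → f e ≤ 2 * f c + ϱ) (n : ℕ) :
    ∀ t ∈ Icc a b, t ≤ a + n * h → f t + ϱ ≤ 2 ^ n * (f a + ϱ) := by
  induction n with
  | zero =>
    rintro t ⟨hat, -⟩ htn
    rw [Nat.cast_zero, zero_mul, add_zero] at htn
    rw [le_antisymm htn hat, pow_zero, one_mul]
  | succ n ih =>
    rintro t ⟨hat, htb⟩ htn
    push_cast at htn
    have hct : max a (t - h) ≤ t := max_le hat (by linarith)
    have hcn : max a (t - h) ≤ a + n * h :=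
      max_le (by nlinarith [n.cast_nonneg (α := ℝ)]) (by linarith)
    have hc := ih _ ⟨le_max_left _ _, hct.trans htb⟩ hcn
    have hstep := hf _ t (le_max_left _ _) hct htb (by linarith [le_max_right a (t - h)])
    rw [pow_succ]
    linarith

theorem exists_le_mul_add_of_local_le (T : ℝ) (hh : 0 < h) :
    ∃ K ≥ (0 : ℝ), ∀ a ≥ 0, ∀ (f : ℝ → ℝ) (ϱ : ℝ), 0 ≤ ϱ →
      (∀ c e, a ≤ c → c ≤ e → e ≤ T → e - c ≤ h → f e ≤ 2 * f c + ϱ) →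
      ∀ t ∈ Icc a T, f t ≤ K * (f a + ϱ) := by
  refine ⟨2 ^ ⌈T / h⌉₊, by positivity, fun a ha f ϱ hϱ hf t ht => ?_⟩
  have hceil := (div_le_iff₀ hh).1 (Nat.le_ceil (T / h))
  exact (le_add_of_nonneg_right hϱ).trans
    (add_le_two_pow_mul_of_local_le hh hf _ t ht (by linarith [ht.2]))

end LocalToGlobal

variable [NormedSpace ℝ X]

/-- A continuous path whose second order expansion along the driver has a remainder of order
larger than one. -/
structure DavieSolution (a b : ℝ) (β : ℝ → X → X) (σ : ℝ → X → E d →L[ℝ] X) (ζ : ℝ → E d)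
    (A : ℝ → ℝ → Fin d → Fin d → ℝ) (x : ℝ → X) : Prop where
  cont : ContinuousOn x (Icc a b)
  rem : ∃ θ > (1 : ℝ), ∃ M : ℝ,
    HolderBound a b θ M (davieRemainder σ ζ A (driftIncrement β x) x)

/-- A Davie solution on `[a, T]` for a drift and a driver controlled by `C`. -/
structure DrivenSolution (a T α C : ℝ) (β : ℝ → X → X) (σ : ℝ → X → E d →L[ℝ] X) (ζ : ℝ → E d)
    (A : ℝ → ℝ → Fin d → Fin d → ℝ) (x : ℝ → X) : Prop where
  nonneg : 0 ≤ a
  drift : DriftField a T C β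
  driver : DriverBound a T α C ζ A
  solution : DavieSolution a T β σ ζ A x

/-- The standing assumptions on the exponent, the bounding constant and the vector field. -/
structure RoughData (T α C : ℝ) (σ : ℝ → X → E d →L[ℝ] X) : Prop where
  lt_exponent : 1 / 3 < α
  one_le : 1 ≤ C
  field : FieldRegular T C σ

/-- Interval on which the equation is contractive, with remainders bounded by `aprioriConst`. -/
def IsShort (α C c e : ℝ) : Prop :=
  c ≤ e ∧ e - c ≤ 1 ∧ stabilityConst α C (aprioriConst α C) * (e - c) ^ (1 / 3 : ℝ) ≤ 1 / 2

variable {T a α C c e ϱ : ℝ} {β : ℝ → X → X} {σ : ℝ → X → E d →L[ℝ] X} {ζ ζ' : ℝ → E d}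
  {A A' : ℝ → ℝ → Fin d → Fin d → ℝ} {x x' : ℝ → X}

theorem DriverBound.mono {a b a' b' : ℝ} (h : DriverBound a b α C ζ A) (ha : a ≤ a')
    (hb : b' ≤ b) : DriverBound a' b' α C ζ A where
  path s t hs hst ht := h.path s t (ha.trans hs) hst (ht.trans hb)
  area s t hs hst ht := h.area s t (ha.trans hs) hst (ht.trans hb)
  chen s u t hs hsu hut ht := h.chen s u t (ha.trans hs) hsu hut (ht.trans hb)

theorem exists_forall_isShort (hα : 1 / 3 < α) :
    ∃ h > (0 : ℝ), ∀ c e, c ≤ e → e - c ≤ h → IsShort α C c e := by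
  have hK : 0 ≤ stabilityConst α C (aprioriConst α C) := stabilityConst_nonneg hα
  obtain ⟨h, hpos, hle, hsmall⟩ := exists_pos_mul_rpow_le_half hK (α := 1 / 3) (by norm_num)
  refine ⟨h, hpos, fun c e hce hec => ⟨hce, hec.trans hle, le_trans ?_ hsmall⟩⟩
  gcongr

theorem IsShort.apriori_le (h : IsShort α C c e) (hα : 1 / 3 < α) (hC : 1 ≤ C) :
    sewingConst (2 / 3 + α) * (4 * (3 * C ^ 2) ^ 2) * (e - c) ^ α ≤ 1 / 2 := by
  have hM : 0 ≤ aprioriConst α C := aprioriConst_nonneg hα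
  have hc := one_le_sewingConst (θ := 2 / 3 + α) (by linarith)
  have hpow : (e - c) ^ α ≤ (e - c) ^ (1 / 3 : ℝ) :=
    scale_eq h.1 ▸ rpow_le_scale hα h.1 h.2.1
  refine le_trans ?_ h.2.2
  rw [stabilityConst, mul_right_comm 35, mul_comm (35 * _)]
  have hconst : 4 * (3 * C ^ 2) ^ 2 ≤ 35 * (5 * C ^ 2 + aprioriConst α C) ^ 4 := by
    have hC2 : 1 ≤ 5 * C ^ 2 := by nlinarith
    calc 4 * (3 * C ^ 2) ^ 2 ≤ 35 * (5 * C ^ 2) ^ 2 := by nlinarith [sq_nonneg (C ^ 2)]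
      _ ≤ 35 * (5 * C ^ 2) ^ 4 := by gcongr; norm_num
      _ ≤ _ := by gcongr; linarith
  have := Real.rpow_nonneg (sub_nonneg.2 h.1) α
  gcongr

namespace DrivenSolution

theorem davieSetup (H : RoughData T α C σ) (hx : DrivenSolution a T α C β σ ζ A x)
    (hc : a ≤ c) (he : e ≤ T) (hce : e - c ≤ 1) :
    DavieSetup T c e α C σ ζ A (driftIncrement β x) where
  nonneg := hx.nonneg.trans hc
  le_end := he
  short := hce
  lt_exponent := H.lt_exponent
  one_le := H.one_le
  field := H.field
  driver := hx.driver.mono hc he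
  drift_add _ _ _ hs hsu hut ht :=
    hx.drift.driftIncrement_add hx.solution.cont (hc.trans hs) hsu hut (ht.trans he)
  drift_le _ _ hs hst ht :=
    hx.drift.norm_driftIncrement_le x (hc.trans hs) hst (ht.trans he)

theorem holderBound_davieRemainder (H : RoughData T α C σ)
    (hx : DrivenSolution a T α C β σ ζ A x) (hc : a ≤ c) (he : e ≤ T) (hce : IsShort α C c e) :
    HolderBound c e (2 / 3 + α) (aprioriConst α C)
      (davieRemainder σ ζ A (driftIncrement β x) x) := by
  obtain ⟨θ, hθ, M, hM⟩ := hx.solution.rem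
  exact (hx.davieSetup H hc he hce.2.1).holderBound_davieRemainder hθ
    (fun _ _ hs hst ht => hM (hc.trans hs) hst (ht.trans he))
    (hce.apriori_le H.lt_exponent H.one_le)

theorem davieClose (H : RoughData T α C σ) (hx : DrivenSolution a T α C β σ ζ A x)
    (hx' : DrivenSolution a T α C β σ ζ' A' x') (hϱ : 0 ≤ ϱ)
    (hζ : ∀ s t, a ≤ s → s ≤ t → t ≤ T → ‖inc ζ s t - inc ζ' s t‖ ≤ ϱ * (t - s) ^ α)
    (hA : ∀ s t, a ≤ s → s ≤ t → t ≤ T → entrySum (A s t - A' s t) ≤ ϱ * (t - s) ^ (2 * α))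
    (hc : a ≤ c) (he : e ≤ T) (hce : IsShort α C c e) {S : ℝ} (hS0 : 0 ≤ S)
    (hS : ∀ r ∈ Icc c e, ‖x r - x' r‖ ≤ S) :
    DavieClose T c e α C (aprioriConst α C) (S + ϱ) σ ζ ζ' A A' (driftIncrement β x)
      (driftIncrement β x') x x' where
  left := hx.davieSetup H hc he hce.2.1
  right := hx'.davieSetup H hc he hce.2.1
  nonneg := aprioriConst_nonneg H.lt_exponent
  left_remainder := hx.holderBound_davieRemainder H hc he hce
  right_remainder := hx'.holderBound_davieRemainder H hc he hce
  path _ _ hs hst ht := (hζ _ _ (hc.trans hs) hst (ht.trans he)).trans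
    (mul_le_mul_of_nonneg_right (le_add_of_nonneg_left hS0)
      (Real.rpow_nonneg (sub_nonneg.2 hst) _))
  area _ _ hs hst ht := (hA _ _ (hc.trans hs) hst (ht.trans he)).trans
    (mul_le_mul_of_nonneg_right (le_add_of_nonneg_left hS0)
      (Real.rpow_nonneg (sub_nonneg.2 hst) _))
  drift _ _ hs hst ht := hx.drift.norm_driftIncrement_sub_le hx.solution.cont hx'.solution.cont
    (zero_le_one.trans H.one_le) (hc.trans hs) hst (ht.trans he) fun r hr =>
      (hS r ⟨hs.trans hr.1, hr.2.trans ht⟩).trans (le_add_of_nonneg_right hϱ)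
  value _ hr := (hS _ hr).trans (le_add_of_nonneg_right hϱ)

theorem norm_sub_le_of_isShort (H : RoughData T α C σ) (hx : DrivenSolution a T α C β σ ζ A x)
    (hx' : DrivenSolution a T α C β σ ζ' A' x') (hϱ : 0 ≤ ϱ)
    (hζ : ∀ s t, a ≤ s → s ≤ t → t ≤ T → ‖inc ζ s t - inc ζ' s t‖ ≤ ϱ * (t - s) ^ α)
    (hA : ∀ s t, a ≤ s → s ≤ t → t ≤ T → entrySum (A s t - A' s t) ≤ ϱ * (t - s) ^ (2 * α))
    (hc : a ≤ c) (he : e ≤ T) (hce : IsShort α C c e) :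
    ‖x e - x' e‖ ≤ 2 * ‖x c - x' c‖ + ϱ := by
  have hcont : ContinuousOn (fun t => x t - x' t) (Icc c e) :=
    (hx.solution.cont.sub hx'.solution.cont).mono (Icc_subset_Icc hc he)
  obtain ⟨B, hB⟩ := isCompact_Icc.exists_bound_of_continuousOn hcont
  have hhalf : ‖x e - x' e‖ ≤ 2 * (‖x c - x' c‖ + ϱ / 2) := by
    refine le_two_mul_of_forall_add_half_mem
      (S := {S | 0 ≤ S ∧ ∀ r ∈ Icc c e, ‖x r - x' r‖ ≤ S})
      ⟨B, (norm_nonneg _).trans (hB c (left_mem_Icc.2 hce.1)), hB⟩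
      (fun S hS => hS.2 e (right_mem_Icc.2 hce.1)) fun S hS => ⟨?_, fun r hr => ?_⟩
    · have := hS.1
      positivity
    · linarith [(hx.davieClose H hx' hϱ hζ hA hc he hce hS.1 hS.2).norm_sub_le hce.2.2 hr]
  linarith

end DrivenSolution

theorem RoughData.exists_norm_sub_le (H : RoughData T α C σ) :
    ∃ K ≥ (0 : ℝ), ∀ a β ζ A x ζ' A' x' ϱ, DrivenSolution a T α C β σ ζ A x →
      DrivenSolution a T α C β σ ζ' A' x' → 0 ≤ ϱ →
      (∀ s t, a ≤ s → s ≤ t → t ≤ T → ‖inc ζ s t - inc ζ' s t‖ ≤ ϱ * (t - s) ^ α) →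
      (∀ s t, a ≤ s → s ≤ t → t ≤ T → entrySum (A s t - A' s t) ≤ ϱ * (t - s) ^ (2 * α)) →
      ∀ t ∈ Icc a T, ‖x t - x' t‖ ≤ K * (‖x a - x' a‖ + ϱ) := by
  obtain ⟨h, hpos, hshort⟩ := exists_forall_isShort H.lt_exponent
  obtain ⟨K, hK, hglobal⟩ := exists_le_mul_add_of_local_le T hpos
  refine ⟨K, hK, fun a β ζ A x ζ' A' x' ϱ hx hx' hϱ hζ hA => ?_⟩
  exact hglobal a hx.nonneg (fun t => ‖x t - x' t‖) ϱ hϱ fun c e hac hce he hec =>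
    hx.norm_sub_le_of_isShort H hx' hϱ hζ hA hac he (hshort c e hce hec)

theorem RoughData.exists_norm_sub_init_le (H : RoughData T α C σ) :
    ∃ K ≥ (0 : ℝ), ∀ a β ζ A x, DrivenSolution a T α C β σ ζ A x →
      ∀ t ∈ Icc a T, ‖x t - x a‖ ≤ K := by
  have hC := H.one_le
  have hM : 0 ≤ aprioriConst α C := aprioriConst_nonneg H.lt_exponent
  obtain ⟨h, hpos, hshort⟩ := exists_forall_isShort H.lt_exponent
  obtain ⟨K, hK, hglobal⟩ := exists_le_mul_add_of_local_le T hpos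
  refine ⟨K * (3 * C ^ 2 + aprioriConst α C), by positivity, fun a β ζ A x hx t ht => ?_⟩
  have hlocal := hglobal a hx.nonneg (fun t => ‖x t - x a‖) (3 * C ^ 2 + aprioriConst α C)
    (by positivity) (fun c e hac hce he hec => ?_) t ht
  · simpa only [sub_self, norm_zero, zero_add] using hlocal
  have hs := hshort c e hce hec
  have hq := scale_le_one hce hs.2.1
  have S := hx.davieSetup H hac he hs.2.1
  have hinc : ‖inc x c e‖ ≤ 3 * C ^ 2 + aprioriConst α C := by
    refine (S.norm_inc_le le_rfl hce le_rfl x).trans (add_le_add ?_ ?_)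
    · exact mul_le_of_le_one_right (by positivity) hq
    · exact (hx.holderBound_davieRemainder H hac he hs le_rfl hce le_rfl).trans
        (mul_le_of_le_one_right hM (Real.rpow_le_one (sub_nonneg.2 hce) hs.2.1
          (by linarith [H.lt_exponent])))
  have hsplit : x e - x a = inc x c e + (x c - x a) := by rw [inc]; abel
  calc ‖x e - x a‖ ≤ 3 * C ^ 2 + aprioriConst α C + ‖x c - x a‖ :=
        hsplit ▸ norm_add_le_of_le hinc le_rfl
    _ ≤ _ := by linarith [norm_nonneg (x c - x a)]

end Global

section IntegralEquation

variable {X : Type*} [NormedAddCommGroup X] [NormedSpace ℝ X] [CompleteSpace X] {a b C : ℝ}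
  {β : ℝ → X → X}

theorem DriftField.exists_integral_solution (hβ : DriftField a b C β) (hab : a ≤ b)
    (hC : 0 ≤ C) (y : X) :
    ∃ x, ContinuousOn x (Icc a b) ∧ ∀ t ∈ Icc a b, x t = y + driftIncrement β x a t := by
  have hpl : IsPicardLindelof β (tmin := a) (tmax := b) ⟨a, le_rfl, hab⟩ y
      (C.toNNReal * (b - a).toNNReal) 0 C.toNNReal C.toNNReal := by
    refine ⟨fun t ht => LipschitzOnWith.of_dist_le_mul fun p _ q _ => ?_,
      fun x _ => hβ.cont x, fun t ht x _ => ?_, ?_⟩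
    · rw [dist_eq_norm, dist_eq_norm, Real.coe_toNNReal _ hC]
      exact hβ.lip t ht p q
    · rw [Real.coe_toNNReal _ hC]
      exact hβ.bound t ht x
    · simp [Real.coe_toNNReal _ hC, Real.coe_toNNReal _ (sub_nonneg.2 hab), hab]
  obtain ⟨x, hxa, hx⟩ := hpl.exists_eq_forall_mem_Icc_hasDerivWithinAt₀
  have hcont : ContinuousOn x (Icc a b) := fun t ht => (hx t ht).continuousWithinAt
  refine ⟨x, hcont, fun t ht => ?_⟩
  have hint : driftIncrement β x a t = x t - x a :=
    intervalIntegral.integral_eq_sub_of_hasDerivAt_of_le ht.1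
      (hcont.mono (Icc_subset_Icc_right ht.2))
      (fun r hr => (hx r ⟨hr.1.le, hr.2.le.trans ht.2⟩).hasDerivAt
        (Icc_mem_nhds hr.1 (hr.2.trans_le ht.2)))
      (hβ.intervalIntegrable hcont le_rfl ht.1 ht.2)
  rw [hint, ← hxa]
  abel

theorem DriftField.hasDerivWithinAt_of_integral_eq (hβ : DriftField a b C β) {y : X} {x : ℝ → X}
    (hx : ContinuousOn x (Icc a b)) (h : ∀ t ∈ Icc a b, x t = y + driftIncrement β x a t)
    {t : ℝ} (ht : t ∈ Ico a b) : HasDerivWithinAt x (β t (x t)) (Ici t) t := by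
  have ht' := Ico_subset_Icc_self ht
  have hβx := hβ.continuousOn_comp hx
  have : Fact (t ∈ Icc a b) := ⟨ht'⟩
  have hderiv : HasDerivWithinAt (driftIncrement β x a) (β t (x t)) (Icc a b) t :=
    intervalIntegral.integral_hasDerivWithinAt_right
      (hβ.intervalIntegrable hx le_rfl ht.1 ht.2.le)
      (hβx.stronglyMeasurableAtFilter_nhdsWithin measurableSet_Icc t) (hβx t ht')
  exact ((hderiv.const_add y).congr h (h t ht')).mono_of_mem_nhdsWithin
    (mem_of_superset (Icc_mem_nhdsGE ht.2) (Icc_subset_Icc_left ht.1))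

theorem DriftField.integral_solution_unique (hβ : DriftField a b C β) {y : X} {x x' : ℝ → X}
    (hx : ContinuousOn x (Icc a b)) (hx' : ContinuousOn x' (Icc a b))
    (h : ∀ t ∈ Icc a b, x t = y + driftIncrement β x a t)
    (h' : ∀ t ∈ Icc a b, x' t = y + driftIncrement β x' a t) : EqOn x x' (Icc a b) := by
  intro t ht
  have ha : a ∈ Icc a b := left_mem_Icc.2 (ht.1.trans ht.2)
  have hinit : x a = x' a := by
    rw [h a ha, h' a ha, driftIncrement, driftIncrement, intervalIntegral.integral_same,
      intervalIntegral.integral_same]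
  refine ODE_solution_unique_of_mem_Icc_right (v := β) (s := fun _ => univ) (K := C.toNNReal)
    (fun r hr => LipschitzOnWith.of_dist_le_mul fun p _ q _ => ?_)
    hx (fun r hr => hβ.hasDerivWithinAt_of_integral_eq hx h hr) (fun _ _ => mem_univ _)
    hx' (fun r hr => hβ.hasDerivWithinAt_of_integral_eq hx' h' hr) (fun _ _ => mem_univ _)
    hinit ht
  rw [dist_eq_norm, dist_eq_norm]
  exact (hβ.lip r (Ico_subset_Icc_self hr) p q).trans (by gcongr; exact Real.le_coe_toNNReal C)

end IntegralEquation

section Smooth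

variable {d : ℕ} {T : ℝ} {ζ : ℝ → E d} {s u t : ℝ}

theorem pathDeriv_continuousOn (hT : 0 < T) (hζ : ContDiffOn ℝ 1 ζ (Icc 0 T)) :
    ContinuousOn (pathDeriv T ζ) (Icc 0 T) :=
  hζ.continuousOn_derivWithin (uniqueDiffOn_Icc hT) le_rfl

theorem pathDeriv_intervalIntegrable (hT : 0 < T) (hζ : ContDiffOn ℝ 1 ζ (Icc 0 T))
    (hs : 0 ≤ s) (hst : s ≤ t) (ht : t ≤ T) :
    IntervalIntegrable (pathDeriv T ζ) volume s t :=
  ((pathDeriv_continuousOn hT hζ).mono (Icc_subset_Icc hs ht)).intervalIntegrable_of_Icc hst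

theorem integral_pathDeriv (hT : 0 < T) (hζ : ContDiffOn ℝ 1 ζ (Icc 0 T)) (hs : 0 ≤ s)
    (hst : s ≤ t) (ht : t ≤ T) : ∫ r in s..t, pathDeriv T ζ r = inc ζ s t := by
  refine intervalIntegral.integral_eq_sub_of_hasDerivAt_of_le hst
    (hζ.continuousOn.mono (Icc_subset_Icc hs ht)) (fun r hr => ?_)
    (pathDeriv_intervalIntegrable hT hζ hs hst ht)
  have hr' : r ∈ Icc 0 T := ⟨hs.trans hr.1.le, hr.2.le.trans ht⟩
  exact ((hζ.differentiableOn one_ne_zero) r hr').hasDerivWithinAt.hasDerivAt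
    (Icc_mem_nhds (hs.trans_lt hr.1) (hr.2.trans_le ht))

theorem integral_clm_pathDeriv {W : Type*} [NormedAddCommGroup W] [NormedSpace ℝ W]
    [CompleteSpace W] (hT : 0 < T) (hζ : ContDiffOn ℝ 1 ζ (Icc 0 T)) (hs : 0 ≤ s) (hst : s ≤ t)
    (ht : t ≤ T) (P : E d →L[ℝ] W) : ∫ r in s..t, P (pathDeriv T ζ r) = P (inc ζ s t) := by
  rw [← integral_pathDeriv hT hζ hs hst ht]
  exact P.intervalIntegral_comp_comm (pathDeriv_intervalIntegrable hT hζ hs hst ht)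

theorem norm_inc_le_of_norm_pathDeriv_le {B : ℝ} (hζ : ContDiffOn ℝ 1 ζ (Icc 0 T))
    (hB : ∀ r ∈ Icc 0 T, ‖pathDeriv T ζ r‖ ≤ B) (hs : 0 ≤ s) (hst : s ≤ t) (ht : t ≤ T) :
    ‖inc ζ s t‖ ≤ B * (t - s) := by
  have h := (convex_Icc 0 T).norm_image_sub_le_of_norm_derivWithin_le
    (hζ.differentiableOn one_ne_zero) hB ⟨hs, hst.trans ht⟩ ⟨hs.trans hst, ht⟩
  rwa [Real.norm_of_nonneg (sub_nonneg.2 hst)] at h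

theorem canonicalArea_intervalIntegrable (hT : 0 < T) (hζ : ContDiffOn ℝ 1 ζ (Icc 0 T))
    (hs : 0 ≤ s) (hst : s ≤ t) (ht : t ≤ T) (r : ℝ) (i j : Fin d) :
    IntervalIntegrable (fun q => inc ζ r q i * pathDeriv T ζ q j) volume s t :=
  ((((EuclideanSpace.proj (𝕜 := ℝ) i).continuous.comp_continuousOn
    (hζ.continuousOn.sub continuousOn_const)).mul
    ((EuclideanSpace.proj (𝕜 := ℝ) j).continuous.comp_continuousOn
      (pathDeriv_continuousOn hT hζ))).mono (Icc_subset_Icc hs ht)).intervalIntegrable_of_Icc hst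

theorem canonicalArea_chen (hT : 0 < T) (hζ : ContDiffOn ℝ 1 ζ (Icc 0 T)) (hs : 0 ≤ s)
    (hsu : s ≤ u) (hut : u ≤ t) (ht : t ≤ T) (i j : Fin d) :
    delta (canonicalArea T ζ) s u t i j = inc ζ s u i * inc ζ u t j := by
  have hu := hs.trans hsu
  have hint := canonicalArea_intervalIntegrable hT hζ hu hut ht
  calc delta (canonicalArea T ζ) s u t i j
      = (∫ r in s..t, inc ζ s r i * pathDeriv T ζ r j)
          - (∫ r in s..u, inc ζ s r i * pathDeriv T ζ r j)
          - ∫ r in u..t, inc ζ u r i * pathDeriv T ζ r j := rfl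
    _ = (∫ r in u..t, inc ζ s r i * pathDeriv T ζ r j)
          - ∫ r in u..t, inc ζ u r i * pathDeriv T ζ r j := by
        rw [← intervalIntegral.integral_add_adjacent_intervals
          (canonicalArea_intervalIntegrable hT hζ hs hsu (hut.trans ht) s i j) (hint s i j),
          add_sub_cancel_left]
    _ = ∫ r in u..t, inc ζ s u i * pathDeriv T ζ r j := by
        rw [← intervalIntegral.integral_sub (hint s i j) (hint u i j)]
        refine intervalIntegral.integral_congr fun r _ => ?_
        change (ζ r i - ζ s i) * _ - (ζ r i - ζ u i) * _ = (ζ u i - ζ s i) * _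
        ring
    _ = inc ζ s u i * inc ζ u t j := by
        rw [intervalIntegral.integral_const_mul]
        exact congrArg _ (integral_clm_pathDeriv hT hζ hu hut ht (EuclideanSpace.proj (𝕜 := ℝ) j))

variable {X : Type*} [NormedAddCommGroup X] [NormedSpace ℝ X]

theorem contract_canonicalArea [CompleteSpace X] (hT : 0 < T) (hζ : ContDiffOn ℝ 1 ζ (Icc 0 T))
    (P : E d →L[ℝ] E d →L[ℝ] X) (hs : 0 ≤ s) (hst : s ≤ t) (ht : t ≤ T) :
    contract P (canonicalArea T ζ s t) = ∫ r in s..t, P (inc ζ s r) (pathDeriv T ζ r) := by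
  have hint (i j : Fin d) (c : X) :
      IntervalIntegrable (fun r => (inc ζ s r i * pathDeriv T ζ r j) • c) volume s t :=
    have h := canonicalArea_intervalIntegrable hT hζ hs hst ht s i j
    ⟨h.1.smul_const c, h.2.smul_const c⟩
  simp_rw [← contract_mul]
  simp only [contract, canonicalArea, ← intervalIntegral.integral_smul_const]
  rw [intervalIntegral.integral_finsetSum fun i _ => ?_]
  · refine Finset.sum_congr rfl fun i _ => ?_
    rw [intervalIntegral.integral_finsetSum fun j _ => hint i j _]
  · simpa only [Finset.sum_fn] using IntervalIntegrable.sum Finset.univ fun j _ => hint i j _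

variable {a C B : ℝ} {β : ℝ → X → X} {σ : ℝ → X → E d →L[ℝ] X} {x : ℝ → X}

theorem FieldRegular.norm_time_sub_le (hσ : FieldRegular T C σ) (hs : s ∈ Icc 0 T)
    (ht : t ∈ Icc 0 T) (y : X) : ‖σ t y - σ s y‖ ≤ C * |t - s| :=
  scale_pow_three s t ▸ hσ.field.time s hs t ht y

theorem FieldRegular.continuousOn_time (hσ : FieldRegular T C σ) (y : X) :
    ContinuousOn (fun t => σ t y) (Icc 0 T) :=
  (LipschitzOnWith.of_dist_le_mul (K := C.toNNReal) fun t ht s hs => by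
    rw [dist_eq_norm, Real.dist_eq]
    exact (hσ.norm_time_sub_le hs ht y).trans
      (by gcongr; exact Real.le_coe_toNNReal C)).continuousOn

theorem DriftField.add_field_apply (hβ : DriftField a T C β) (hσ : FieldRegular T C σ)
    (ha : 0 ≤ a) {ξ : ℝ → E d} (hξ : ContinuousOn ξ (Icc 0 T))
    (hB : ∀ t ∈ Icc 0 T, ‖ξ t‖ ≤ B) :
    DriftField a T (C + C * B) (fun t y => β t y + σ t y (ξ t)) where
  bound r hr y := by
    have hr' : r ∈ Icc 0 T := ⟨ha.trans hr.1, hr.2⟩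
    exact norm_add_le_of_le (hβ.bound r hr y)
      (ContinuousLinearMap.le_of_opNorm_le_of_le _ (hσ.field.bound r hr' y) (hB r hr'))
  lip r hr y z := by
    have hr' : r ∈ Icc 0 T := ⟨ha.trans hr.1, hr.2⟩
    rw [add_sub_add_comm, ← _root_.sub_apply, add_mul, mul_right_comm]
    exact norm_add_le_of_le (hβ.lip r hr y z)
      (ContinuousLinearMap.le_of_opNorm_le_of_le _ (hσ.field.lip r hr' y z) (hB r hr'))
  cont y := (hβ.cont y).add
    (((hσ.continuousOn_time y).clm_apply hξ).mono (Icc_subset_Icc_left ha))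

theorem DriftField.inc_eq_driftIncrement (hβ : DriftField a T C β) (hx : ContinuousOn x (Icc a T))
    {y : X} (h : ∀ t ∈ Icc a T, x t = y + driftIncrement β x a t) (hs : a ≤ s) (hst : s ≤ t)
    (ht : t ≤ T) : inc x s t = driftIncrement β x s t := by
  rw [inc, h t ⟨hs.trans hst, ht⟩, h s ⟨hs, hst.trans ht⟩,
    hβ.driftIncrement_add hx le_rfl hs hst ht]
  abel

theorem davieRemainder_canonicalArea_eq_integral [CompleteSpace X] (hT : 0 < T)
    (hζ : ContDiffOn ℝ 1 ζ (Icc 0 T)) (hs : 0 ≤ s) (hst : s ≤ t) (ht : t ≤ T)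
    (hβ : IntervalIntegrable (fun r => β r (x r)) volume s t)
    (hv : IntervalIntegrable (fun r => β r (x r) + σ r (x r) (pathDeriv T ζ r)) volume s t)
    (hx : inc x s t = driftIncrement (fun r y => β r y + σ r y (pathDeriv T ζ r)) x s t) :
    davieRemainder σ ζ (canonicalArea T ζ) (driftIncrement β x) x s t =
      ∫ r in s..t, (σ r (x r) - σ s (x s) - levyField σ s (x s) (inc ζ s r))
        (pathDeriv T ζ r) := by
  have hξ := (pathDeriv_continuousOn hT hζ).mono (Icc_subset_Icc hs ht)
  have hinc : ContinuousOn (inc ζ s) (Icc s t) :=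
    (hζ.continuousOn.mono (Icc_subset_Icc hs ht)).sub continuousOn_const
  have hfield : IntervalIntegrable (fun r => σ s (x s) (pathDeriv T ζ r)) volume s t :=
    ((σ s (x s)).continuous.comp_continuousOn hξ).intervalIntegrable_of_Icc hst
  have hlevy : IntervalIntegrable
      (fun r => levyField σ s (x s) (inc ζ s r) (pathDeriv T ζ r)) volume s t :=
    (((levyField σ s (x s)).continuous.comp_continuousOn hinc).clm_apply
      hξ).intervalIntegrable_of_Icc hst
  rw [davieRemainder, hx, germ, ← integral_clm_pathDeriv hT hζ hs hst ht,
    contract_canonicalArea hT hζ _ hs hst ht, driftIncrement, driftIncrement,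
    ← intervalIntegral.integral_sub hv hβ, ← intervalIntegral.integral_add hfield hlevy,
    ← intervalIntegral.integral_sub (hv.sub hβ) (hfield.add hlevy)]
  refine intervalIntegral.integral_congr fun r _ => ?_
  simp only [_root_.sub_apply, add_sub_cancel_left]
  abel

theorem FieldRegular.norm_sub_sub_levyField_le (hσ : FieldRegular T C σ) (hs : s ∈ Icc 0 T)
    (ht : t ∈ Icc 0 T) (y z : X) (e : E d) :
    ‖σ t z - σ s y - levyField σ s y e‖ ≤ C * |t - s| + C * ‖z - y‖ + C * ‖e‖ := by
  rw [← sub_add_sub_cancel (σ t z) (σ s z) (σ s y)]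
  exact norm_sub_le_of_le
    (norm_add_le_of_le (hσ.norm_time_sub_le hs ht z) (hσ.field.lip s hs z y))
    (ContinuousLinearMap.le_of_opNorm_le _ (hσ.levy.bound s hs y) e)

theorem davieSolution_of_integral_solution [CompleteSpace X] (hT : 0 < T)
    (hζ : ContDiffOn ℝ 1 ζ (Icc 0 T)) (hβ : DriftField a T C β) (hσ : FieldRegular T C σ)
    (ha : 0 ≤ a) {y : X} (hx : ContinuousOn x (Icc a T))
    (h : ∀ t ∈ Icc a T,
      x t = y + driftIncrement (fun r z => β r z + σ r z (pathDeriv T ζ r)) x a t) :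
    DavieSolution a T β σ ζ (canonicalArea T ζ) x := by
  have hξ := pathDeriv_continuousOn hT hζ
  obtain ⟨B, hB⟩ := isCompact_Icc.exists_bound_of_continuousOn hξ
  have hB0 : 0 ≤ B := (norm_nonneg _).trans (hB 0 (left_mem_Icc.2 hT.le))
  have hC := hσ.field.nonneg
  have hv := hβ.add_field_apply hσ ha hξ hB
  refine ⟨hx, 2, one_lt_two, (C + C * (C + C * B) + C * B) * B, fun s t hs hst ht => ?_⟩
  have hs0 := ha.trans hs
  rw [davieRemainder_canonicalArea_eq_integral hT hζ hs0 hst ht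
    (hβ.intervalIntegrable hx hs hst ht) (hv.intervalIntegrable hx hs hst ht)
    (hv.inc_eq_driftIncrement hx h hs hst ht), Real.rpow_two, sq, ← mul_assoc]
  refine (intervalIntegral.norm_integral_le_of_norm_le_const fun r hr => ?_).trans_eq
    (by rw [abs_of_nonneg (sub_nonneg.2 hst)])
  rw [uIoc_of_le hst] at hr
  have hrT := hr.2.trans ht
  have hr0 : r ∈ Icc 0 T := ⟨hs0.trans hr.1.le, hrT⟩
  have hsr : r - s ≤ t - s := by linarith [hr.2]
  have hxr : ‖x r - x s‖ ≤ (C + C * B) * (r - s) :=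
    (congrArg norm (hv.inc_eq_driftIncrement hx h hs hr.1.le hrT)).trans_le
      (hv.norm_driftIncrement_le x hs hr.1.le hrT)
  have hζr := norm_inc_le_of_norm_pathDeriv_le hζ hB hs0 hr.1.le hrT
  refine (ContinuousLinearMap.le_of_opNorm_le_of_le _
    (hσ.norm_sub_sub_levyField_le ⟨hs0, hst.trans ht⟩ hr0 _ _ _) (hB r hr0)).trans ?_
  rw [abs_of_nonneg (sub_nonneg.2 hr.1.le), mul_right_comm]
  gcongr ?_ * B
  calc C * (r - s) + C * ‖x r - x s‖ + C * ‖inc ζ s r‖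
      ≤ C * (r - s) + C * ((C + C * B) * (r - s)) + C * (B * (r - s)) := by gcongr
    _ = (C + C * (C + C * B) + C * B) * (r - s) := by ring
    _ ≤ (C + C * (C + C * B) + C * B) * (t - s) := by gcongr

end Smooth

section Orders

variable {V W : Type*} [NormedAddCommGroup V] [NormedAddCommGroup W] {a b p q : ℝ}

/-- `g s t = O((t - s) ^ p)` uniformly on the simplex `a ≤ s ≤ t ≤ b`. -/
def HasOrder (a b p : ℝ) (g : ℝ → ℝ → W) : Prop :=
  ∃ M : ℝ, HolderBound a b p M g

namespace HasOrder

variable {g : ℝ → ℝ → W} {h : ℝ → ℝ → V}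

theorem holderNorm_lt_top (hg : HasOrder a b p g) : holderNorm a b p g < ∞ :=
  hg.elim fun _ hM => hM.holderNorm_lt_top

theorem mono_exponent (hg : HasOrder a b p g) (hq : 0 ≤ q) (hqp : q ≤ p) : HasOrder a b q g := by
  obtain ⟨M, hM⟩ := hg
  refine ⟨|M| * (b - a) ^ (p - q), fun s t hs hst ht => ?_⟩
  have hts : 0 ≤ t - s := sub_nonneg.2 hst
  have hsplit : (t - s) ^ p = (t - s) ^ (p - q) * (t - s) ^ q := by
    rw [← Real.rpow_add_of_nonneg hts (sub_nonneg.2 hqp) hq, sub_add_cancel]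
  calc ‖g s t‖ ≤ |M| * (t - s) ^ p :=
        (hM hs hst ht).trans (by gcongr; exact le_abs_self M)
    _ = |M| * (t - s) ^ (p - q) * (t - s) ^ q := by rw [hsplit, mul_assoc]
    _ ≤ |M| * (b - a) ^ (p - q) * (t - s) ^ q := by gcongr

theorem of_norm_le {c : ℝ} (hg : HasOrder a b p g) (hc : 0 ≤ c)
    (hh : ∀ s t, a ≤ s → s ≤ t → t ≤ b → ‖h s t‖ ≤ c * ‖g s t‖) : HasOrder a b p h := by
  obtain ⟨M, hM⟩ := hg
  refine ⟨c * M, fun s t hs hst ht => (hh s t hs hst ht).trans ?_⟩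
  rw [mul_assoc]
  exact mul_le_mul_of_nonneg_left (hM hs hst ht) hc

theorem add {g' : ℝ → ℝ → W} (hg : HasOrder a b p g) (hg' : HasOrder a b p g') :
    HasOrder a b p (fun s t => g s t + g' s t) := by
  obtain ⟨M, hM⟩ := hg
  obtain ⟨M', hM'⟩ := hg'
  refine ⟨M + M', fun s t hs hst ht => ?_⟩
  rw [add_mul]
  exact norm_add_le_of_le (hM hs hst ht) (hM' hs hst ht)

theorem sub {g' : ℝ → ℝ → W} (hg : HasOrder a b p g) (hg' : HasOrder a b p g') :
    HasOrder a b p (fun s t => g s t - g' s t) := by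
  simp only [sub_eq_add_neg]
  exact hg.add (hg'.of_norm_le zero_le_one fun _ _ _ _ _ => by rw [norm_neg, one_mul])

theorem norm_sq (hg : HasOrder a b p g) : HasOrder a b (2 * p) (fun s t => ‖g s t‖ ^ 2) := by
  obtain ⟨M, hM⟩ := hg
  refine ⟨M ^ 2, fun s t hs hst ht => ?_⟩
  rw [norm_pow, norm_norm, rpow_two_mul_eq (sub_nonneg.2 hst), ← mul_pow]
  exact pow_le_pow_left₀ (norm_nonneg _) (hM hs hst ht) 2

theorem const_mul_norm (hg : HasOrder a b p g) (c : ℝ) :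
    HasOrder a b p (fun s t => c * ‖g s t‖) :=
  hg.of_norm_le (abs_nonneg c) fun _ _ _ _ _ => by rw [norm_mul, norm_norm, Real.norm_eq_abs]

theorem of_local {M δ : ℝ} (hg : HasOrder a b 0 g) (hp : 0 ≤ p) (hδ : 0 < δ)
    (hloc : ∀ s t, a ≤ s → s ≤ t → t ≤ b → t - s ≤ δ → ‖g s t‖ ≤ M * (t - s) ^ p) :
    HasOrder a b p g := by
  obtain ⟨D, hD⟩ := hg
  refine ⟨max M (|D| / δ ^ p), fun s t hs hst ht => ?_⟩
  have hts : 0 ≤ t - s := sub_nonneg.2 hst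
  rcases le_total (t - s) δ with hδts | hδts
  · exact (hloc s t hs hst ht hδts).trans (by gcongr; exact le_max_left _ _)
  · calc ‖g s t‖ ≤ |D| := by
          simpa only [Real.rpow_zero, mul_one] using (hD hs hst ht).trans
            (mul_le_mul_of_nonneg_right (le_abs_self D) (Real.rpow_nonneg hts 0))
      _ = |D| / δ ^ p * δ ^ p := by field_simp
      _ ≤ |D| / δ ^ p * (t - s) ^ p := by gcongr
      _ ≤ _ := by gcongr; exact le_max_right _ _

theorem continuousOn {x : ℝ → W} (hx : HasOrder a b p (inc x)) (hp : 0 < p) :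
    ContinuousOn x (Icc a b) := by
  obtain ⟨M, hM⟩ := hx
  have hinc : ∀ s ∈ Icc a b, ∀ t ∈ Icc a b, ‖x t - x s‖ ≤ M * |t - s| ^ p := by
    intro s hs t ht
    rcases le_total s t with hst | hst
    · simpa only [abs_of_nonneg (sub_nonneg.2 hst), inc] using hM hs.1 hst ht.2
    · simpa only [abs_sub_comm t s, abs_of_nonneg (sub_nonneg.2 hst), norm_sub_rev (x t), inc]
        using hM ht.1 hst hs.2
  intro s hs
  rw [ContinuousWithinAt, tendsto_iff_norm_sub_tendsto_zero]
  refine squeeze_zero' (Eventually.of_forall fun _ => norm_nonneg _)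
    (eventually_nhdsWithin_of_forall fun t ht => hinc s hs t ht) ?_
  have hcont : Continuous fun t : ℝ => M * |t - s| ^ p :=
    continuous_const.mul ((continuous_id.sub continuous_const).abs.rpow_const
      fun _ => Or.inr hp.le)
  simpa only [sub_self, abs_zero, Real.zero_rpow hp.ne', mul_zero] using
    (hcont.tendsto s).mono_left nhdsWithin_le_nhds

end HasOrder

theorem hasOrder_scale_pow (n : ℕ) (c : ℝ) :
    HasOrder a b (n / 3) (fun s t => c * scale s t ^ n) := by
  refine ⟨|c|, fun s t _ hst _ => ?_⟩
  have hts : 0 ≤ t - s := sub_nonneg.2 hst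
  have hpow : scale s t ^ n = (t - s) ^ (n / 3 : ℝ) := by
    rw [scale_eq hst, ← Real.rpow_mul_natCast hts, one_div_mul_eq_div]
  simp only [hpow, norm_mul, Real.norm_eq_abs, abs_of_nonneg (Real.rpow_nonneg hts _), le_refl]

theorem hasOrder_of_holderNorm_lt_top {g : ℝ → ℝ → W} (h : holderNorm a b p g < ∞)
    (hdiag : ∀ s, a ≤ s → s ≤ b → g s s = 0) : HasOrder a b p g :=
  ⟨_, holderBound_of_holderNorm_ne_top h.ne hdiag⟩

theorem IsSewing.hasOrder {f : ℝ → ℝ → ℝ → W} {g : ℝ → ℝ → W}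
    (h : IsSewing a b p f g) (hf : ∀ s, f s s s = 0) : HasOrder a b p g :=
  hasOrder_of_holderNorm_lt_top h.2 fun s hs hs' => by
    have hdelta := h.1 s s s hs le_rfl le_rfl hs'
    rwa [delta, sub_self, zero_sub, hf, neg_eq_zero] at hdelta

theorem SpaceTimeRegular.hasOrder_inc_comp {T C : ℝ} {k : ℕ}
    {f : ℝ → V → W} {x : ℝ → V} (hf : SpaceTimeRegular T k C f) (ha : 0 ≤ a) (hb : b ≤ T)
    (hp : 0 ≤ p) (hpk : p ≤ ((k + 1 : ℕ) : ℝ) / 3) (hx : HasOrder a b p (inc x)) :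
    HasOrder a b p (inc fun r => f r (x r)) := by
  have htime := (hasOrder_scale_pow (a := a) (b := b) (k + 1) C).mono_exponent hp hpk
  refine (htime.add (hx.const_mul_norm C)).of_norm_le zero_le_one fun s t hs hst ht => ?_
  have hle := hf.norm_sub_le (s := s) (u := t) ⟨ha.trans hs, (hst.trans ht).trans hb⟩
    ⟨ha.trans (hs.trans hst), ht.trans hb⟩ (x s) (inc x s t)
  rw [inc, add_sub_cancel] at hle
  rw [one_mul]
  exact hle.trans (Real.le_norm_self _)

end Orders

section Equivalence

variable {d : ℕ} {X : Type*} [NormedAddCommGroup X] [NormedSpace ℝ X]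
  {T α C a κ : ℝ} {β : ℝ → X → X} {σ : ℝ → X → E d →L[ℝ] X} {ζ : ℝ → E d}
  {A : ℝ → ℝ → Fin d → Fin d → ℝ} {x : ℝ → X}

section Terms

variable (hσ : FieldRegular T C σ) (ha : 0 ≤ a) (hζ : DriverBound a T α C ζ A)

theorem DriftField.hasOrder_driftIncrement (hβ : DriftField a T C β) (x : ℝ → X) :
    HasOrder a T 1 (driftIncrement β x) :=
  ⟨C, fun s t hs hst ht => by
    simpa only [Real.rpow_one] using hβ.norm_driftIncrement_le x hs hst ht⟩

include hσ ha hζ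

theorem FieldRegular.hasOrder_field_term (x : ℝ → X) :
    HasOrder a T α fun s t => σ s (x s) (inc ζ s t) := by
  refine ⟨C * C, fun s t hs hst ht => ?_⟩
  calc _ ≤ C * ‖inc ζ s t‖ := ContinuousLinearMap.le_of_opNorm_le _
        (hσ.field.bound s ⟨ha.trans hs, hst.trans ht⟩ _) _
    _ ≤ C * (C * (t - s) ^ α) :=
      mul_le_mul_of_nonneg_left (hζ.path s t hs hst ht) hσ.field.nonneg
    _ = _ := by ring

theorem FieldRegular.hasOrder_area_term (x : ℝ → X) :
    HasOrder a T (2 * α) fun s t => contract (levyField σ s (x s)) (A s t) := by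
  refine ⟨C * C, fun s t hs hst ht => ?_⟩
  calc _ ≤ ‖levyField σ s (x s)‖ * entrySum (A s t) := norm_contract_le _ _
    _ ≤ C * (C * (t - s) ^ (2 * α)) := by
      have := hσ.levy.nonneg
      gcongr
      exacts [entrySum_nonneg _, hσ.levy.bound s ⟨ha.trans hs, hst.trans ht⟩ _,
        hζ.area s t hs hst ht]
    _ = _ := by ring

end Terms

namespace DrivenSolution

section

variable (hσ : FieldRegular T C σ) (hx : DrivenSolution a T α C β σ ζ A x)
include hσ hx

theorem hasOrder_remainder (hκ : 0 ≤ κ) (hκα : κ ≤ α) (hκ' : 2 * κ ≤ 1)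
    (hR : HasOrder a T (2 * κ) (davieRemainder σ ζ A (driftIncrement β x) x)) :
    HasOrder a T (2 * κ) (remainder ζ x fun r => σ r (x r)) := by
  have hdrift := (hx.drift.hasOrder_driftIncrement x).mono_exponent (by positivity) hκ'
  have harea := (hσ.hasOrder_area_term hx.nonneg hx.driver x).mono_exponent (q := 2 * κ)
    (by positivity) (by linarith)
  refine ((hdrift.add harea).add hR).of_norm_le zero_le_one fun s t _ _ _ => ?_
  rw [one_mul, remainder_eq]

theorem hasOrder_inc (hκ : 0 ≤ κ) (hκα : κ ≤ α)
    (hrem : HasOrder a T (2 * κ) (remainder ζ x fun r => σ r (x r))) :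
    HasOrder a T κ (inc x) := by
  have hfield := (hσ.hasOrder_field_term hx.nonneg hx.driver x).mono_exponent hκ hκα
  refine ((hrem.mono_exponent hκ (by linarith)).add hfield).of_norm_le zero_le_one
    fun s t _ _ _ => ?_
  rw [one_mul, remainder, sub_add_cancel]

theorem hasOrder_remainder_field (hκ : 0 ≤ κ) (hκ' : 2 * κ ≤ 1)
    (hrem : HasOrder a T (2 * κ) (remainder ζ x fun r => σ r (x r)))
    (hinc : HasOrder a T κ (inc x)) :
    HasOrder a T (2 * κ) (remainder ζ (fun r => σ r (x r)) fun r => levyField σ r (x r)) := by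
  have htime := (hasOrder_scale_pow (a := a) (b := T) 3 C).mono_exponent (q := 2 * κ)
    (by positivity) (by norm_num; exact hκ')
  refine ((htime.add (hinc.norm_sq.const_mul_norm C)).add (hrem.const_mul_norm C)).of_norm_le
    zero_le_one fun s t hs hst ht => ?_
  have hdefect := hσ.norm_fieldDefect_le (s := s) (u := t) ⟨hx.nonneg.trans hs, hst.trans ht⟩
    ⟨hx.nonneg.trans (hs.trans hst), ht⟩ (x s) (inc x s t) (inc x s t) (σ s (x s) (inc ζ s t))
  rw [sub_self, norm_zero, mul_zero, add_zero] at hdefect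
  rw [remainder_field_eq_fieldDefect, one_mul, norm_pow, norm_norm]
  exact hdefect.trans (Real.le_norm_self _)

theorem isControlled_isRoughIntegral (hκ : 0 ≤ κ) (hκα : κ ≤ α) (hκ' : 2 * κ ≤ 1)
    (hR : HasOrder a T (3 * κ) (davieRemainder σ ζ A (driftIncrement β x) x)) :
    IsControlled a T κ ζ x (fun r => σ r (x r)) ∧
      IsRoughIntegral a T κ ζ A (fun r => σ r (x r)) (fun r => levyField σ r (x r))
        (fun r t => inc x r t - driftIncrement β x r t) := by
  have hrem := hx.hasOrder_remainder hσ hκ hκα hκ' (hR.mono_exponent (by positivity) (by linarith))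
  have hinc := hx.hasOrder_inc hσ hκ hκα hrem
  have hfield := hσ.field.hasOrder_inc_comp hx.nonneg le_rfl hκ (by norm_num; linarith) hinc
  have hlevy := hσ.levy.hasOrder_inc_comp hx.nonneg le_rfl hκ (by norm_num; linarith) hinc
  have hrem' := hx.hasOrder_remainder_field hσ hκ hκ' hrem hinc
  refine ⟨⟨hinc.holderNorm_lt_top, hfield.holderNorm_lt_top, hrem.holderNorm_lt_top⟩,
    ⟨hfield.holderNorm_lt_top, hlevy.holderNorm_lt_top, hrem'.holderNorm_lt_top⟩,
    davieRemainder σ ζ A (driftIncrement β x) x, ⟨fun s u t hs hsu hut ht => ?_,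
    hR.holderNorm_lt_top⟩, fun s t _ _ _ => ?_⟩
  · exact delta_davieRemainder (hx.driver.chen s u t hs hsu hut ht)
      (hx.drift.driftIncrement_add hx.solution.cont hs hsu hut ht)
  · simp only [davieRemainder, germ, add_sub_cancel]

end

theorem exists_isControlled_isRoughIntegral (H : RoughData T α C σ)
    (hx : DrivenSolution a T α C β σ ζ A x) :
    ∃ κ, 1 / 3 < κ ∧ κ < α ∧ IsControlled a T κ ζ x (fun r => σ r (x r)) ∧
      IsRoughIntegral a T κ ζ A (fun r => σ r (x r)) (fun r => levyField σ r (x r))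
        (fun r t => inc x r t - driftIncrement β x r t) := by
  have hα := H.lt_exponent
  obtain ⟨θ, hθ, hR⟩ := hx.solution.rem
  obtain ⟨κ, hκ, hκ'⟩ : ∃ κ, 1 / 3 < κ ∧ κ < min α (min (1 / 2) (θ / 3)) :=
    exists_between (lt_min hα (lt_min (by norm_num) (by linarith)))
  obtain ⟨hκα, hκ_half, hκθ⟩ : κ < α ∧ κ < 1 / 2 ∧ κ < θ / 3 := by simpa only [lt_min_iff] using hκ'
  have hR' : HasOrder a T (3 * κ) (davieRemainder σ ζ A (driftIncrement β x) x) :=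
    HasOrder.mono_exponent hR (by linarith) (by linarith)
  exact ⟨κ, hκ, hκα, hx.isControlled_isRoughIntegral H.field (by linarith) hκα.le
    (by linarith) hR'⟩

end DrivenSolution

theorem davieSolution_of_isRoughIntegral (hκ : 1 / 3 < κ)
    (hx : IsControlled a T κ ζ x (fun r => σ r (x r)))
    (hI : IsRoughIntegral a T κ ζ A (fun r => σ r (x r)) (fun r => levyField σ r (x r))
      (fun r t => inc x r t - driftIncrement β x r t)) :
    DavieSolution a T β σ ζ A x := by
  obtain ⟨-, g, hg, hI⟩ := hI
  have hinc : HasOrder a T κ (inc x) :=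
    hasOrder_of_holderNorm_lt_top hx.holder_path fun s _ _ => sub_self _
  obtain ⟨M, hM⟩ : HasOrder a T (3 * κ) g := hg.hasOrder fun s => by
    simp [inc, remainder, contract]
  refine ⟨hinc.continuousOn (by linarith), 3 * κ, by linarith, M, fun s t hs hst ht => ?_⟩
  have hrem : davieRemainder σ ζ A (driftIncrement β x) x s t = g s t := by
    rw [davieRemainder, sub_eq_iff_eq_add', germ]
    exact hI s t hs hst ht
  exact hrem ▸ hM hs hst ht

end Equivalence

section Limits

variable {d : ℕ} {X : Type*} [NormedAddCommGroup X]

theorem exists_forall_norm_sub_le_of_cauchy {ι Y : Type*} [NormedAddCommGroup Y] [CompleteSpace Y]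
    {S : Set ι} {f : ℕ → ι → Y} {r : ℕ → ℝ} (hr : Tendsto r atTop (𝓝 0))
    (hf : ∀ n k, ∀ t ∈ S, ‖f n t - f k t‖ ≤ r n + r k) :
    ∃ g : ι → Y, ∀ n, ∀ t ∈ S, ‖f n t - g t‖ ≤ r n := by
  have hlim : ∀ t ∈ S, ∃ z, Tendsto (fun n => f n t) atTop (𝓝 z) := by
    refine fun t ht => cauchySeq_tendsto_of_complete (Metric.cauchySeq_iff'.2 fun ε hε => ?_)
    obtain ⟨n₀, hn₀⟩ := eventually_atTop.1 (hr.eventually (gt_mem_nhds (half_pos hε)))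
    refine ⟨n₀, fun n hn => ?_⟩
    rw [dist_eq_norm]
    linarith [hf n n₀ t ht, hn₀ n hn, hn₀ n₀ le_rfl]
  choose! g hg using hlim
  refine ⟨g, fun n t ht => le_of_tendsto_of_tendsto' (tendsto_const_nhds.sub (hg t ht)).norm ?_
    fun k => hf n k t ht⟩
  simpa only [add_zero] using tendsto_const_nhds.add hr

theorem entrySum_sub_le (A A' B : Fin d → Fin d → ℝ) :
    entrySum (A - A') ≤ entrySum (A - B) + entrySum (A' - B) := by
  simp only [entrySum, ← Finset.sum_add_distrib]
  refine Finset.sum_le_sum fun i _ => Finset.sum_le_sum fun j _ => ?_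
  simpa only [Pi.sub_apply, abs_sub_comm (A' i j)] using abs_sub_le (A i j) (B i j) (A' i j)

theorem abs_le_entrySum (A : Fin d → Fin d → ℝ) (i j : Fin d) : |A i j| ≤ entrySum A :=
  (Finset.single_le_sum (f := fun j => |A i j|) (fun _ _ => abs_nonneg _)
    (Finset.mem_univ j)).trans
  (Finset.single_le_sum (f := fun i => ∑ j, |A i j|)
    (fun _ _ => Finset.sum_nonneg fun _ _ => abs_nonneg _) (Finset.mem_univ i))

theorem tendsto_contract {ι W : Type*} [NormedAddCommGroup W] [NormedSpace ℝ W] {l : Filter ι}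
    {Bn : ι → E d →L[ℝ] E d →L[ℝ] W} {B : E d →L[ℝ] E d →L[ℝ] W} {An : ι → Fin d → Fin d → ℝ}
    {A : Fin d → Fin d → ℝ} (hB : Tendsto Bn l (𝓝 B)) (hA : Tendsto An l (𝓝 A)) :
    Tendsto (fun n => contract (Bn n) (An n)) l (𝓝 (contract B A)) := by
  have happly (v w : E d) : Tendsto (fun n => Bn n v w) l (𝓝 (B v w)) :=
    ((by fun_prop : Continuous fun B : E d →L[ℝ] E d →L[ℝ] W => B v w).tendsto B).comp hB
  exact tendsto_finsetSum _ fun i _ => tendsto_finsetSum _ fun j _ =>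
    (tendsto_pi_nhds.1 (tendsto_pi_nhds.1 hA i) j).smul (happly _ _)

variable [NormedSpace ℝ X] {T α C a : ℝ} {β : ℝ → X → X} {σ : ℝ → X → E d →L[ℝ] X} {ζ : ℝ → E d}
  {A : ℝ → ℝ → Fin d → Fin d → ℝ} {ζn : ℕ → ℝ → E d} {An : ℕ → ℝ → ℝ → Fin d → Fin d → ℝ}
  {xn : ℕ → ℝ → X} {ϱ : ℕ → ℝ} {x : ℝ → X}

/-- Solutions driven by rough paths `(ζn, An)` that converge to `(ζ, A)` at rate `ϱ`. -/
structure SolutionApprox (a T α C : ℝ) (β : ℝ → X → X) (σ : ℝ → X → E d →L[ℝ] X) (ζ : ℝ → E d)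
    (A : ℝ → ℝ → Fin d → Fin d → ℝ) (ζn : ℕ → ℝ → E d) (An : ℕ → ℝ → ℝ → Fin d → Fin d → ℝ)
    (xn : ℕ → ℝ → X) (ϱ : ℕ → ℝ) : Prop where
  solution : ∀ n, DrivenSolution a T α C β σ (ζn n) (An n) (xn n)
  error_nonneg : ∀ n, 0 ≤ ϱ n
  error_tendsto : Tendsto ϱ atTop (𝓝 0)
  path : ∀ n s t, a ≤ s → s ≤ t → t ≤ T → ‖inc (ζn n) s t - inc ζ s t‖ ≤ ϱ n * (t - s) ^ α
  area : ∀ n s t, a ≤ s → s ≤ t → t ≤ T →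
    entrySum (An n s t - A s t) ≤ ϱ n * (t - s) ^ (2 * α)

namespace SolutionApprox

variable (h : SolutionApprox a T α C β σ ζ A ζn An xn ϱ)
include h

theorem tendsto_inc {s t : ℝ} (hs : a ≤ s) (hst : s ≤ t) (ht : t ≤ T) :
    Tendsto (fun n => inc (ζn n) s t) atTop (𝓝 (inc ζ s t)) := by
  rw [tendsto_iff_norm_sub_tendsto_zero]
  refine squeeze_zero (fun _ => norm_nonneg _) (fun n => h.path n s t hs hst ht) ?_
  simpa only [zero_mul] using h.error_tendsto.mul_const _

theorem tendsto_area {s t : ℝ} (hs : a ≤ s) (hst : s ≤ t) (ht : t ≤ T) :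
    Tendsto (fun n => An n s t) atTop (𝓝 (A s t)) := by
  refine tendsto_pi_nhds.2 fun i => tendsto_pi_nhds.2 fun j => ?_
  rw [tendsto_iff_norm_sub_tendsto_zero]
  refine squeeze_zero (fun _ => norm_nonneg _) (fun n =>
    (abs_le_entrySum (An n s t - A s t) i j).trans (h.area n s t hs hst ht)) ?_
  simpa only [zero_mul] using h.error_tendsto.mul_const _

theorem exists_limit [CompleteSpace X] (H : RoughData T α C σ)
    (hinit : ∀ n k, xn n a = xn k a) :
    ∃ K ≥ (0 : ℝ), ∃ x : ℝ → X, ∀ n, ∀ t ∈ Icc a T, ‖xn n t - x t‖ ≤ K * ϱ n := by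
  obtain ⟨K, hK, hstab⟩ := H.exists_norm_sub_le
  refine ⟨K, hK, exists_forall_norm_sub_le_of_cauchy
    (by simpa only [mul_zero] using h.error_tendsto.const_mul K) fun n k t ht => ?_⟩
  rw [← mul_add]
  have hle := hstab a β _ _ _ _ _ _ (ϱ n + ϱ k) (h.solution n) (h.solution k)
    (add_nonneg (h.error_nonneg n) (h.error_nonneg k)) (fun s t hs hst ht => ?_)
    (fun s t hs hst ht => ?_) t ht
  · rwa [hinit n k, sub_self, norm_zero, zero_add] at hle
  · rw [← sub_sub_sub_cancel_right _ _ (inc ζ s t), add_mul]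
    exact norm_sub_le_of_le (h.path n s t hs hst ht) (h.path k s t hs hst ht)
  · rw [add_mul]
    exact (entrySum_sub_le _ _ (A s t)).trans
      (add_le_add (h.area n s t hs hst ht) (h.area k s t hs hst ht))

theorem driverBound (hchen : ∀ s u t, a ≤ s → s ≤ u → u ≤ t → t ≤ T → ∀ i j,
      delta A s u t i j = inc ζ s u i * inc ζ u t j) : DriverBound a T α C ζ A where
  path s t hs hst ht := le_of_tendsto' (h.tendsto_inc hs hst ht).norm fun n =>
    (h.solution n).driver.path s t hs hst ht
  area s t hs hst ht := by
    have hlim : Tendsto (fun n => entrySum (An n s t)) atTop (𝓝 (entrySum (A s t))) :=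
      tendsto_finsetSum _ fun i _ => tendsto_finsetSum _ fun j _ =>
        (tendsto_pi_nhds.1 (tendsto_pi_nhds.1 (h.tendsto_area hs hst ht) i) j).abs
    exact le_of_tendsto' hlim fun n => (h.solution n).driver.area s t hs hst ht
  chen := hchen

variable {r : ℕ → ℝ} (hr : Tendsto r atTop (𝓝 0))
  (hx : ∀ n, ∀ t ∈ Icc a T, ‖xn n t - x t‖ ≤ r n)
include hr hx

theorem continuousOn_limit : ContinuousOn x (Icc a T) := by
  refine TendstoUniformlyOn.continuousOn (F := xn) (p := atTop) ?_
    (Frequently.of_forall fun n => (h.solution n).solution.cont)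
  refine Metric.tendstoUniformlyOn_iff.2 fun ε hε => ?_
  filter_upwards [hr.eventually (gt_mem_nhds hε)] with n hn t ht
  rw [dist_comm, dist_eq_norm]
  exact (hx n t ht).trans_lt hn

theorem tendsto_davieRemainder (hσ : FieldRegular T C σ) {s t : ℝ} (hs : a ≤ s) (hst : s ≤ t)
    (ht : t ≤ T) :
    Tendsto (fun n => davieRemainder σ (ζn n) (An n) (driftIncrement β (xn n)) (xn n) s t) atTop
      (𝓝 (davieRemainder σ ζ A (driftIncrement β x) x s t)) := by
  have hlim : ∀ u ∈ Icc a T, Tendsto (fun n => xn n u) atTop (𝓝 (x u)) := fun u hu => by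
    rw [tendsto_iff_norm_sub_tendsto_zero]
    exact squeeze_zero (fun _ => norm_nonneg _) (fun n => hx n u hu) hr
  have hxs := hlim s ⟨hs, hst.trans ht⟩
  have ms : s ∈ Icc 0 T := ⟨(h.solution 0).nonneg.trans hs, hst.trans ht⟩
  have hlevy : LipschitzWith C.toNNReal (levyField σ s) := LipschitzWith.of_dist_le' fun y z => by
    simpa only [dist_eq_norm] using hσ.levy.lip s ms y z
  have hdrift : Tendsto (fun n => driftIncrement β (xn n) s t) atTop
      (𝓝 (driftIncrement β x s t)) := by
    have hle (n : ℕ) : ‖driftIncrement β (xn n) s t - driftIncrement β x s t‖ ≤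
        C * r n * (t - s) :=
      (h.solution n).drift.norm_driftIncrement_sub_le (h.solution n).solution.cont
        (h.continuousOn_limit hr hx) hσ.field.nonneg hs hst ht
        fun u hu => hx n u ⟨hs.trans hu.1, hu.2.trans ht⟩
    rw [tendsto_iff_norm_sub_tendsto_zero]
    refine squeeze_zero (fun _ => norm_nonneg _) hle ?_
    simpa only [mul_zero, zero_mul] using (hr.const_mul C).mul_const (t - s)
  have hfield : Tendsto (fun n => σ s (xn n s) (inc (ζn n) s t)) atTop
      (𝓝 (σ s (x s) (inc ζ s t))) := by
    have hσn := ((hσ.differentiable s ms).continuous.tendsto (x s)).comp hxs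
    exact (isBoundedBilinearMap_apply.continuous.tendsto (σ s (x s), inc ζ s t)).comp
      (hσn.prodMk_nhds (h.tendsto_inc hs hst ht))
  have hlevyn : Tendsto (fun n => levyField σ s (xn n s)) atTop (𝓝 (levyField σ s (x s))) :=
    (hlevy.continuous.tendsto (x s)).comp hxs
  exact (((hlim t ⟨hs.trans hst, ht⟩).sub hxs).sub hdrift).sub
    (hfield.add (tendsto_contract hlevyn (h.tendsto_area hs hst ht)))

theorem davieSolution_limit (H : RoughData T α C σ) (hζ : DriverBound a T α C ζ A) :
    DavieSolution a T β σ ζ A x := by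
  have hα := H.lt_exponent
  have ha := (h.solution 0).nonneg
  have hcont := h.continuousOn_limit hr hx
  obtain ⟨δ, hδ, hshort⟩ := exists_forall_isShort H.lt_exponent
  obtain ⟨B, hB⟩ := isCompact_Icc.exists_bound_of_continuousOn hcont
  have hinc : HasOrder a T 0 (inc x) := ⟨B + B, fun s t hs hst ht => by
    rw [Real.rpow_zero, mul_one]
    exact norm_sub_le_of_le (hB t ⟨hs.trans hst, ht⟩) (hB s ⟨hs, hst.trans ht⟩)⟩
  have hbounded : HasOrder a T 0 (davieRemainder σ ζ A (driftIncrement β x) x) :=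
    (hinc.sub (((h.solution 0).drift.hasOrder_driftIncrement x).mono_exponent le_rfl
      zero_le_one)).sub (((H.field.hasOrder_field_term ha hζ x).mono_exponent le_rfl
      (by linarith)).add ((H.field.hasOrder_area_term ha hζ x).mono_exponent le_rfl (by linarith)))
  refine ⟨hcont, 2 / 3 + α, by linarith, hbounded.of_local (M := aprioriConst α C)
    (by linarith) hδ fun s t hs hst ht hts => ?_⟩
  exact le_of_tendsto' (h.tendsto_davieRemainder hr hx H.field hs hst ht).norm fun n =>
    (h.solution n).holderBound_davieRemainder H hs ht (hshort s t hst hts) le_rfl hst le_rfl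

end SolutionApprox

theorem SolutionApprox.exists_drivenSolution [CompleteSpace X]
    (h : SolutionApprox a T α C β σ ζ A ζn An xn ϱ) (H : RoughData T α C σ) (haT : a ≤ T)
    (hchen : ∀ s u t, a ≤ s → s ≤ u → u ≤ t → t ≤ T → ∀ i j,
      delta A s u t i j = inc ζ s u i * inc ζ u t j) {y : X} (hy : ∀ n, xn n a = y) :
    ∃ x, DrivenSolution a T α C β σ ζ A x ∧ x a = y := by
  obtain ⟨K, -, x, hx⟩ := h.exists_limit H fun n k => (hy n).trans (hy k).symm
  have hr : Tendsto (fun n => K * ϱ n) atTop (𝓝 0) := by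
    simpa only [mul_zero] using h.error_tendsto.const_mul K
  have hζ := h.driverBound hchen
  refine ⟨x, ⟨(h.solution 0).nonneg, (h.solution 0).drift, hζ, h.davieSolution_limit hr hx H hζ⟩,
    ?_⟩
  have hle : ‖y - x a‖ ≤ 0 := ge_of_tendsto' hr fun n => hy n ▸ hx n a ⟨le_rfl, haT⟩
  exact (sub_eq_zero.1 (norm_le_zero_iff.1 hle)).symm

end Limits

section Wasserstein

theorem norm_integral_sub_integral_le_of_norm_sub_le {Ω W : Type*} [MeasurableSpace Ω]
    [NormedAddCommGroup W] [NormedSpace ℝ W] {μ : Measure Ω} [IsProbabilityMeasure μ] {f g : Ω → W}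
    {C : ℝ} (hf : Integrable f μ) (hg : Integrable g μ) (h : ∀ a, ‖f a - g a‖ ≤ C) :
    ‖∫ a, f a ∂μ - ∫ a, g a ∂μ‖ ≤ C := by
  rw [← integral_sub hf hg]
  simpa only [probReal_univ, mul_one] using
    norm_integral_le_of_norm_le_const (μ := μ) (Eventually.of_forall h)

variable {U : Type*} [MetricSpace U] [MeasurableSpace U]

instance (ν : P2 U) : IsProbabilityMeasure ν.1 := ν.2.1

/-- A measure with finite second moment, as an element of Mathlib's space of probability
measures, whose topology is that of weak convergence. -/
def P2.toProbabilityMeasure (ν : P2 U) : ProbabilityMeasure U := ⟨ν.1, ν.2.1⟩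

theorem W2_self (ν : P2 U) : W2 ν ν = 0 := by
  have hdiag : Measurable fun a : U => (a, a) := measurable_id.prodMk measurable_id
  refine le_antisymm (iInf₂_le_of_le (ν.1.map fun a => (a, a)) ⟨?_, ?_⟩ ?_) zero_le
  · rw [Measure.map_map measurable_fst hdiag]
    exact Measure.map_id
  · rw [Measure.map_map measurable_snd hdiag]
    exact Measure.map_id
  · have hcost : ∫⁻ p : U × U, edist p.1 p.2 ^ 2 ∂ν.1.map (fun a => (a, a)) = 0 :=
      le_antisymm ((lintegral_map_le _ _).trans (by simp)) zero_le
    simp [hcost]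

section Borel

variable [SecondCountableTopology U] [BorelSpace U]

theorem lintegral_edist_le_rpow_lintegral_sq {π : Measure (U × U)} [IsProbabilityMeasure π] :
    ∫⁻ p, edist p.1 p.2 ∂π ≤ (∫⁻ p, edist p.1 p.2 ^ 2 ∂π) ^ (1 / 2 : ℝ) := by
  simpa using ENNReal.lintegral_mul_le_Lp_mul_Lq π Real.HolderConjugate.two_two
    measurable_edist.aemeasurable (aemeasurable_const (b := (1 : ℝ≥0∞)))

variable {W : Type*} [NormedAddCommGroup W] [NormedSpace ℝ W] {f : U → W} {L : NNReal}

theorem enorm_integral_map_fst_sub_integral_map_snd_le {π : Measure (U × U)}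
    (hf : LipschitzWith L f) (h₁ : Integrable f (π.map Prod.fst))
    (h₂ : Integrable f (π.map Prod.snd)) :
    ‖∫ a, f a ∂π.map Prod.fst - ∫ a, f a ∂π.map Prod.snd‖ₑ ≤ L * ∫⁻ p, edist p.1 p.2 ∂π := by
  have hf₁ : Integrable (fun p : U × U => f p.1) π := h₁.comp_measurable measurable_fst
  have hf₂ : Integrable (fun p : U × U => f p.2) π := h₂.comp_measurable measurable_snd
  rw [integral_map measurable_fst.aemeasurable h₁.1, integral_map measurable_snd.aemeasurable h₂.1,
    ← integral_sub hf₁ hf₂, ← lintegral_const_mul _ measurable_edist]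
  refine (enorm_integral_le_lintegral_enorm _).trans (lintegral_mono fun p => ?_)
  rw [← edist_eq_enorm_sub]
  exact hf p.1 p.2

theorem enorm_integral_sub_integral_le_W2 [CompleteSpace W] {μ ν : P2 U} (hf : LipschitzWith L f)
    (hμ : Integrable f μ.1) (hν : Integrable f ν.1) :
    ‖∫ a, f a ∂μ.1 - ∫ a, f a ∂ν.1‖ₑ ≤ L * W2 μ ν := by
  rcases eq_or_ne L 0 with rfl | hL
  · obtain ⟨a₀⟩ := ν.1.nonempty_of_neZero
    have hconst (a : U) : f a = f a₀ := edist_le_zero.1 (by simpa using hf a a₀)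
    simp only [hconst, integral_const, probReal_univ, sub_self, enorm_zero, zero_le]
  have hL₀ : (L : ℝ≥0∞) ≠ 0 := ENNReal.coe_ne_zero.2 hL
  rw [W2, ENNReal.mul_iInf_of_ne hL₀ ENNReal.coe_ne_top]
  refine le_iInf fun π => ?_
  rw [ENNReal.mul_iInf_of_ne hL₀ ENNReal.coe_ne_top]
  refine le_iInf fun ⟨h₁, h₂⟩ => ?_
  have : IsProbabilityMeasure (π.map Prod.fst) := h₁ ▸ μ.2.1
  have : IsProbabilityMeasure π := Measure.isProbabilityMeasure_of_map Prod.fst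
  rw [← h₁] at hμ ⊢
  rw [← h₂] at hν ⊢
  exact (enorm_integral_map_fst_sub_integral_map_snd_le hf hμ hν).trans
    (by gcongr; exact lintegral_edist_le_rpow_lintegral_sq)

theorem tendsto_toProbabilityMeasure_of_tendsto_W2 {ι : Type*} {l : Filter ι}
    [l.IsCountablyGenerated] {μ : ι → P2 U} {ν : P2 U}
    (h : Tendsto (fun i => W2 (μ i) ν) l (𝓝 0)) :
    Tendsto (fun i => (μ i).toProbabilityMeasure) l (𝓝 ν.toProbabilityMeasure) := by
  rw [tendsto_iff_forall_lipschitz_integral_tendsto]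
  rintro g ⟨B, hB⟩ ⟨M, hM⟩
  obtain ⟨a₀⟩ := ν.1.nonempty_of_neZero
  have hint (m : P2 U) : Integrable g m.1 :=
    Integrable.of_bound hM.continuous.aestronglyMeasurable (‖g a₀‖ + B)
      (Eventually.of_forall fun a => norm_le_of_mem_closedBall (hB a a₀))
  rw [tendsto_iff_edist_tendsto_0]
  refine tendsto_of_tendsto_of_tendsto_of_le_of_le tendsto_const_nhds ?_ (fun _ => zero_le)
    fun i => (edist_eq_enorm_sub _ _).trans_le
      (enorm_integral_sub_integral_le_W2 hM (hint _) (hint _))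
  simpa only [mul_zero] using ENNReal.Tendsto.const_mul h (Or.inr ENNReal.coe_ne_top)

end Borel

theorem integrable_of_continuous_of_norm_le [OpensMeasurableSpace U] {W : Type*}
    [NormedAddCommGroup W] [SecondCountableTopologyEither U W] (ν : P2 U) {f : U → W} {C : ℝ}
    (hf : Continuous f) (hC : ∀ a, ‖f a‖ ≤ C) : Integrable f ν.1 :=
  Integrable.of_bound hf.aestronglyMeasurable C (Eventually.of_forall hC)

theorem tendsto_integral_of_tendsto_toProbabilityMeasure [OpensMeasurableSpace U] {m : ℕ}
    {ι : Type*} {l : Filter ι} {μ : ι → P2 U} {ν : P2 U}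
    (h : Tendsto (fun i => (μ i).toProbabilityMeasure) l (𝓝 ν.toProbabilityMeasure)) {f : U → E m}
    {C : ℝ} (hf : Continuous f) (hC : ∀ a, ‖f a‖ ≤ C) :
    Tendsto (fun i => ∫ a, f a ∂(μ i).1) l (𝓝 (∫ a, f a ∂ν.1)) := by
  rw [(EuclideanSpace.equiv (Fin m) ℝ).toHomeomorph.isInducing.tendsto_nhds_iff, tendsto_pi_nhds]
  intro i
  have happly (ρ : P2 U) : (∫ a, f a ∂ρ.1) i = ∫ a, f a i ∂ρ.1 :=
    ((EuclideanSpace.proj (𝕜 := ℝ) i).integral_comp_comm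
      (integrable_of_continuous_of_norm_le ρ hf hC)).symm
  have hi := ProbabilityMeasure.tendsto_iff_forall_integral_tendsto.1 h
    (BoundedContinuousFunction.ofNormedAddCommGroup (fun a => f a i)
      ((EuclideanSpace.proj (𝕜 := ℝ) i).continuous.comp hf) C
      fun a => (PiLp.norm_apply_le (f a) i).trans (hC a))
  exact (hi.congr fun j => (happly (μ j)).symm).trans (happly ν ▸ le_rfl)

end Wasserstein

section Controls

variable {U : Type*} [MetricSpace U] [MeasurableSpace U] {K : Set (P2 U)} {ε L s T : ℝ}
  {γ : ℝ → P2 U}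

theorem tendsto_W2_of_mem_controls (hε : 0 < ε) (hγ : γ ∈ controls K ε L s T) {r : ℝ}
    (hr : r ∈ Icc s T) : Tendsto (fun t => W2 (γ t) (γ r)) (𝓝[Icc s T] r) (𝓝 0) := by
  have hmodulus : Continuous fun t : ℝ => ENNReal.ofReal (L * |r - t| ^ ε) :=
    ENNReal.continuous_ofReal.comp (continuous_const.mul
      ((continuous_const.sub continuous_id).abs.rpow_const fun _ => Or.inr hε.le))
  have hzero : Tendsto (fun t : ℝ => ENNReal.ofReal (L * |r - t| ^ ε)) (𝓝[Icc s T] r) (𝓝 0) := by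
    simpa [Real.zero_rpow hε.ne'] using (hmodulus.tendsto r).mono_left nhdsWithin_le_nhds
  exact tendsto_of_tendsto_of_tendsto_of_le_of_le' tendsto_const_nhds hzero
    (Eventually.of_forall fun _ => zero_le)
    (eventually_nhdsWithin_of_forall fun t ht => hγ.2 t ht r hr)

theorem controls_nonempty (hK : K.Nonempty) : (controls K ε L s T).Nonempty := by
  obtain ⟨ν, hν⟩ := hK
  exact ⟨fun _ => ν, fun _ _ => hν, fun _ _ _ _ => (W2_self ν).trans_le zero_le⟩

end Controls

section AveragedDrift

variable {m : ℕ} {U : Type*} [MetricSpace U] {T C : ℝ} {b : ℝ → E m → U → E m}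

theorem continuous_of_forall_eventually_norm_sub_le {W : Type*} [SeminormedAddCommGroup W]
    {f : U → W} (hf : ∀ a, ∀ᶠ a' in 𝓝 a, ‖f a' - f a‖ ≤ C * dist a' a) : Continuous f := by
  refine continuous_iff_continuousAt.2 fun a => tendsto_iff_norm_sub_tendsto_zero.2 ?_
  have hlim : Tendsto (fun a' => C * dist a' a) (𝓝 a) (𝓝 0) := by
    simpa using (show Continuous fun a' => C * dist a' a by fun_prop).tendsto a
  exact squeeze_zero' (Eventually.of_forall fun _ => norm_nonneg _) (hf a) hlim

variable [MeasurableSpace U]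

/-- The drift averaged over the control, `(r, x) ↦ ∫_U b(r, x, a) γ_r(da)`: the state equation
depends on the control only through this vector field. -/
def averagedDrift (b : ℝ → E m → U → E m) (γ : ℝ → P2 U) (r : ℝ) (x : E m) : E m :=
  ∫ a, b r x a ∂(γ r).1

variable [SecondCountableTopology U] [BorelSpace U]

theorem tendsto_integral_of_mem_controls {K : Set (P2 U)} {ε L s : ℝ} {γ : ℝ → P2 U} (hε : 0 < ε)
    (hγ : γ ∈ controls K ε L s T) {r : ℝ} (hr : r ∈ Icc s T) {f : ℝ → U → E m}
    (hcont : ∀ t ∈ Icc s T, Continuous (f t)) (hC : ∀ t ∈ Icc s T, ∀ a, ‖f t a‖ ≤ C)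
    (hunif : ∀ η > 0, ∀ᶠ t in 𝓝[Icc s T] r, ∀ a, ‖f t a - f r a‖ ≤ η) :
    Tendsto (fun t => ∫ a, f t a ∂(γ t).1) (𝓝[Icc s T] r) (𝓝 (∫ a, f r a ∂(γ r).1)) := by
  have hweak : Tendsto (fun t => ∫ a, f r a ∂(γ t).1) (𝓝[Icc s T] r) (𝓝 (∫ a, f r a ∂(γ r).1)) :=
    tendsto_integral_of_tendsto_toProbabilityMeasure
      (tendsto_toProbabilityMeasure_of_tendsto_W2 (tendsto_W2_of_mem_controls hε hγ hr))
      (hcont r hr) (hC r hr)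
  refine tendsto_of_tendsto_of_dist hweak (Metric.tendsto_nhds.2 fun η hη => ?_)
  filter_upwards [hunif (η / 2) (half_pos hη), self_mem_nhdsWithin] with t ht htmem
  have hint {q : ℝ} (hq : q ∈ Icc s T) : Integrable (f q) (γ t).1 :=
    integrable_of_continuous_of_norm_le _ (hcont q hq) (hC q hq)
  rw [Real.dist_0_eq_abs, abs_of_nonneg dist_nonneg, dist_comm, dist_eq_norm]
  exact (norm_integral_sub_integral_le_of_norm_sub_le (hint htmem) (hint hr) ht).trans_lt
    (half_lt_self hη)

theorem DriftRegular.exists_driftField (hb : DriftRegular T b) :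
    ∃ C : ℝ, ∀ K : Set (P2 U), ∀ ε L s : ℝ, 0 < ε → 0 ≤ s → ∀ γ ∈ controls K ε L s T,
      DriftField s T C (averagedDrift b γ) := by
  obtain ⟨⟨C, hC⟩, hunif⟩ := hb
  refine ⟨C, fun K ε L s hε hs γ hγ => ?_⟩
  have hmem {r : ℝ} (hr : r ∈ Icc s T) : r ∈ Icc 0 T := ⟨hs.trans hr.1, hr.2⟩
  have hcont (x : E m) (r : ℝ) (hr : r ∈ Icc s T) : Continuous (b r x) :=
    continuous_of_forall_eventually_norm_sub_le fun a => ((hC r (hmem hr) a).2 x).2.2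
  have hbound (x : E m) (r : ℝ) (hr : r ∈ Icc s T) (a : U) : ‖b r x a‖ ≤ C :=
    ((hC r (hmem hr) a).2 x).1
  have hint {r : ℝ} (hr : r ∈ Icc s T) (x : E m) : Integrable (b r x) (γ r).1 :=
    integrable_of_continuous_of_norm_le _ (hcont x r hr) (hbound x r hr)
  refine ⟨fun r hr x => ?_, fun r hr x y => ?_, fun x r hr => ?_⟩
  · simpa only [averagedDrift, probReal_univ, mul_one] using
      norm_integral_le_of_norm_le_const (μ := (γ r).1) (Eventually.of_forall (hbound x r hr))
  · refine norm_integral_sub_integral_le_of_norm_sub_le (hint hr x) (hint hr y) fun a => ?_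
    exact norm_sub_le_of_norm_fderiv_le ((hC r (hmem hr) a).1.differentiable one_ne_zero)
      (fun x => ((hC r (hmem hr) a).2 x).2.1) x y
  · refine tendsto_integral_of_mem_controls hε hγ hr (hcont x) (hbound x) fun η hη => ?_
    obtain ⟨δ, hδ, hclose⟩ := hunif x η hη
    filter_upwards [mem_nhdsWithin_of_mem_nhds (Metric.ball_mem_nhds r hδ), self_mem_nhdsWithin]
      with t ht htmem
    exact hclose t (hmem htmem) r (hmem hr) ht

end AveragedDrift

section DiagonalMeasurability

variable {Ω W : Type*} [MeasurableSpace Ω] [TopologicalSpace W]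
  [TopologicalSpace.PseudoMetrizableSpace W] {μ : Measure Ω} {S : Set Ω} {f : Ω → Ω → W}

theorem aestronglyMeasurable_apply_simpleFunc (hS : MeasurableSet S)
    (hmeas : ∀ q ∈ S, AEStronglyMeasurable (f q) (μ.restrict S)) (φ : SimpleFunc Ω Ω)
    (hφ : ∀ r, φ r ∈ S) : AEStronglyMeasurable (fun r => f (φ r) r) (μ.restrict S) := by
  have hcover : S = ⋃ q : φ.range, S ∩ φ ⁻¹' {q.1} := by
    rw [← inter_iUnion, inter_eq_left.2]
    exact fun r _ => mem_iUnion.2 ⟨⟨φ r, φ.mem_range_self r⟩, rfl⟩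
  rw [hcover, aestronglyMeasurable_iUnion_iff]
  rintro ⟨q, hq⟩
  obtain ⟨r₀, rfl⟩ := SimpleFunc.mem_range.1 hq
  refine ((hmeas _ (hφ r₀)).mono_measure (Measure.restrict_mono inter_subset_left le_rfl)).congr ?_
  filter_upwards [ae_restrict_mem (hS.inter (φ.measurableSet_preimage _))] with r hr
  rw [show φ r = φ r₀ from hr.2]

theorem aestronglyMeasurable_diagonal [PseudoEMetricSpace Ω] [SecondCountableTopology Ω]
    [OpensMeasurableSpace Ω] (hS : MeasurableSet S)
    (hmeas : ∀ q ∈ S, AEStronglyMeasurable (f q) (μ.restrict S))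
    (hcont : ∀ r ∈ S, ContinuousWithinAt (fun q => f q r) S r) :
    AEStronglyMeasurable (fun r => f r r) (μ.restrict S) := by
  rcases S.eq_empty_or_nonempty with rfl | ⟨q₀, hq₀⟩
  · rw [Measure.restrict_empty]
    exact aestronglyMeasurable_zero_measure _
  let φ : ℕ → SimpleFunc Ω Ω := SimpleFunc.approxOn id measurable_id S q₀ hq₀
  have hφ (n : ℕ) (r : Ω) : φ n r ∈ S := SimpleFunc.approxOn_mem measurable_id hq₀ n r
  refine aestronglyMeasurable_of_tendsto_ae atTop
    (fun n => aestronglyMeasurable_apply_simpleFunc hS hmeas (φ n) (hφ n)) ?_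
  filter_upwards [ae_restrict_mem hS] with r hr
  exact (hcont r hr).tendsto.comp (tendsto_nhdsWithin_iff.2
    ⟨SimpleFunc.tendsto_approxOn measurable_id hq₀ (subset_closure hr),
      Eventually.of_forall fun n => hφ n r⟩)

end DiagonalMeasurability

section Reward

variable {m : ℕ} {U : Type*} [MetricSpace U] [MeasurableSpace U] {T ε L s : ℝ} {K : Set (P2 U)}
  {F : ℝ → E m → P2 U → ℝ} {γ : ℝ → P2 U} {x : ℝ → E m}

theorem RewardRegular.exists_edist_le (hF : RewardRegular T K F) :
    ∃ C : ℝ, ∀ t ∈ Icc 0 T, ∀ x x', ∀ ν ∈ K, ∀ ν' ∈ K,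
      edist (F t x ν) (F t x' ν') ≤ ENNReal.ofReal C * edist x x' + ENNReal.ofReal C * W2 ν ν' := by
  obtain ⟨C, hC⟩ := hF.2
  refine ⟨C, fun t ht x x' ν hν ν' hν' => (edist_triangle _ (F t x' ν) _).trans ?_⟩
  obtain ⟨hbound, hspace, hmeasure⟩ := hC t ht
  have hC₀ : 0 ≤ C := (abs_nonneg _).trans (hbound x ν hν)
  refine add_le_add ?_ ?_
  · rw [edist_dist, edist_dist, Real.dist_eq, dist_eq_norm, ← ENNReal.ofReal_mul hC₀]
    exact ENNReal.ofReal_le_ofReal (hspace x x' ν hν)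
  · rw [edist_dist, Real.dist_eq]
    exact hmeasure x' ν hν ν' hν'

theorem RewardRegular.continuousWithinAt (hF : RewardRegular T K F) (hε : 0 < ε) (hs : 0 ≤ s)
    (hγ : γ ∈ controls K ε L s T) (hx : ContinuousOn x (Icc s T)) {r : ℝ} (hr : r ∈ Icc s T) :
    ContinuousWithinAt (fun q => F r (x q) (γ q)) (Icc s T) r := by
  obtain ⟨C, hC⟩ := hF.exists_edist_le
  have hpath := tendsto_iff_edist_tendsto_0.1 (hx r hr).tendsto
  have hcontrol := tendsto_W2_of_mem_controls hε hγ hr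
  have hzero := (ENNReal.Tendsto.const_mul hpath (Or.inr (ENNReal.ofReal_ne_top (r := C)))).add
    (ENNReal.Tendsto.const_mul hcontrol (Or.inr (ENNReal.ofReal_ne_top (r := C))))
  simp only [mul_zero, add_zero] at hzero
  refine tendsto_iff_edist_tendsto_0.2 (tendsto_of_tendsto_of_tendsto_of_le_of_le'
    tendsto_const_nhds hzero (Eventually.of_forall fun _ => zero_le)
    (eventually_nhdsWithin_of_forall fun q hq => ?_))
  exact hC r ⟨hs.trans hr.1, hr.2⟩ _ _ _ (hγ.1 q hq) _ (hγ.1 r hr)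

theorem RewardRegular.aestronglyMeasurable (hF : RewardRegular T K F) (hε : 0 < ε) (hs : 0 ≤ s)
    (hγ : γ ∈ controls K ε L s T) (hx : ContinuousOn x (Icc s T)) :
    AEStronglyMeasurable (fun r => F r (x r) (γ r)) (volume.restrict (Icc s T)) :=
  aestronglyMeasurable_diagonal (f := fun q r => F r (x q) (γ q)) measurableSet_Icc
    (fun q hq => (hF.1 (x q) (γ q) (hγ.1 q hq)).mono_measure
      (Measure.restrict_mono (Icc_subset_Icc_left hs) le_rfl))
    fun _ hr => hF.continuousWithinAt hε hs hγ hx hr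

theorem RewardRegular.intervalIntegrable (hF : RewardRegular T K F) (hε : 0 < ε)
    (hs : s ∈ Icc 0 T) (hγ : γ ∈ controls K ε L s T) (hx : ContinuousOn x (Icc s T)) :
    IntervalIntegrable (fun r => F r (x r) (γ r)) volume s T := by
  obtain ⟨C, hC⟩ := hF.2
  rw [intervalIntegrable_iff_integrableOn_Icc_of_le hs.2]
  refine IntegrableOn.of_bound measure_Icc_lt_top (hF.aestronglyMeasurable hε hs.1 hγ hx) C
    ((ae_restrict_iff' measurableSet_Icc).2 (Eventually.of_forall fun r hr => ?_))
  exact (hC r ⟨hs.1.trans hr.1, hr.2⟩).1 _ _ (hγ.1 r hr)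

theorem RewardRegular.bddAbove_objective (hF : RewardRegular T K F) {G : E m → ℝ}
    (hG : ∃ C : ℝ, ∀ x, |G x| ≤ C) (hs : s ∈ Icc 0 T) (P : (ℝ → P2 U) → (ℝ → E m) → Prop) :
    BddAbove {J | ∃ γ ∈ controls K ε L s T, ∃ x, P γ x ∧ J = objective T F G s γ x} := by
  obtain ⟨C, hC⟩ := hF.2
  obtain ⟨B, hB⟩ := hG
  refine ⟨C * (T - s) + B, ?_⟩
  rintro _ ⟨γ, hγ, x, -, rfl⟩
  have h := intervalIntegral.norm_integral_le_of_norm_le_const (a := s) (b := T) (C := C)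
    (f := fun r => F r (x r) (γ r)) fun r hr => by
      rw [uIoc_of_le hs.2] at hr
      exact (hC r ⟨hs.1.trans hr.1.le, hr.2⟩).1 _ _ (hγ.1 r ⟨hr.1.le, hr.2⟩)
  rw [abs_of_nonneg (sub_nonneg.2 hs.2)] at h
  exact add_le_add ((le_abs_self _).trans h) ((le_abs_self _).trans (hB _))

theorem RewardRegular.exists_abs_objective_sub_le (hF : RewardRegular T K F) (hε : 0 < ε) :
    ∃ C : ℝ, ∀ s ∈ Icc 0 T, ∀ γ ∈ controls K ε L s T, ∀ (G : E m → ℝ) (x x' : ℝ → E m),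
      ContinuousOn x (Icc s T) → ContinuousOn x' (Icc s T) → ∀ δ,
        (∀ r ∈ Icc s T, ‖x r - x' r‖ ≤ δ) →
        |objective T F G s γ x - objective T F G s γ x'| ≤
          C * δ * (T - s) + |G (x T) - G (x' T)| := by
  obtain ⟨C, hC⟩ := hF.2
  refine ⟨C, fun s hs γ hγ G x x' hx hx' δ hδ => ?_⟩
  have h := intervalIntegral.norm_integral_le_of_norm_le_const (a := s) (b := T) (C := C * δ)
    (f := fun r => F r (x r) (γ r) - F r (x' r) (γ r)) fun r hr => by
      rw [uIoc_of_le hs.2] at hr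
      obtain ⟨hbound, hspace, -⟩ := hC r ⟨hs.1.trans hr.1.le, hr.2⟩
      have hr' : r ∈ Icc s T := ⟨hr.1.le, hr.2⟩
      have hC₀ : 0 ≤ C := (abs_nonneg _).trans (hbound (x r) _ (hγ.1 r hr'))
      exact (hspace _ _ _ (hγ.1 r hr')).trans (by gcongr; exact hδ r hr')
  rw [intervalIntegral.integral_sub (hF.intervalIntegrable hε hs hγ hx)
    (hF.intervalIntegrable hε hs hγ hx'), abs_of_nonneg (sub_nonneg.2 hs.2)] at h
  rw [objective, objective, add_sub_add_comm]
  exact (abs_add_le _ _).trans (add_le_add h le_rfl)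

end Reward

section Drivers

variable {d : ℕ} {T α N N' ϱ : ℝ} {ζ ζ' : ℝ → E d} {A A' : ℝ → ℝ → Fin d → Fin d → ℝ}

theorem area_self_eq_zero {s : ℝ} (h : ∀ i j, delta A s s s i j = inc ζ s s i * inc ζ s s j) :
    A s s = 0 := by
  ext i j
  simpa [delta, inc] using h i j

theorem entrySum_le_of_holderBound {a b θ M : ℝ} (hA : HolderBound a b θ M A) {s t : ℝ} (hs : a ≤ s)
    (hst : s ≤ t) (ht : t ≤ b) : entrySum (A s t) ≤ d ^ 2 * M * (t - s) ^ θ :=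
  (entrySum_le _).trans (by rw [mul_assoc]; gcongr; exact hA hs hst ht)

theorem DriverBound.mono_const {a b : ℝ} (h : DriverBound a b α N ζ A) (hN : N ≤ N') :
    DriverBound a b α N' ζ A where
  path s t hs hst ht := (h.path s t hs hst ht).trans
    (mul_le_mul_of_nonneg_right hN (Real.rpow_nonneg (sub_nonneg.2 hst) _))
  area s t hs hst ht := (h.area s t hs hst ht).trans
    (mul_le_mul_of_nonneg_right hN (Real.rpow_nonneg (sub_nonneg.2 hst) _))
  chen := h.chen

theorem IsGeometricRoughPath.exists_driverBound (h : IsGeometricRoughPath T α ζ A) :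
    ∃ N, DriverBound 0 T α N ζ A := by
  have hpath := holderBound_of_holderNorm_ne_top h.holder_path.ne fun _ _ _ => sub_self _
  have harea := holderBound_of_holderNorm_ne_top h.holder_area.ne fun s hs hs' =>
    area_self_eq_zero (h.chen s s s hs le_rfl le_rfl hs')
  refine ⟨max (holderNorm 0 T α (inc ζ)).toReal (d ^ 2 * (holderNorm 0 T (2 * α) A).toReal),
    fun s t hs hst ht => ?_, fun s t hs hst ht => ?_, h.chen⟩
  · exact hpath.mono_const (le_max_left _ _) hs hst ht
  · exact (entrySum_le_of_holderBound harea hs hst ht).trans (mul_le_mul_of_nonneg_right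
      (le_max_right _ _) (Real.rpow_nonneg (sub_nonneg.2 hst) _))

/-- Two drivers with their areas are within `ϱ` of each other on `[0, T]`: the explicit form of a
bound on their rough path distance. -/
structure DriverClose (T α ϱ : ℝ) (ζ : ℝ → E d) (A : ℝ → ℝ → Fin d → Fin d → ℝ)
    (ζ' : ℝ → E d) (A' : ℝ → ℝ → Fin d → Fin d → ℝ) : Prop where
  path : ∀ s t, 0 ≤ s → s ≤ t → t ≤ T → ‖inc ζ s t - inc ζ' s t‖ ≤ ϱ * (t - s) ^ α
  area : ∀ s t, 0 ≤ s → s ≤ t → t ≤ T → entrySum (A s t - A' s t) ≤ ϱ * (t - s) ^ (2 * α)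

theorem driverClose_of_roughDist_ne_top (h : roughDist T α ζ A ζ' A' ≠ ∞)
    (hA : ∀ s, 0 ≤ s → s ≤ T → A s s = 0) (hA' : ∀ s, 0 ≤ s → s ≤ T → A' s s = 0) :
    DriverClose T α ((1 + d ^ 2) * (roughDist T α ζ A ζ' A').toReal) ζ A ζ' A' := by
  obtain ⟨hpath, harea⟩ := ENNReal.add_ne_top.1 h
  have hP := (holderBound_of_holderNorm_ne_top hpath fun _ _ _ => by simp [inc]).mono_const
    (ENNReal.toReal_mono h le_self_add)
  have hR := (holderBound_of_holderNorm_ne_top harea fun s hs hs' => by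
    rw [hA s hs hs', hA' s hs hs', sub_zero]).mono_const (ENNReal.toReal_mono h le_add_self)
  have hD : 0 ≤ (roughDist T α ζ A ζ' A').toReal := ENNReal.toReal_nonneg
  refine ⟨fun s t hs hst ht => (hP hs hst ht).trans ?_,
    fun s t hs hst ht => (entrySum_le_of_holderBound hR hs hst ht).trans ?_⟩ <;>
    refine mul_le_mul_of_nonneg_right ?_ (Real.rpow_nonneg (sub_nonneg.2 hst) _)
  · exact le_mul_of_one_le_left hD (le_add_of_nonneg_right (by positivity))
  · exact mul_le_mul_of_nonneg_right (le_add_of_nonneg_left zero_le_one) hD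

theorem DriverBound.of_driverClose (h : DriverBound 0 T α N ζ A) (h' : DriverClose T α ϱ ζ' A' ζ A)
    (hchen : ∀ s u t, 0 ≤ s → s ≤ u → u ≤ t → t ≤ T → ∀ i j,
      delta A' s u t i j = inc ζ' s u i * inc ζ' u t j) :
    DriverBound 0 T α (N + ϱ) ζ' A' where
  path s t hs hst ht := by
    rw [add_mul]
    exact (norm_le_norm_add_norm_sub' (inc ζ' s t) (inc ζ s t)).trans
      (add_le_add (h.path s t hs hst ht) (h'.path s t hs hst ht))
  area s t hs hst ht := by
    have hsplit : entrySum (A' s t) ≤ entrySum (A s t) + entrySum (A' s t - A s t) := by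
      simpa [entrySum, add_comm] using entrySum_sub_le (A' s t) 0 (A s t)
    rw [add_mul]
    exact hsplit.trans (add_le_add (h.area s t hs hst ht) (h'.area s t hs hst ht))
  chen := hchen

theorem exists_driverBound_driverClose (h : IsGeometricRoughPath T α ζ A) {ζn : ℕ → ℝ → E d}
    {An : ℕ → ℝ → ℝ → Fin d → Fin d → ℝ}
    (hchen : ∀ n s u t, 0 ≤ s → s ≤ u → u ≤ t → t ≤ T → ∀ i j,
      delta (An n) s u t i j = inc (ζn n) s u i * inc (ζn n) u t j)
    (hconv : Tendsto (fun n => roughDist T α (ζn n) (An n) ζ A) atTop (𝓝 0)) :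
    ∃ (N : ℝ) (ϱ : ℕ → ℝ), DriverBound 0 T α N ζ A ∧ (∀ n, 0 ≤ ϱ n) ∧ Tendsto ϱ atTop (𝓝 0) ∧
      ∀ᶠ n in atTop, DriverBound 0 T α N (ζn n) (An n) ∧
        DriverClose T α (ϱ n) (ζn n) (An n) ζ A := by
  obtain ⟨N, hN⟩ := h.exists_driverBound
  set ϱ : ℕ → ℝ := fun n => (1 + d ^ 2) * (roughDist T α (ζn n) (An n) ζ A).toReal
  have hlim : Tendsto ϱ atTop (𝓝 0) := by
    simpa [ϱ] using ((ENNReal.tendsto_toReal ENNReal.zero_ne_top).comp hconv).const_mul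
      (1 + (d : ℝ) ^ 2)
  refine ⟨N + 1, ϱ, hN.mono_const (by linarith),
    fun n => mul_nonneg (by positivity) ENNReal.toReal_nonneg, hlim, ?_⟩
  filter_upwards [hconv.eventually_lt_const ENNReal.zero_lt_top,
    hlim.eventually_le_const zero_lt_one] with n hfinite hn
  have hclose : DriverClose T α (ϱ n) (ζn n) (An n) ζ A :=
    driverClose_of_roughDist_ne_top hfinite.ne
      (fun s hs hs' => area_self_eq_zero (hchen n s s s hs le_rfl le_rfl hs'))
      (fun s hs hs' => area_self_eq_zero (h.chen s s s hs le_rfl le_rfl hs'))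
  exact ⟨(hN.of_driverClose hclose (hchen n)).mono_const (by linarith), hclose⟩

end Drivers

section StateEquation

variable {m d : ℕ} {T α C s : ℝ}

theorem DriftField.mono {β : ℝ → E m → E m} {a b C' : ℝ} (h : DriftField a b C β) (hC : C ≤ C') :
    DriftField a b C' β where
  bound r hr x := (h.bound r hr x).trans hC
  lip r hr x y := (h.lip r hr x y).trans (by gcongr)
  cont := h.cont

theorem DiffusionRegular.exists_fieldRegular {σ : ℝ → E m → E d →L[ℝ] E m}
    (hσ : DiffusionRegular T σ) (hT : 0 ≤ T) : ∃ C, FieldRegular T C σ := by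
  obtain ⟨C, hspace, htime⟩ := hσ
  have hC3 (t : ℝ) (ht : t ∈ Icc 0 T) : BoundedC3 C (σ t) := ⟨(hspace t ht).1, (hspace t ht).2⟩
  refine ⟨_, .of_boundedC3 (hC3 0 ⟨le_rfl, hT⟩).nonneg hC3 fun s hs t ht x => ?_⟩
  exact (convex_Icc 0 T).norm_image_sub_le_of_norm_derivWithin_le
    ((htime x).1.differentiableOn one_ne_zero) (htime x).2 hs ht

theorem DrivenSolution.eqOn {β : ℝ → E m → E m} {σ : ℝ → E m → E d →L[ℝ] E m} {ζ : ℝ → E d}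
    {A : ℝ → ℝ → Fin d → Fin d → ℝ} {x x' : ℝ → E m} (H : RoughData T α C σ)
    (hx : DrivenSolution s T α C β σ ζ A x) (hx' : DrivenSolution s T α C β σ ζ A x')
    (hinit : x s = x' s) : EqOn x x' (Icc s T) := by
  obtain ⟨K, -, hK⟩ := H.exists_norm_sub_le
  intro t ht
  have h := hK s β ζ A x ζ A x' 0 hx hx' le_rfl (fun _ _ _ _ _ => by simp)
    (fun _ _ _ _ _ => by simp [entrySum]) t ht
  rw [hinit, sub_self, norm_zero, add_zero, mul_zero] at h
  exact sub_eq_zero.1 (norm_le_zero_iff.1 h)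

variable {U : Type*} [MetricSpace U] [MeasurableSpace U] {b : ℝ → E m → U → E m}
  {σ : ℝ → E m → E d →L[ℝ] E m} {ζ : ℝ → E d} {γ : ℝ → P2 U} {x : ℝ → E m} {y : E m}

section Classical

theorem isClassicalSolution_iff (hT : 0 < T) (hζ : ContDiffOn ℝ 1 ζ (Icc 0 T))
    (hβ : DriftField s T C (averagedDrift b γ)) (hσ : FieldRegular T C σ) (hs : 0 ≤ s) :
    IsClassicalSolution T b σ ζ s y γ x ↔ ContinuousOn x (Icc s T) ∧ ∀ t ∈ Icc s T,
      x t = y + driftIncrement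
        (fun t x => averagedDrift b γ t x + σ t x (pathDeriv T ζ t)) x s t := by
  refine and_congr_right fun hx => forall₂_congr fun t ht => ?_
  have hξ := pathDeriv_continuousOn hT hζ
  obtain ⟨B, hB⟩ := isCompact_Icc.exists_bound_of_continuousOn hξ
  have hdrift := hβ.intervalIntegrable hx le_rfl ht.1 ht.2
  have hnoise : IntervalIntegrable (fun r => σ r (x r) (pathDeriv T ζ r)) volume s t := by
    simpa using ((hβ.add_field_apply hσ hs hξ hB).intervalIntegrable hx le_rfl ht.1 ht.2).sub hdrift
  rw [driftIncrement, intervalIntegral.integral_add hdrift hnoise, ← add_assoc]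
  rfl

theorem exists_isClassicalSolution (hT : 0 < T) (hζ : ContDiffOn ℝ 1 ζ (Icc 0 T))
    (hβ : DriftField s T C (averagedDrift b γ)) (hσ : FieldRegular T C σ) (hs : s ∈ Icc 0 T)
    (y : E m) : ∃ x, IsClassicalSolution T b σ ζ s y γ x ∧
      ∀ x', IsClassicalSolution T b σ ζ s y γ x' → EqOn x' x (Icc s T) := by
  have hξ := pathDeriv_continuousOn hT hζ
  obtain ⟨B, hB⟩ := isCompact_Icc.exists_bound_of_continuousOn hξ
  have hB₀ : 0 ≤ B := (norm_nonneg _).trans (hB s hs)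
  have hC : 0 ≤ C := hσ.field.nonneg
  have hv := hβ.add_field_apply hσ hs.1 hξ hB
  obtain ⟨x, hx, h⟩ := hv.exists_integral_solution hs.2 (by positivity) y
  refine ⟨x, (isClassicalSolution_iff hT hζ hβ hσ hs.1).2 ⟨hx, h⟩, fun x' hx' => ?_⟩
  obtain ⟨hx', h'⟩ := (isClassicalSolution_iff hT hζ hβ hσ hs.1).1 hx'
  exact hv.integral_solution_unique hx' hx h' h

theorem IsClassicalSolution.apply_left (h : IsClassicalSolution T b σ ζ s y γ x) (hsT : s ≤ T) :
    x s = y := by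
  simpa using h.2 s ⟨le_rfl, hsT⟩

theorem IsClassicalSolution.drivenSolution (h : IsClassicalSolution T b σ ζ s y γ x) (hT : 0 < T)
    (hζ : ContDiffOn ℝ 1 ζ (Icc 0 T)) (hβ : DriftField s T C (averagedDrift b γ))
    (hσ : FieldRegular T C σ) (hs : 0 ≤ s) (hA : DriverBound 0 T α C ζ (canonicalArea T ζ)) :
    DrivenSolution s T α C (averagedDrift b γ) σ ζ (canonicalArea T ζ) x := by
  obtain ⟨hx, h⟩ := (isClassicalSolution_iff hT hζ hβ hσ hs).1 h
  exact ⟨hs, hβ, hA.mono hs le_rfl, davieSolution_of_integral_solution hT hζ hβ hσ hs hx h⟩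

end Classical

section Rough

variable {A : ℝ → ℝ → Fin d → Fin d → ℝ}

theorem IsRoughSolution.drivenSolution (h : IsRoughSolution T α b σ ζ A s y γ x)
    (hβ : DriftField s T C (averagedDrift b γ)) (hs : 0 ≤ s) (hA : DriverBound 0 T α C ζ A) :
    DrivenSolution s T α C (averagedDrift b γ) σ ζ A x := by
  obtain ⟨-, κ, hκ, -, hcontrolled, hintegral⟩ := h
  exact ⟨hs, hβ, hA.mono hs le_rfl, davieSolution_of_isRoughIntegral hκ hcontrolled hintegral⟩

theorem DrivenSolution.isRoughSolution (H : RoughData T α C σ)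
    (hx : DrivenSolution s T α C (averagedDrift b γ) σ ζ A x) (hy : x s = y) :
    IsRoughSolution T α b σ ζ A s y γ x :=
  ⟨hy, hx.exists_isControlled_isRoughIntegral H⟩

end Rough

end StateEquation

section Suprema

theorem sSup_le_sSup_add {S S' : Set ℝ} {η : ℝ} (hS : S.Nonempty) (hS' : BddAbove S')
    (h : ∀ x ∈ S, ∃ y ∈ S', x ≤ y + η) : sSup S ≤ sSup S' + η :=
  csSup_le hS fun x hx => by
    obtain ⟨y, hy, hxy⟩ := h x hx
    linarith [le_csSup hS' hy]

theorem abs_sSup_sub_sSup_le {S S' : Set ℝ} {η : ℝ} (hne : S.Nonempty) (hS : BddAbove S)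
    (hS' : BddAbove S') (h : ∀ x ∈ S, ∃ y ∈ S', |x - y| ≤ η)
    (h' : ∀ y ∈ S', ∃ x ∈ S, |x - y| ≤ η) : |sSup S - sSup S'| ≤ η := by
  have hne' : S'.Nonempty := hne.elim fun x hx => (h x hx).imp fun _ hy => hy.1
  have hle := sSup_le_sSup_add hne hS' fun x hx => (h x hx).imp fun y hy =>
    ⟨hy.1, sub_le_iff_le_add'.1 (le_of_abs_le hy.2)⟩
  have hge := sSup_le_sSup_add hne' hS fun y hy => (h' y hy).imp fun x hx =>
    ⟨hx.1, sub_le_iff_le_add'.1 (le_of_abs_le ((abs_sub_comm y x).trans_le hx.2))⟩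
  exact abs_sub_le_iff.2 ⟨sub_le_iff_le_add'.2 hle, sub_le_iff_le_add'.2 hge⟩

end Suprema

theorem exists_pos_forall_abs_sub_le {X : Type*} [NormedAddCommGroup X] [ProperSpace X] {G : X → ℝ}
    (hG : Continuous G) (R : ℝ) {η : ℝ} (hη : 0 < η) :
    ∃ δ > 0, ∀ x x', ‖x‖ ≤ R → ‖x - x'‖ ≤ δ → |G x - G x'| ≤ η := by
  have h := (isCompact_closedBall (0 : X) R).uniformContinuousAt_of_continuousAt G
    (fun x _ => hG.continuousAt) (Metric.dist_mem_uniformity hη)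
  obtain ⟨δ, hδ, hclose⟩ := Metric.mem_uniformity_dist.1 h
  refine ⟨δ / 2, half_pos hδ, fun x x' hx hxx' => (hclose (b := x') ?_ ?_).le⟩
  · rw [dist_eq_norm]
    exact hxx'.trans_lt (half_lt_self hδ)
  · exact mem_closedBall_zero_iff.2 hx

section Approximation

variable {m d : ℕ} {U : Type*} [MetricSpace U] [MeasurableSpace U] {T α C ε L : ℝ}
  {b : ℝ → E m → U → E m} {σ : ℝ → E m → E d →L[ℝ] E m} {K : Set (P2 U)} {ζ : ℝ → E d}
  {A : ℝ → ℝ → Fin d → Fin d → ℝ} {ζn : ℕ → ℝ → E d} {ϱ : ℕ → ℝ}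

/-- Smooth drivers `ζn` approximating the rough path `(ζ, A)` at rate `ϱ`, together with bounds by
one constant `C`, uniform in the controls and eventually in `n`, on all data of the state
equations. -/
structure ApproximationScheme (T α C ε L : ℝ) (b : ℝ → E m → U → E m)
    (σ : ℝ → E m → E d →L[ℝ] E m) (K : Set (P2 U)) (ζ : ℝ → E d)
    (A : ℝ → ℝ → Fin d → Fin d → ℝ) (ζn : ℕ → ℝ → E d) (ϱ : ℕ → ℝ) : Prop where
  pos : 0 < T
  rough : RoughData T α C σ
  drift : ∀ s ∈ Icc 0 T, ∀ γ ∈ controls K ε L s T, DriftField s T C (averagedDrift b γ)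
  driver : DriverBound 0 T α C ζ A
  smooth : ∀ n, ContDiffOn ℝ 1 (ζn n) (Icc 0 T)
  error_nonneg : ∀ n, 0 ≤ ϱ n
  error_tendsto : Tendsto ϱ atTop (𝓝 0)
  eventually_driver : ∀ᶠ n in atTop, DriverBound 0 T α C (ζn n) (canonicalArea T (ζn n)) ∧
    DriverClose T α (ϱ n) (ζn n) (canonicalArea T (ζn n)) ζ A

theorem exists_approximationScheme [SecondCountableTopology U] [BorelSpace U] (hT : 0 < T)
    (hα : 1 / 3 < α) (hε : 0 < ε) (hb : DriftRegular T b) (hσ : DiffusionRegular T σ)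
    (hζ : IsGeometricRoughPath T α ζ A) (hζn : ∀ n, ContDiffOn ℝ 1 (ζn n) (Icc 0 T))
    (hconv : Tendsto (fun n => roughDist T α (ζn n) (canonicalArea T (ζn n)) ζ A) atTop (𝓝 0)) :
    ∃ C ϱ, ApproximationScheme T α C ε L b σ K ζ A ζn ϱ := by
  obtain ⟨B, hB⟩ := hb.exists_driftField
  obtain ⟨M, hM⟩ := hσ.exists_fieldRegular hT.le
  obtain ⟨N, ϱ, hN, hϱ, hlim, hclose⟩ := exists_driverBound_driverClose hζ
    (fun n _ _ _ => canonicalArea_chen hT (hζn n)) hconv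
  obtain ⟨C, hBC, hMC, hNC, hC⟩ : ∃ C, B ≤ C ∧ M ≤ C ∧ N ≤ C ∧ 1 ≤ C :=
    ⟨max (max B M) (max N 1), by simp⟩
  exact ⟨C, ϱ, hT, ⟨hα, hC, hM.mono hMC⟩,
    fun s hs γ hγ => (hB K ε L s hε hs.1 γ hγ).mono hBC, hN.mono_const hNC, hζn, hϱ, hlim,
    hclose.mono fun n hn => ⟨hn.1.mono_const hNC, hn.2⟩⟩

namespace ApproximationScheme

variable (h : ApproximationScheme T α C ε L b σ K ζ A ζn ϱ) {s : ℝ} {γ : ℝ → P2 U}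
include h

theorem exists_classicalSolution (hs : s ∈ Icc 0 T) (hγ : γ ∈ controls K ε L s T) (y : E m)
    (n : ℕ) : ∃ x, IsClassicalSolution T b σ (ζn n) s y γ x ∧
      ∀ x', IsClassicalSolution T b σ (ζn n) s y γ x' → EqOn x' x (Icc s T) :=
  exists_isClassicalSolution h.pos (h.smooth n) (h.drift s hs γ hγ) h.rough.field hs y

theorem exists_solutionApprox (hs : s ∈ Icc 0 T) (hγ : γ ∈ controls K ε L s T) (y : E m) :
    ∃ (ζn' : ℕ → ℝ → E d) (An' : ℕ → ℝ → ℝ → Fin d → Fin d → ℝ) (xn : ℕ → ℝ → E m) (ϱ' : ℕ → ℝ),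
      SolutionApprox s T α C (averagedDrift b γ) σ ζ A ζn' An' xn ϱ' ∧ ∀ n, xn n s = y := by
  obtain ⟨k, hk⟩ := eventually_atTop.1 h.eventually_driver
  replace hk := fun n => hk (n + k) (Nat.le_add_left k n)
  choose x hx _ using h.exists_classicalSolution hs hγ y
  refine ⟨fun n => ζn (n + k), fun n => canonicalArea T (ζn (n + k)), fun n => x (n + k),
    fun n => ϱ (n + k), ⟨fun n => ?_, fun n => h.error_nonneg _,
      (tendsto_add_atTop_iff_nat k).2 h.error_tendsto,
      fun n r t hr => (hk n).2.path r t (hs.1.trans hr),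
      fun n r t hr => (hk n).2.area r t (hs.1.trans hr)⟩, fun n => (hx (n + k)).apply_left hs.2⟩
  exact (hx (n + k)).drivenSolution h.pos (h.smooth _) (h.drift s hs γ hγ) h.rough.field hs.1
    (hk n).1

theorem exists_roughSolution (hs : s ∈ Icc 0 T) (hγ : γ ∈ controls K ε L s T) (y : E m) :
    ∃ x, IsRoughSolution T α b σ ζ A s y γ x ∧
      ∀ x', IsRoughSolution T α b σ ζ A s y γ x' → EqOn x' x (Icc s T) := by
  obtain ⟨ζn', An', xn, ϱ', happrox, hxn⟩ := h.exists_solutionApprox hs hγ y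
  obtain ⟨x, hx, hxs⟩ := happrox.exists_drivenSolution h.rough hs.2
    (fun r u t hr => h.driver.chen r u t (hs.1.trans hr)) hxn
  exact ⟨x, hx.isRoughSolution h.rough hxs, fun x' hx' =>
    (hx'.drivenSolution (h.drift s hs γ hγ) hs.1 h.driver).eqOn h.rough hx (hx'.1.trans hxs.symm)⟩

theorem eventually_norm_sub_le {δ : ℝ} (hδ : 0 < δ) :
    ∀ᶠ n in atTop, ∀ s ∈ Icc 0 T, ∀ γ ∈ controls K ε L s T, ∀ y x x',
      IsRoughSolution T α b σ ζ A s y γ x → IsClassicalSolution T b σ (ζn n) s y γ x' →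
      ∀ r ∈ Icc s T, ‖x r - x' r‖ ≤ δ := by
  obtain ⟨K', -, hstable⟩ := h.rough.exists_norm_sub_le
  have hlim : Tendsto (fun n => K' * ϱ n) atTop (𝓝 0) := by
    simpa only [mul_zero] using h.error_tendsto.const_mul K'
  filter_upwards [h.eventually_driver, hlim.eventually_le_const hδ]
    with n hn hnδ s hs γ hγ y x x' hx hx' r hr
  have hβ := h.drift s hs γ hγ
  have hle := hstable s _ _ _ x' _ _ x (ϱ n)
    (hx'.drivenSolution h.pos (h.smooth n) hβ h.rough.field hs.1 hn.1)
    (hx.drivenSolution hβ hs.1 h.driver) (h.error_nonneg n)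
    (fun r t hr => hn.2.path r t (hs.1.trans hr)) (fun r t hr => hn.2.area r t (hs.1.trans hr)) r hr
  rw [hx.1, hx'.apply_left hs.2, sub_self, norm_zero, zero_add, norm_sub_rev] at hle
  exact hle.trans hnδ

variable {F : ℝ → E m → P2 U → ℝ} {G : E m → ℝ}

theorem eventually_abs_terminal_sub_le (hG : Continuous G) (R : ℝ) {η : ℝ} (hη : 0 < η) :
    ∀ᶠ n in atTop, ∀ s ∈ Icc 0 T, ∀ γ ∈ controls K ε L s T, ∀ y x x', ‖y‖ ≤ R →
      IsRoughSolution T α b σ ζ A s y γ x → IsClassicalSolution T b σ (ζn n) s y γ x' →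
      |G (x T) - G (x' T)| ≤ η := by
  obtain ⟨K', -, hgrowth⟩ := h.rough.exists_norm_sub_init_le
  obtain ⟨δ, hδ, hclose⟩ := exists_pos_forall_abs_sub_le hG (R + K') hη
  filter_upwards [h.eventually_norm_sub_le hδ] with n hn s hs γ hγ y x x' hy hx hx'
  have hT : T ∈ Icc s T := ⟨hs.2, le_rfl⟩
  have hxT := hgrowth s _ ζ A x (hx.drivenSolution (h.drift s hs γ hγ) hs.1 h.driver) T hT
  rw [hx.1] at hxT
  refine hclose _ _ ?_ (hn s hs γ hγ y x x' hx hx' T hT)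
  linarith [norm_le_norm_add_norm_sub' (x T) y]

theorem eventually_abs_objective_sub_le (hε : 0 < ε) (hF : RewardRegular T K F)
    (hG : Continuous G) (R : ℝ) {η : ℝ} (hη : 0 < η) :
    ∀ᶠ n in atTop, ∀ s ∈ Icc 0 T, ∀ γ ∈ controls K ε L s T, ∀ y x x', ‖y‖ ≤ R →
      IsRoughSolution T α b σ ζ A s y γ x → IsClassicalSolution T b σ (ζn n) s y γ x' →
      |objective T F G s γ x - objective T F G s γ x'| ≤ η := by
  obtain ⟨M, hM⟩ := hF.exists_abs_objective_sub_le (L := L) hε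
  obtain ⟨δ, hδ, hMδ⟩ := exists_pos_mul_lt (half_pos hη) (|M| * T)
  filter_upwards [h.eventually_norm_sub_le hδ, h.eventually_abs_terminal_sub_le hG R (half_pos hη)]
    with n hpath hterminal s hs γ hγ y x x' hy hx hx'
  have hcont := (hx.drivenSolution (h.drift s hs γ hγ) hs.1 h.driver).solution.cont
  have hrunning : M * δ * (T - s) ≤ |M| * δ * T := by
    have := le_abs_self M
    have := sub_nonneg.2 hs.2
    have := hs.1
    gcongr
    linarith
  have hobjective := hM s hs γ hγ G x x' hcont hx'.1 δ (hpath s hs γ hγ y x x' hx hx')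
  linarith [hterminal s hs γ hγ y x x' hy hx hx', mul_right_comm |M| T δ]

theorem eventually_abs_value_sub_le (hε : 0 < ε) (hK : K.Nonempty) (hF : RewardRegular T K F)
    (hG : Continuous G) (hGb : ∃ C : ℝ, ∀ x, |G x| ≤ C) (R : ℝ) {η : ℝ} (hη : 0 < η) :
    ∀ᶠ n in atTop, ∀ s ∈ Icc 0 T, ∀ y, ‖y‖ ≤ R →
      |roughValue T α b σ F G K ε L ζ A s y - classicalValue T b σ F G K ε L (ζn n) s y| ≤ η := by
  filter_upwards [h.eventually_abs_objective_sub_le hε hF hG R hη] with n hn s hs y hy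
  refine abs_sSup_sub_sSup_le ?_ (hF.bddAbove_objective hGb hs _) (hF.bddAbove_objective hGb hs _)
    ?_ ?_
  · obtain ⟨γ, hγ⟩ := controls_nonempty (ε := ε) (L := L) (s := s) (T := T) hK
    obtain ⟨x, hx, -⟩ := h.exists_roughSolution hs hγ y
    exact ⟨_, γ, hγ, x, hx, rfl⟩
  · rintro _ ⟨γ, hγ, x, hx, rfl⟩
    obtain ⟨x', hx', -⟩ := h.exists_classicalSolution hs hγ y n
    exact ⟨_, ⟨γ, hγ, x', hx', rfl⟩, hn s hs γ hγ y x x' hy hx hx'⟩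
  · rintro _ ⟨γ, hγ, x', hx', rfl⟩
    obtain ⟨x, hx, -⟩ := h.exists_roughSolution hs hγ y
    exact ⟨_, ⟨γ, hγ, x, hx, rfl⟩, hn s hs γ hγ y x x' hy hx hx'⟩

theorem tendstoLocallyUniformlyOn_value (hε : 0 < ε) (hK : K.Nonempty) (hF : RewardRegular T K F)
    (hG : Continuous G) (hGb : ∃ C : ℝ, ∀ x, |G x| ≤ C) :
    TendstoLocallyUniformlyOn
      (fun n (p : ℝ × E m) => classicalValue T b σ F G K ε L (ζn n) p.1 p.2)
      (fun p => roughValue T α b σ F G K ε L ζ A p.1 p.2) atTop (Icc 0 T ×ˢ univ) := by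
  refine Metric.tendstoLocallyUniformlyOn_iff.2 fun η hη p _ => ?_
  have hnhds : {q : ℝ × E m | ‖q.2‖ < ‖p.2‖ + 1} ∈ 𝓝 p :=
    (isOpen_lt (by fun_prop) continuous_const).mem_nhds (lt_add_one ‖p.2‖)
  refine ⟨_, inter_mem_nhdsWithin _ hnhds, ?_⟩
  filter_upwards [h.eventually_abs_value_sub_le hε hK hF hG hGb (‖p.2‖ + 1) (half_pos hη)]
    with n hn
  rintro ⟨s, y⟩ ⟨⟨hs, -⟩, hy⟩
  exact (hn s hs y (le_of_lt hy)).trans_lt (half_lt_self hη)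

end ApproximationScheme

end Approximation

end RoughControl

end

theorem mainTheorem7_general {m d : ℕ} {U : Type*} [MetricSpace U] [SecondCountableTopology U]
    [MeasurableSpace U] [BorelSpace U]
    (T α ε L : ℝ) (hT : 0 < T) (hα : 1 / 3 < α) (hε : 0 < ε)
    (K : Set (RoughControl.P2 U)) (hK₀ : K.Nonempty)
    (b : ℝ → RoughControl.E m → U → RoughControl.E m)
    (hb : RoughControl.DriftRegular T b)
    (σ : ℝ → RoughControl.E m → RoughControl.E d →L[ℝ] RoughControl.E m)
    (hσ : RoughControl.DiffusionRegular T σ)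
    (F : ℝ → RoughControl.E m → RoughControl.P2 U → ℝ)
    (hF : RoughControl.RewardRegular T K F)
    (G : RoughControl.E m → ℝ) (hG : Continuous G) (hGb : ∃ C : ℝ, ∀ x, |G x| ≤ C)
    (ζ : ℝ → RoughControl.E d) (A : ℝ → ℝ → Fin d → Fin d → ℝ)
    (hζ : RoughControl.IsGeometricRoughPath T α ζ A)
    (ζn : ℕ → ℝ → RoughControl.E d) (hζn : ∀ n, ContDiffOn ℝ 1 (ζn n) (Icc 0 T))
    (hconv : Tendsto (fun n => RoughControl.roughDist T α (ζn n)
      (RoughControl.canonicalArea T (ζn n)) ζ A) atTop (𝓝 0)) :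
    (∀ s ∈ Icc (0 : ℝ) T, ∀ y, ∀ γ ∈ RoughControl.controls K ε L s T,
      (∃ x, RoughControl.IsRoughSolution T α b σ ζ A s y γ x ∧
        ∀ x', RoughControl.IsRoughSolution T α b σ ζ A s y γ x' → EqOn x' x (Icc s T)) ∧
      ∀ n, ∃ x, RoughControl.IsClassicalSolution T b σ (ζn n) s y γ x ∧
        ∀ x', RoughControl.IsClassicalSolution T b σ (ζn n) s y γ x' → EqOn x' x (Icc s T)) ∧
    TendstoLocallyUniformlyOn
      (fun n (p : ℝ × RoughControl.E m) =>
        RoughControl.classicalValue T b σ F G K ε L (ζn n) p.1 p.2)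
      (fun p => RoughControl.roughValue T α b σ F G K ε L ζ A p.1 p.2)
      atTop (Icc 0 T ×ˢ univ) := by
  obtain ⟨C, ϱ, h⟩ := RoughControl.exists_approximationScheme (ε := ε) (L := L) (K := K)
    hT hα hε hb hσ hζ hζn hconv
  exact ⟨fun s hs y γ hγ =>
      ⟨h.exists_roughSolution hs hγ y, h.exists_classicalSolution hs hγ y⟩,
    h.tendstoLocallyUniformlyOn_value hε hK₀ hF hG hGb⟩

theorem mainTheorem7 {m d : ℕ} {U : Type*} [MetricSpace U] [SecondCountableTopology U]
    [MeasurableSpace U] [BorelSpace U]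
    (T α ε L : ℝ) (hT : 0 < T) (hα : 1 / 3 < α) (hε : 0 < ε) (hL : 0 < L)
    (K : Set (RoughControl.P2 U)) (hK : IsCompact K) (hK₀ : K.Nonempty)
    (b : ℝ → RoughControl.E m → U → RoughControl.E m)
    (hb : RoughControl.DriftRegular T b)
    (σ : ℝ → RoughControl.E m → RoughControl.E d →L[ℝ] RoughControl.E m)
    (hσ : RoughControl.DiffusionRegular T σ)
    (F : ℝ → RoughControl.E m → RoughControl.P2 U → ℝ)
    (hF : RoughControl.RewardRegular T K F)
    (G : RoughControl.E m → ℝ) (hG : Continuous G) (hGb : ∃ C : ℝ, ∀ x, |G x| ≤ C)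
    (ζ : ℝ → RoughControl.E d) (A : ℝ → ℝ → Fin d → Fin d → ℝ)
    (hζ : RoughControl.IsGeometricRoughPath T α ζ A)
    (ζn : ℕ → ℝ → RoughControl.E d) (hζn : ∀ n, ContDiffOn ℝ 1 (ζn n) (Icc 0 T))
    (hconv : Tendsto (fun n => RoughControl.roughDist T α (ζn n)
      (RoughControl.canonicalArea T (ζn n)) ζ A) atTop (𝓝 0)) :
    (∀ s ∈ Icc (0 : ℝ) T, ∀ y, ∀ γ ∈ RoughControl.controls K ε L s T,
      (∃ x, RoughControl.IsRoughSolution T α b σ ζ A s y γ x ∧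
        ∀ x', RoughControl.IsRoughSolution T α b σ ζ A s y γ x' → EqOn x' x (Icc s T)) ∧
      ∀ n, ∃ x, RoughControl.IsClassicalSolution T b σ (ζn n) s y γ x ∧
        ∀ x', RoughControl.IsClassicalSolution T b σ (ζn n) s y γ x' → EqOn x' x (Icc s T)) ∧
    TendstoLocallyUniformlyOn
      (fun n (p : ℝ × RoughControl.E m) =>
        RoughControl.classicalValue T b σ F G K ε L (ζn n) p.1 p.2)
      (fun p => RoughControl.roughValue T α b σ F G K ε L ζ A p.1 p.2)
      atTop (Icc 0 T ×ˢ univ) :=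
  mainTheorem7_general T α ε L hT hα hε K hK₀ b hb σ hσ F hF G hG hGb ζ A hζ ζn hζn hconv
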